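/- **Setting.** For every security parameter $\lambda$ let $n\ge 2$ be a power of $2$, $q\ge 3$ odd and $1\le B\le\frac{q-1}{2}$, with $n=O(\lambda)$, $q=\widetilde O(n^4)$, $B=\widetilde O(\sqrt n)$ (logarithms of $n$). Put $R_q=\mathbb Z_q[X]/(X^n+1)$ with coefficient embedding $\tau:R_q\to\mathbb Z_q^n$ and $\|\cdot\|_\infty$ taken over representatives in $[-\frac{q-1}2,\frac{q-1}2]$; $\delta_b=\lfloor\log_2 b\rfloor+1$, $\ell=\delta_{(q-1)/2}$, $L=9n^2\ell^2\delta_B+3n\ell\delta_B$. The relation consists of the pairs $(\mathbf c;(\mathbf a,g,\mathbf e))$ with $\mathbf c,\mathbf a,\mathbf e\in R_q^\ell$, $g\in R_q$, $\|g\|_\infty\le B$, $\|\mathbf e\|_\infty\le B$ and $\mathbf c=\mathbf a\cdot g+\mathbf e$; only $\mathbf c$ is public. **Extensions and permutations.** $[b]_3\in\{-1,0,1\}$ is the residue of $b$ modulo $3$. For $a,g,b,e\in\{-1,0,1\}$: $\mathsf{enc}_3(a)\in\{-1,0,1\}^3$ has entries $[a-i]_3$, $\mathsf{mult}_3(a,g)\in\{-1,0,1\}^9$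 has entries $[a-i]_3[g-j]_3$ ($i,j\in\{-1,0,1\}$), and $\pi_e$, $\phi_{b,e}$ permute coordinates by $\pi_e(v)^{(i)}=v^{([i-e]_3)}$, $\phi_{b,e}(v)^{(i,j)}=v^{([i-b]_3,[j-e]_3)}$. For vectors, $\mathsf{enc}(\mathbf z)$ has the blocks $\mathsf{enc}_3(z_k)$, $\mathsf{mult}(\mathbf a,\mathbf g)$ the blocks $\mathsf{mult}_3(a_k,g_m)$, and $\Pi_{\mathbf e}$, $\Phi_{\mathbf b,\mathbf e}$ act blockwise by $\pi_{e_k}$, $\phi_{b_k,e_m}$. For an integer $b\geq 1$ let $b_j=\lfloor (b+2^{j-1})/2^j\rfloor$ ($1\le j\le\delta_b$). Greedy decomposition with these weights gives $\mathbf a_i^\star\in\{-1,0,1\}^{n\ell}$ from $\tau(a_i)$ (with $b=\frac{q-1}2$) and $\mathbf g^\star\in\{-1,0,1\}^{n\delta_B}$, $\mathbf e^\star\in\{-1,0,1\}^{n\ell\delta_B}$ from $\tau(g),\tau(\mathbf e)$ (with $b=B$), so that $\tau(a_i)=\mathbf H\mathbf a_i^\star$, $\tau(g)=\mathbf H_B\mathbf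 g^\star$, $\tau(\mathbf e)=\mathbf H_{\ell,B}\mathbf e^\star$ for the block-diagonal weight matrices. The prover's vector is $\mathbf w=(\mathsf{mult}(\mathbf a_1^\star,\mathbf g^\star)\|\cdots\|\mathsf{mult}(\mathbf a_\ell^\star,\mathbf g^\star)\|\mathsf{enc}(\mathbf e^\star))\in\{-1,0,1\}^L$. $\mathsf{VALID}$ is the set of all vectors of this form for arbitrary $\{-1,0,1\}$-vectors $\mathbf a_i^\star,\mathbf g^\star,\mathbf e^\star$; $\mathcal S=(\{-1,0,1\}^{n\ell})^\ell\times\{-1,0,1\}^{n\delta_B}\times\{-1,0,1\}^{n\ell\delta_B}$; for $\eta=(\mathbf b_1,\dots,\mathbf b_\ell,\mathbf f_1,\mathbf f_2)\in\mathcal S$ the permutation $\Gamma_\eta$ acts by $\Phi_{\mathbf b_i,\mathbf f_1}$ on the $i$-th block and by $\Pi_{\mathbf f_2}$ on the last one. With $\mathbf Q_0=[\mathsf{rot}(X^0)\mathbf H\,\mathbf H_{\ell,B}|\cdots|\mathsf{rot}(X^{n-1})\mathbf H\,\mathbf H_{\ell,B}]$, where $\mathsf{rot}(a)=[\tau(a)|\tau(aX)|\cdots|\tau(aX^{n-1})]$,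 the matrix $\mathbf M\in\mathbb Z_q^{n\ell\times L}$ is $[\mathrm{diag}(\mathbf Q_0,\dots,\mathbf Q_0)|\mathbf H_{\ell,B}]$ with zero columns inserted, its columns being placed at the entries $[a]_3[g]_3$ and $[z]_3$ of the blocks; $\mathbf u=\tau(\mathbf c)$. **Protocol.** Let $\mathsf{COM}$ be a keyed string commitment scheme that is statistically hiding and computationally binding (against PPT adversaries with polynomial auxiliary input), whose coins have $O(L\log q)$ bits and whose commitments to a message $m$ have $O(|m|+L\log q)$ bits. The prover picks $\mathbf r\in\mathbb Z_q^L$, $\eta\in\mathcal S$ and coins $\rho_1,\rho_2,\rho_3$ uniformly and sends $C_1=\mathsf{COM}(\eta,\mathbf M\mathbf r;\rho_1)$, $C_2=\mathsf{COM}(\Gamma_\eta(\mathbf r);\rho_2)$, $C_3=\mathsf{COM}(\Gamma_\eta(\mathbf w+\mathbf r);\rho_3)$. The verifier sends a uniform challenge in $\{1,2,3\}$. The responses are $(\mathbf t_w,\mathbf t_r,\rho_2,\rho_3)$ with $\mathbf t_w=\Gamma_\eta(\mathbf w)$, $\mathbf t_r=\Gamma_\eta(\mathbf r)$; $(\eta,\mathbf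 w_2,\rho_1,\rho_3)$ with $\mathbf w_2=\mathbf w+\mathbf r$; $(\eta,\mathbf w_3,\rho_1,\rho_2)$ with $\mathbf w_3=\mathbf r$. The verifier checks, respectively: $\mathbf t_w\in\mathsf{VALID}$, $C_2=\mathsf{COM}(\mathbf t_r;\rho_2)$, $C_3=\mathsf{COM}(\mathbf t_w+\mathbf t_r;\rho_3)$; $C_1=\mathsf{COM}(\eta,\mathbf M\mathbf w_2-\mathbf u;\rho_1)$, $C_3=\mathsf{COM}(\Gamma_\eta(\mathbf w_2);\rho_3)$; $C_1=\mathsf{COM}(\eta,\mathbf M\mathbf w_3;\rho_1)$, $C_2=\mathsf{COM}(\Gamma_\eta(\mathbf w_3);\rho_2)$. **Theorem.** 1. For all $a,b,g,e\in\{-1,0,1\}$ and $\mathbf v\in\mathbb Z^9$: $\mathbf v=\mathsf{mult}_3(a,g)\iff\phi_{b,e}(\mathbf v)=\mathsf{mult}_3([a+b]_3,[g+e]_3)$. Likewise, for all $\{-1,0,1\}$-vectors, $\mathbf v=\mathsf{mult}(\mathbf a,\mathbf g)\iff\Phi_{\mathbf b,\mathbf e}(\mathbf v)=\mathsf{mult}([\mathbf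 a+\mathbf b]_3,[\mathbf g+\mathbf e]_3)$. 2. $\mathbf v\in\mathsf{VALID}\iff\Gamma_\eta(\mathbf v)\in\mathsf{VALID}$, and for $\mathbf w\in\mathsf{VALID}$ and uniform $\eta\in\mathcal S$ the vector $\Gamma_\eta(\mathbf w)$ is uniform in $\mathsf{VALID}$. The vector $\mathbf w$ built from any $(\mathbf a,g,\mathbf e)$ lies in $\mathsf{VALID}$, and if $g,\mathbf e$ are $B$-bounded, then $\mathbf c=\mathbf a\cdot g+\mathbf e\iff\mathbf M\mathbf w=\mathbf u\bmod q$. 3. The protocol, with PPT prover and verifier, is a statistical zero-knowledge argument of knowledge for the relation: (a) *Perfect completeness:* the honest prover with a witness is accepted with probability $1$. (b) *Statistical zero knowledge:* there is a PPT simulator with oracle access to the verifier such that, for every (even unbounded) cheating verifier and every $(\mathbf c;(\mathbf a,g,\mathbf e))$ in the relation, key and simulated transcript are within negligible statistical distance of key and real transcript. (c) *Argument of knowledge:* there is a PPT extractor $E$ such that no PPT algorithm (with polynomial auxiliary input) produces, with non-negligible probability, three accepting transcripts with the same commitment message and challenges $1,2,3$ on which $E$ fails to output a witness $(\mathbf a',g',\mathbf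 e')$ for $\mathbf c$ that is recomposed from some $\mathbf w'\in\mathsf{VALID}$ with $\mathbf M\mathbf w'=\mathbf u\bmod q$ and $\Gamma_\eta(\mathbf w')=\mathbf t_w$, where $\mathbf t_w$ and $\eta$ are taken from the first and the second response. (d) *Soundness error $2/3$:* every PPT cheating prover (with polynomial auxiliary input) is accepted with probability at most $\frac23+\frac13p+\mathrm{negl}(\lambda)$, where $p$ is the probability that $E$, given the prover's commitment message and its responses from the same state to the three challenges, outputs such a witness. 4. The total number of bits exchanged in an honest execution is $O(L\log q)$, which is $O(n^2\log^4 n)$ and $\widetilde O(\lambda^2)$. -/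

import Mathlib

open Polynomial Filter Asymptotics

noncomputable section

/-! ## A machine model with a step count

Data are binary trees with natural numbers at the leaves. The length of a datum is the number of
bits of a self-delimiting binary code. Programs form a small first-order language with binary
arithmetic, pairing, branching, bounded loops, uniform sampling and oracle calls. Every basic step
is charged the bit length of what it reads and writes, so the model is polynomially equivalent to
probabilistic (oracle) Turing machines; loops are bounded because a polynomial-time computation can
always be run under a clock. Uniform sampling below a number written in binary is a basic step. -/

/-- Data: binary trees with natural numbers at the leaves. -/
inductive Val : Type
  | num : ℕ → Val
  | pair : Val → Val → Val

namespace Val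

/-- A self-delimiting binary code: a leaf is `0` followed by its binary digits, each announced by
a `1`, and a closing `0`; a node is `1` followed by the codes of both subtrees. -/
def code : Val → List Bool
  | num n => false :: (n.bits.flatMap (fun b => [true, b]) ++ [false])
  | pair a b => true :: (a.code ++ b.code)

/-- The bit length of a datum. -/
def size (v : Val) : ℕ := v.code.length

def fst : Val → Val
  | pair a _ => a
  | num _ => num 0

def snd : Val → Val
  | pair _ b => b
  | num _ => num 0

def isZero : Val → Bool
  | num 0 => true
  | _ => false

/-- The string `1^k` (a word of `k` bits, with a leading marker digit). -/
def unary (k : ℕ) : Val := num (2 ^ k)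

/-- The number `x < 2 ^ w` written with exactly `w` bits (after a leading marker digit), so that
the length does not depend on `x`. -/
def word (w x : ℕ) : Val := num (2 ^ w + x)

/-- The list of the values of a function on `Fin k`. -/
def ofFun {k : ℕ} (f : Fin k → Val) : Val := (List.ofFn f).foldr pair (num 0)

end Val

/-- The basic deterministic operations; on arguments of the wrong shape they return `num 0`. -/
inductive Op : Type
  | id
  | const (v : Val)
  | fst
  | snd
  | isPair
  | eq
  | lt
  | len
  | add
  | sub
  | mul
  | div
  | mod

open Classical in
def Op.apply : Op → Val → Val
  | .id, x => x
  | .const v, _ => v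
  | .fst, x => x.fst
  | .snd, x => x.snd
  | .isPair, .pair _ _ => .num 1
  | .eq, .pair a b => if a = b then .num 1 else .num 0
  | .lt, .pair (.num a) (.num b) => if a < b then .num 1 else .num 0
  | .len, x => .num x.size
  | .add, .pair (.num a) (.num b) => .num (a + b)
  | .sub, .pair (.num a) (.num b) => .num (a - b)
  | .mul, .pair (.num a) (.num b) => .num (a * b)
  | .div, .pair (.num a) (.num b) => .num (a / b)
  | .mod, .pair (.num a) (.num b) => .num (a % b)
  | _, _ => .num 0

inductive Prog : Type
  /-- a basic operation -/
  | op : Op → Prog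
  /-- run the first program, then the second one on its output -/
  | seq : Prog → Prog → Prog
  /-- the pair of both outputs on the same input -/
  | fork : Prog → Prog → Prog
  /-- `cond c f g` runs `f` if `c` outputs something other than `num 0`, and `g` otherwise -/
  | cond : Prog → Prog → Prog → Prog
  /-- on input `(k, y)`: apply the body `k` times, starting from `y` -/
  | loop : Prog → Prog
  /-- on input `m > 0`: a uniform element of `{0, …, m - 1}` -/
  | rand : Prog
  /-- query the oracle at the input -/
  | oracle : Prog

/-- The joint law of output and running time of a program with oracle `O`. -/
def Prog.eval (O : Val → Val) : Prog → Val → PMF (Val × ℕ)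
  | .op p, x => PMF.pure (p.apply x, x.size + (p.apply x).size)
  | .seq f g, x =>
      (f.eval O x).bind fun r => (g.eval O r.1).map fun s => (s.1, r.2 + s.2)
  | .fork f g, x =>
      (f.eval O x).bind fun r => (g.eval O x).map fun s => (.pair r.1 s.1, r.2 + s.2 + 1)
  | .cond c f g, x =>
      (c.eval O x).bind fun r =>
        (if r.1.isZero then g.eval O x else f.eval O x).map fun s => (s.1, r.2 + s.2)
  | .loop f, .pair (.num k) y =>
      Nat.rec (motive := fun _ => PMF (Val × ℕ)) (PMF.pure (y, (Val.pair (.num k) y).size))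
        (fun _ ih => ih.bind fun r => (f.eval O r.1).map fun s => (s.1, r.2 + s.2 + 1)) k
  | .loop _, x => PMF.pure (.num 0, x.size + (Val.num 0).size)
  | .rand, .num (m + 1) =>
      (PMF.uniformOfFintype (Fin (m + 1))).map fun i =>
        (.num i, (Val.num (m + 1)).size + (Val.num i).size)
  | .rand, x => PMF.pure (.num 0, x.size + (Val.num 0).size)
  | .oracle, x => PMF.pure (O x, x.size + (O x).size)

/-- The law of the output of an oracle program. -/
def Prog.outWith (O : Val → Val) (f : Prog) (x : Val) : PMF Val := (f.eval O x).map Prod.fst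

/-- The law of the output of a program without oracle (the oracle is constant). -/
def Prog.out (f : Prog) (x : Val) : PMF Val := f.outWith (fun _ => .num 0) x

/-- Probabilistic polynomial time: on every input and for every outcome of the random choices, the
running time is at most a fixed polynomial in the length of the input. -/
def Prog.PolyTime (f : Prog) : Prop :=
  ∃ p : Polynomial ℕ, ∀ x : Val, ∀ r ∈ (f.eval (fun _ => .num 0) x).support,
    r.2 ≤ p.eval x.size

/-! ## Probability and asymptotics -/

/-- The probability of an event. -/
def prob {α : Type} (μ : PMF α) (s : Set α) : ℝ := (μ.toOuterMeasure s).toReal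

/-- The statistical distance of `μ` and `ν` is at most `ε`. -/
def StatClose {α : Type} (μ ν : PMF α) (ε : ℝ) : Prop :=
  ∀ s : Set α, |prob μ s - prob ν s| ≤ ε

/-- Negligible functions of the security parameter. -/
def Negligible (ε : ℕ → ℝ) : Prop := SuperpolynomialDecay atTop (fun k : ℕ => (k : ℝ)) ε

/-- Families of data whose length is polynomial in the security parameter. -/
def PolyLength (z : ℕ → Val) : Prop := ∃ p : Polynomial ℕ, ∀ k, (z k).size ≤ p.eval k

/-- `f = Õ(g)` for functions of the security parameter, with logarithms taken of `s`:
`f = O(g · log^k s)` for some `k`. -/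
def SoftO (s f g : ℕ → ℝ) : Prop :=
  ∃ k : ℕ, f =O[atTop] fun t => g t * Real.log (s t) ^ k

/-! ## Commitment schemes -/

/-- A (keyed) string commitment scheme: a polynomial-time key generator, run on `1^t`, and a
polynomial-time deterministic function `com pk m ρ` of key, message and coins. At security
parameter `t` the coins are uniform strings of `coinLen t` bits. -/
structure CommitmentScheme where
  gen : Prog
  gen_polyTime : gen.PolyTime
  com : Val → Val → Val → Val
  comProg : Prog
  comProg_polyTime : comProg.PolyTime
  comProg_out : ∀ pk m ρ, comProg.out (.pair pk (.pair m ρ)) = PMF.pure (com pk m ρ)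
  coinLen : ℕ → ℕ

namespace CommitmentScheme

variable (C : CommitmentScheme)

/-- The law of the key at security parameter `t`. -/
def key (t : ℕ) : PMF Val := C.gen.out (.unary t)

/-- The coins at security parameter `t`. -/
abbrev Coin (t : ℕ) : Type := Fin (2 ^ C.coinLen t)

/-- Coins as a string of `coinLen t` bits. -/
def coin {t : ℕ} (ρ : C.Coin t) : Val := .word (C.coinLen t) ρ

/-- The joint law of the key and a commitment to `m`. -/
def commitLaw (t : ℕ) (m : Val) : PMF (Val × Val) :=
  (C.key t).bind fun pk =>
    (PMF.uniformOfFintype (C.Coin t)).map fun ρ => (pk, C.com pk m (C.coin ρ))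

/-- Statistically hiding: commitments to two messages of the same polynomial length are
statistically indistinguishable given the key. -/
def StatisticallyHiding : Prop :=
  ∀ p : Polynomial ℕ, ∃ ε : ℕ → ℝ, Negligible ε ∧
    ∀ (t : ℕ) (m₀ m₁ : Val), m₀.size = m₁.size → m₀.size ≤ p.eval t →
      StatClose (C.commitLaw t m₀) (C.commitLaw t m₁) (ε t)

/-- `v` opens one commitment under the key `pk` to two different messages. -/
def Collision (t : ℕ) (pk v : Val) : Prop :=
  ∃ (m₀ m₁ : Val) (ρ₀ ρ₁ : C.Coin t),
    v = .pair (.pair m₀ (C.coin ρ₀)) (.pair m₁ (C.coin ρ₁)) ∧ m₀ ≠ m₁ ∧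
      C.com pk m₀ (C.coin ρ₀) = C.com pk m₁ (C.coin ρ₁)

/-- Computationally binding: every probabilistic polynomial-time adversary, given `1^t`, the key
and an auxiliary string of polynomial length, finds a collision with negligible probability. -/
def ComputationallyBinding : Prop :=
  ∀ A : Prog, A.PolyTime → ∀ z : ℕ → Val, PolyLength z →
    Negligible fun t =>
      prob ((C.key t).bind fun pk =>
        (A.out (.pair (.unary t) (.pair pk (z t)))).map fun v => (pk, v))
        {x | C.Collision t x.1 x.2}

end CommitmentScheme

/-! ## Trits, the extension `mult` and its permutations -/

/-- The set `{-1, 0, 1}`. -/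
abbrev Trit : Type := Set.Icc (-1 : ℤ) 1

instance : Nonempty Trit := ⟨⟨0, by simp⟩⟩

instance : DecidableEq Trit := Subtype.instDecidableEq

instance : Fintype Trit := inferInstanceAs (Fintype (Set.Icc (-1 : ℤ) 1))

/-- `[b]₃`: the representative of `b` modulo 3 in `{-1, 0, 1}`. -/
def br3 (b : ℤ) : Trit :=
  ⟨Int.bmod b 3, by
    have h1 := Int.le_bmod (x := b) (m := 3) (by norm_num)
    have h2 := Int.bmod_lt (x := b) (m := 3) (by norm_num)
    constructor <;> omega⟩

/-- `enc₃(z) = ([z+1]₃, [z]₃, [z-1]₃)`, with entries labelled `-1, 0, 1`. -/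
def enc3 (z : Trit) : Trit → ℤ := fun i => br3 ((z : ℤ) - i)

/-- `π_e(v) = (v^([-e-1]₃), v^([-e]₃), v^([-e+1]₃))`. -/
def permPi {A : Type} (e : Trit) (v : Trit → A) : Trit → A := fun i => v (br3 (-(e : ℤ) + i))

/-- `mult₃(a, g)`: the entry labelled `(i, j)` is `[a-i]₃ · [g-j]₃`. -/
def mult3 (a g : Trit) : Trit × Trit → ℤ :=
  fun x => (br3 ((a : ℤ) - x.1) : ℤ) * (br3 ((g : ℤ) - x.2) : ℤ)

/-- `φ_{b,e}(v)`: the entry labelled `(i, j)` is `v^([-b+i]₃, [-e+j]₃)`. -/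
def permPhi {A : Type} (b e : Trit) (v : Trit × Trit → A) : Trit × Trit → A :=
  fun x => v (br3 (-(b : ℤ) + x.1), br3 (-(e : ℤ) + x.2))

/-- `[a + b]₃` coordinatewise. -/
def addT {ι : Type} (a b : ι → Trit) : ι → Trit := fun i => br3 ((a i : ℤ) + b i)

/-- `enc(z)`: the blocks `enc₃(z_i)`. -/
def encV {ι : Type} (z : ι → Trit) : ι → Trit → ℤ := fun i => enc3 (z i)

/-- `Π_e`: blockwise `π_{e_i}`. -/
def permPiV {A ι : Type} (e : ι → Trit) (v : ι → Trit → A) : ι → Trit → A :=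
  fun i => permPi (e i) (v i)

/-- `mult(a, g)`: the blocks `mult₃(a_k, g_m)`. -/
def multV {ι κ : Type} (a : ι → Trit) (g : κ → Trit) : ι → κ → Trit × Trit → ℤ :=
  fun k m => mult3 (a k) (g m)

/-- `Φ_{b,e}`: blockwise `φ_{b_k, e_m}`. -/
def permPhiV {A ι κ : Type} (b : ι → Trit) (e : κ → Trit) (v : ι → κ → Trit × Trit → A) :
    ι → κ → Trit × Trit → A :=
  fun k m => permPhi (b k) (e m) (v k m)

/-! ## Integer decomposition -/

/-- `δ_B = ⌊log₂ B⌋ + 1`. -/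
def delta (B : ℕ) : ℕ := Nat.log 2 B + 1

/-- `B_{t+1} = ⌊(B + 2^t) / 2^(t+1)⌋`. -/
def weight (B t : ℕ) : ℕ := (B + 2 ^ t) / 2 ^ (t + 1)

/-- What is left of `a` after the first `t` steps of the greedy decomposition. -/
def idecRem (B a : ℕ) : ℕ → ℕ
  | 0 => a
  | t + 1 => if weight B t ≤ idecRem B a t then idecRem B a t - weight B t else idecRem B a t

/-- The digits of `sign(z) · idec_B(|z|)`. -/
def sdec (B : ℕ) (z : ℤ) (t : Fin (delta B)) : Trit :=
  if weight B t ≤ idecRem B z.natAbs t then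
    ⟨z.sign, by rcases Int.sign_trichotomy z with h | h | h <;> simp [h]⟩
  else ⟨0, by simp⟩

/-- The matrix with one row block `(B_1, …, B_{δ_B})` for every `i` on the diagonal. -/
def gadget (R ι : Type) [Semiring R] [DecidableEq ι] (B : ℕ) : Matrix ι (ι × Fin (delta B)) R :=
  fun i p => if i = p.1 then (weight B p.2 : R) else 0

/-! ## The ring, the relation and the reduction to a linear equation -/

/-- Parameters: `n ≥ 2` a power of two, `q ≥ 3` odd, `1 ≤ B ≤ (q-1)/2`. -/
structure Params where
  n : ℕ
  q : ℕ
  B : ℕ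
  two_le_n : 2 ≤ n
  n_pow : ∃ k, n = 2 ^ k
  three_le_q : 3 ≤ q
  odd_q : Odd q
  one_le_B : 1 ≤ B
  B_le : B ≤ (q - 1) / 2

namespace Params

variable (P : Params)

instance : NeZero P.q := ⟨by have := P.three_le_q; omega⟩

/-- `Z_q`. -/
abbrev Zq : Type := ZMod P.q

/-- `X^n + 1`. -/
def modulus : (ZMod P.q)[X] := X ^ P.n + C 1

theorem modulus_monic : P.modulus.Monic :=
  monic_X_pow_add_C 1 (by have := P.two_le_n; omega)

/-- `R_q = Z_q[X] / (X^n + 1)`. -/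
abbrev Rq : Type := AdjoinRoot P.modulus

/-- The coefficient embedding of `R_q` in `Z_q^n`. -/
def tau (a : P.Rq) : Fin P.n → P.Zq :=
  fun i => (AdjoinRoot.modByMonicHom P.modulus_monic a).coeff i

/-- `rot(a) = [τ(a) | τ(a·X) | ⋯ | τ(a·X^(n-1))]`. -/
def rot (a : P.Rq) : Matrix (Fin P.n) (Fin P.n) P.Zq :=
  fun i j => P.tau (a * AdjoinRoot.root P.modulus ^ (j : ℕ)) i

/-- `‖a‖_∞ ≤ B`, with coefficients represented in `[-(q-1)/2, (q-1)/2]`. -/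
def Bounded (a : P.Rq) : Prop := ∀ i, (P.tau a i).valMinAbs.natAbs ≤ P.B

/-- `(q-1)/2`. -/
abbrev half : ℕ := (P.q - 1) / 2

/-- `ℓ = ⌊log₂ ((q-1)/2)⌋ + 1`. -/
abbrev ell : ℕ := delta P.half

/-- `δ_B`. -/
abbrev dB : ℕ := delta P.B

/-- `L = 9 n² ℓ² δ_B + 3 n ℓ δ_B`. -/
def L : ℕ := 9 * P.n ^ 2 * P.ell ^ 2 * P.dB + 3 * P.n * P.ell * P.dB

/-- Public statements `c ∈ R_q^ℓ`. -/
abbrev Stmt : Type := Fin P.ell → P.Rq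

/-- Candidate witnesses `(a, g, e) ∈ R_q^ℓ × R_q × R_q^ℓ`. -/
structure Witness where
  a : Fin P.ell → P.Rq
  g : P.Rq
  e : Fin P.ell → P.Rq

variable {P} in
/-- The relation: `c = a · g + e` over `R_q`, with `g` and `e` bounded by `B`. -/
def Rel (c : P.Stmt) (w : P.Witness) : Prop :=
  P.Bounded w.g ∧ (∀ i, P.Bounded (w.e i)) ∧ c = fun i => w.a i * w.g + w.e i

/-- Positions in the decomposition of an element of `R_q`. -/
abbrev AIdx : Type := Fin P.n × Fin P.ell

/-- Positions in the decomposition of a `B`-bounded element of `R_q`. -/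
abbrev GIdx : Type := Fin P.n × Fin P.dB

/-- Positions in the decomposition of a `B`-bounded vector of `ℓ` elements of `R_q`. -/
abbrev EIdx : Type := (Fin P.ell × Fin P.n) × Fin P.dB

/-- Positions in the vector `w₀ = (y_1 ‖ ⋯ ‖ y_ℓ ‖ e*)`. -/
abbrev Idx0 : Type := (Fin P.ell × P.AIdx × P.GIdx) ⊕ P.EIdx

/-- Positions in the extended vector `w`. -/
abbrev Idx : Type := (Fin P.ell × P.AIdx × P.GIdx × (Trit × Trit)) ⊕ (P.EIdx × Trit)

instance : DecidableEq P.Idx :=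
  letI : DecidableEq (Fin P.ell × P.AIdx × P.GIdx × (Trit × Trit)) := inferInstance
  letI : DecidableEq (P.EIdx × Trit) := inferInstance
  instDecidableEqSum

/-- `H` of size `n × nℓ`, for the bound `(q-1)/2`. -/
def H : Matrix (Fin P.n) P.AIdx P.Zq := gadget P.Zq (Fin P.n) P.half

/-- `H_B` of size `n × nδ_B`. -/
def HB : Matrix (Fin P.n) P.GIdx P.Zq := gadget P.Zq (Fin P.n) P.B

/-- `H_{ℓ,B}` of size `nℓ × nℓδ_B`, acting on the decomposition of `e`. -/
def HlB : Matrix (Fin P.ell × Fin P.n) P.EIdx P.Zq := gadget P.Zq (Fin P.ell × Fin P.n) P.B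

/-- `Q₀ = [rot(X^0)·H·H_{ℓ,B} | ⋯ | rot(X^(n-1))·H·H_{ℓ,B}]`, with `n²ℓδ_B` columns. -/
def Q0 : Matrix (Fin P.n) (P.AIdx × P.GIdx) P.Zq := fun r x =>
  (P.rot (AdjoinRoot.root P.modulus ^ (x.2.1 : ℕ)) * P.H * gadget P.Zq P.AIdx P.B)
    r (x.1, x.2.2)

/-- `M₀ = [Q | H_{ℓ,B}]` with `Q` block diagonal with `ℓ` blocks `Q₀`. -/
def M0 : Matrix (Fin P.ell × Fin P.n) P.Idx0 P.Zq := fun r x =>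
  match x with
  | .inl (i, y) => if r.1 = i then P.Q0 r.2 y else 0
  | .inr y => P.HlB r y

/-- `M`: `M₀` with zero columns inserted. The columns of `M₀` sit at the entries `[a]₃·[g]₃` of the
blocks `mult₃(a, g)` and at the entries `[z]₃` of the blocks `enc₃(z)`. -/
def M : Matrix (Fin P.ell × Fin P.n) P.Idx P.Zq := fun r x =>
  match x with
  | .inl (i, k, m, s) => if (s.1 : ℤ) = 0 ∧ (s.2 : ℤ) = 0 then P.M0 r (.inl (i, k, m)) else 0
  | .inr (y, s) => if (s : ℤ) = 0 then P.M0 r (.inr y) else 0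

variable {P}

/-- `u = τ(c)`. -/
def target (c : P.Stmt) : Fin P.ell × Fin P.n → P.Zq := fun r => P.tau (c r.1) r.2

/-- Concatenation of the blocks of an extended vector. -/
def join {A : Type} (y : Fin P.ell → P.AIdx → P.GIdx → Trit × Trit → A) (e : P.EIdx → Trit → A) :
    P.Idx → A
  | .inl (i, k, m, s) => y i k m s
  | .inr (x, s) => e x s

/-- `(mult(a_1*, g*) ‖ ⋯ ‖ mult(a_ℓ*, g*) ‖ enc(e*))`. -/
def extend (a : Fin P.ell → P.AIdx → Trit) (g : P.GIdx → Trit) (e : P.EIdx → Trit) : P.Idx → ℤ :=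
  join (fun i => multV (a i) g) (encV e)

variable (P) in
/-- The set `VALID`. -/
def VALID : Set (P.Idx → ℤ) := {v | ∃ a g e, v = extend a g e}

variable (P) in
/-- The set `𝒮` of permutation labels `(b_1, …, b_ℓ, f_1, f_2)`. -/
abbrev Label : Type := (Fin P.ell → P.AIdx → Trit) × (P.GIdx → Trit) × (P.EIdx → Trit)

/-- `Γ_η(v) = (Φ_{b_1,f_1}(v_1) ‖ ⋯ ‖ Φ_{b_ℓ,f_1}(v_ℓ) ‖ Π_{f_2}(v_{ℓ+1}))`. -/
def Gam {A : Type} (η : P.Label) (v : P.Idx → A) : P.Idx → A :=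
  join (fun i => permPhiV (η.1 i) η.2.1 fun k m s => v (.inl (i, k, m, s)))
    (permPiV η.2.2 fun x s => v (.inr (x, s)))

/-- The vector `w` that the prover builds from `(a, g, e)` by decomposing and extending. -/
def secret (w : P.Witness) : P.Idx → ℤ :=
  extend (fun i k => sdec P.half (P.tau (w.a i) k.1).valMinAbs k.2)
    (fun m => sdec P.B (P.tau w.g m.1).valMinAbs m.2)
    (fun x => sdec P.B (P.tau (w.e x.1.1) x.1.2).valMinAbs x.2)

/-- Reduction modulo `q` of an integer vector. -/
def red (v : P.Idx → ℤ) : P.Idx → P.Zq := fun x => (v x : P.Zq)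

/-! ## Encodings of the exchanged objects, with lengths independent of the values -/

def eZq (x : P.Zq) : Val := .word P.q.size x.val

def eTrit (z : ℤ) : Val := .word 2 (z + 1).toNat

def eOver (f : Trit → Val) : Val := .ofFun ![f (br3 (-1)), f (br3 0), f (br3 1)]

def eIdx (f : P.Idx → Val) : Val :=
  .pair
    (.ofFun fun i => .ofFun fun j => .ofFun fun r => .ofFun fun s => .ofFun fun t =>
      eOver fun y => eOver fun x => f (.inl (i, (r, s), (j, t), (x, y))))
    (.ofFun fun i => .ofFun fun r => .ofFun fun t => eOver fun x => f (.inr (((i, r), t), x)))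

def eVec (v : P.Idx → P.Zq) : Val := eIdx fun x => eZq (v x)

def eShort (v : P.Idx → ℤ) : Val := eIdx fun x => eTrit (v x)

def eRows (v : Fin P.ell × Fin P.n → P.Zq) : Val := .ofFun fun i => .ofFun fun r => eZq (v (i, r))

def eRing (a : P.Rq) : Val := .ofFun fun r => eZq (P.tau a r)

def eStmt (c : P.Stmt) : Val := .ofFun fun i => eRing (c i)

def eWitness (w : P.Witness) : Val :=
  .pair (.ofFun fun i => eRing (w.a i)) (.pair (eRing w.g) (.ofFun fun i => eRing (w.e i)))

def eLabel (η : P.Label) : Val :=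
  .pair (.ofFun fun i => .ofFun fun r => .ofFun fun s => eTrit (η.1 i (r, s)))
    (.pair (.ofFun fun j => .ofFun fun t => eTrit (η.2.1 (j, t)))
      (.ofFun fun i => .ofFun fun r => .ofFun fun t => eTrit (η.2.2 ((i, r), t))))

end Params

/-! ## The Stern-type protocol -/

/-- The three challenges; `0, 1, 2` stand for `1, 2, 3`. -/
abbrev Challenge : Type := Fin 3

def eChallenge (ch : Challenge) : Val := .num ((ch : ℕ) + 1)

/-- The reply of a verifier to the commitment: a challenge, or no valid challenge at all. -/
def eReply : Option Challenge → Val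
  | none => .num 0
  | some ch => eChallenge ch

namespace Stern

variable (C : CommitmentScheme) (t : ℕ) {P : Params}

open Params

/-- The public input: `1^t`, the parameters, the commitment key and the statement. -/
def input (pk : Val) (c : P.Stmt) : Val :=
  .pair (.unary t) (.pair (.unary P.n) (.pair (.num P.q) (.pair (.num P.B)
    (.pair (.unary (C.coinLen t)) (.pair pk (eStmt c))))))

/-- The committed messages. -/
def msg1 (η : P.Label) (x : Fin P.ell × Fin P.n → P.Zq) : Val := .pair (eLabel η) (eRows x)

def msg (v : P.Idx → P.Zq) : Val := eVec v

/-- The commitment message `CMT = (C₁, C₂, C₃)`. -/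
def cmt (C₁ C₂ C₃ : Val) : Val := .pair C₁ (.pair C₂ C₃)

/-- `RSP = (t_w, t_r, ρ₂, ρ₃)`. -/
def rspA (tw : P.Idx → ℤ) (tr : P.Idx → P.Zq) (ρ₂ ρ₃ : C.Coin t) : Val :=
  .pair (eShort tw) (.pair (eVec tr) (.pair (C.coin ρ₂) (C.coin ρ₃)))

/-- `RSP = (η, v, ρ, ρ')`, for the second and the third challenge. -/
def rspB (η : P.Label) (v : P.Idx → P.Zq) (ρ ρ' : C.Coin t) : Val :=
  .pair (eLabel η) (.pair (eVec v) (.pair (C.coin ρ) (C.coin ρ')))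

variable (P) in
/-- The random choices of the prover: `η, r_w, ρ₁, ρ₂, ρ₃`. -/
abbrev Coins : Type := P.Label × (P.Idx → P.Zq) × C.Coin t × C.Coin t × C.Coin t

variable {C t}

/-- The commitment message of the prover with random choices `s` and secret vector `w`. -/
def proverCmt (pk : Val) (w : P.Idx → ℤ) (s : Coins C t P) : Val :=
  let (η, r, ρ₁, ρ₂, ρ₃) := s
  cmt (C.com pk (msg1 η (P.M.mulVec r)) (C.coin ρ₁))
    (C.com pk (msg (Gam η r)) (C.coin ρ₂))
    (C.com pk (msg (Gam η (red w + r))) (C.coin ρ₃))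

/-- The response of the prover. -/
def proverRsp (w : P.Idx → ℤ) (s : Coins C t P) : Challenge → Val :=
  let (η, r, ρ₁, ρ₂, ρ₃) := s
  ![rspA C t (Gam η w) (Gam η r) ρ₂ ρ₃, rspB C t η (red w + r) ρ₁ ρ₃, rspB C t η r ρ₁ ρ₂]

variable (C) (t)

/-- The verification of a transcript. -/
def Accept (pk : Val) (c : P.Stmt) (m : Val) (ch : Challenge) (rsp : Val) : Prop :=
  ∃ C₁ C₂ C₃ : Val, m = cmt C₁ C₂ C₃ ∧
    ![∃ (tw : P.Idx → ℤ) (tr : P.Idx → P.Zq) (ρ₂ ρ₃ : C.Coin t), rsp = rspA C t tw tr ρ₂ ρ₃ ∧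
        tw ∈ P.VALID ∧ C₂ = C.com pk (msg tr) (C.coin ρ₂) ∧
        C₃ = C.com pk (msg (red tw + tr)) (C.coin ρ₃),
      ∃ (η : P.Label) (w₂ : P.Idx → P.Zq) (ρ₁ ρ₃ : C.Coin t), rsp = rspB C t η w₂ ρ₁ ρ₃ ∧
        C₁ = C.com pk (msg1 η (P.M.mulVec w₂ - target c)) (C.coin ρ₁) ∧
        C₃ = C.com pk (msg (Gam η w₂)) (C.coin ρ₃),
      ∃ (η : P.Label) (w₃ : P.Idx → P.Zq) (ρ₁ ρ₂ : C.Coin t), rsp = rspB C t η w₃ ρ₁ ρ₂ ∧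
        C₁ = C.com pk (msg1 η (P.M.mulVec w₃)) (C.coin ρ₁) ∧
        C₂ = C.com pk (msg (Gam η w₃)) (C.coin ρ₂)] ch

/-- The law of (commitment message, response to `ch`) of the honest prover. -/
def honest (pk : Val) (w : P.Witness) (ch : Challenge) : PMF (Val × Val) :=
  (PMF.uniformOfFintype (Coins C t P)).map fun s =>
    (proverCmt pk (secret w) s, proverRsp (secret w) s ch)

/-- An interactive prover as a pair of programs: the first one outputs the commitment message and
a state, the second one gets the state and the challenge and outputs the response. This is the law
of (commitment message, response to `ch`) on input `x`. -/
def runProver (P₁ P₂ : Prog) (x : Val) (ch : Challenge) : PMF (Val × Val) :=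
  (P₁.out x).bind fun y =>
    (P₂.out (.pair y.snd (eChallenge ch))).map fun r => (y.fst, r)

/-- The law of (commitment message, responses to all three challenges) when the second program is
run from the same state on each challenge. -/
def runRewound (P₁ P₂ : Prog) (x : Val) : PMF (Val × Val × Val × Val) :=
  (P₁.out x).bind fun y =>
    (P₂.out (.pair y.snd (eChallenge 0))).bind fun r₁ =>
      (P₂.out (.pair y.snd (eChallenge 1))).bind fun r₂ =>
        (P₂.out (.pair y.snd (eChallenge 2))).map fun r₃ => (y.fst, r₁, r₂, r₃)

open Classical in
/-- Prover and verifier of the protocol run in probabilistic polynomial time. -/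
def Efficient (P : ℕ → Params) : Prop :=
  (∃ P₁ P₂ : Prog, P₁.PolyTime ∧ P₂.PolyTime ∧
    ∀ (t : ℕ) (pk : Val) (c : (P t).Stmt) (w : (P t).Witness), Rel c w → ∀ ch,
      runProver P₁ P₂ (.pair (input C t pk c) (eWitness w)) ch = honest C t pk w ch) ∧
  ∃ V : Prog, V.PolyTime ∧
    ∀ (t : ℕ) (pk : Val) (c : (P t).Stmt) (m : Val) (ch : Challenge) (rsp : Val),
      V.out (.pair (input C t pk c) (.pair m (.pair (eChallenge ch) rsp))) =
        PMF.pure (.num (if Accept C t pk c m ch rsp then 1 else 0))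

/-- Perfect completeness: the honest prover, on a statement with witness, is accepted with
probability 1. -/
def PerfectlyComplete (P : ℕ → Params) : Prop :=
  ∀ (t : ℕ) (c : (P t).Stmt) (w : (P t).Witness), Rel c w →
    prob ((C.key t).bind fun pk => (PMF.uniformOfFintype Challenge).bind fun ch =>
      (honest C t pk w ch).map fun x => (pk, ch, x))
      {y | Accept C t y.1 c y.2.2.1 y.2.1 y.2.2.2} = 1

/-- The view of a verifier with strategy `V` (challenge as a function of key and commitment
message) talking to the honest prover: the key and the transcript. After an invalid challenge the
prover stops. -/
def realView (w : P.Witness) (V : Val → Val → Option Challenge) : PMF (Val × Val) :=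
  (C.key t).bind fun pk => (PMF.uniformOfFintype (Coins C t P)).map fun s =>
    let m := proverCmt pk (secret w) s
    (pk, .pair m (.pair (eReply (V pk m))
      ((V pk m).elim (.num 0) (proverRsp (secret w) s))))

/-- The key and the transcript produced by a simulator with oracle access to `V`. -/
def simView (S : Prog) (c : P.Stmt) (V : Val → Val → Option Challenge) : PMF (Val × Val) :=
  (C.key t).bind fun pk =>
    (S.outWith (fun m => eReply (V pk m)) (input C t pk c)).map fun y => (pk, y)

/-- Statistical zero knowledge: one polynomial-time simulator with oracle access to the verifier
works for all, even unbounded, cheating verifiers. Since the error does not depend on the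
strategy `V`, a randomised verifier is covered by fixing its random tape. -/
def StatisticalZK (P : ℕ → Params) : Prop :=
  ∃ S : Prog,
    (∃ p : Polynomial ℕ, ∀ (V : Val → Option Challenge) (x : Val),
      ∀ r ∈ (S.eval (fun m => eReply (V m)) x).support, r.2 ≤ p.eval x.size) ∧
    ∃ ε : ℕ → ℝ, Negligible ε ∧
      ∀ (t : ℕ) (c : (P t).Stmt) (w : (P t).Witness), Rel c w →
        ∀ V : Val → Val → Option Challenge,
          StatClose (realView C t w V) (simView C t S c V) (ε t)

/-- `v` encodes a witness `(a, g, e)` for `c`, and this is the witness carried by the responses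
`r₁, r₂` to the first two challenges: it is recomposed from a vector `w' ∈ VALID` with
`M · w' = u`, and `Γ_η(w')` is the vector `t_w` in `r₁` for the label `η` in `r₂`. -/
def Extracted (c : P.Stmt) (r₁ r₂ v : Val) : Prop :=
  ∃ (a : Fin P.ell → P.AIdx → Trit) (g : P.GIdx → Trit) (e : P.EIdx → Trit) (w : P.Witness)
    (tr w₂ : P.Idx → P.Zq) (η : P.Label) (ρ₁ ρ₂ ρ₃ ρ₃' : C.Coin t),
    v = eWitness w ∧ Rel c w ∧
    P.M.mulVec (red (extend a g e)) = target c ∧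
    (∀ i, P.tau (w.a i) = P.H.mulVec fun k => ((a i k : ℤ) : P.Zq)) ∧
    P.tau w.g = P.HB.mulVec (fun m => ((g m : ℤ) : P.Zq)) ∧
    target w.e = P.HlB.mulVec (fun x => ((e x : ℤ) : P.Zq)) ∧
    r₁ = rspA C t (Gam η (extend a g e)) tr ρ₂ ρ₃ ∧ r₂ = rspB C t η w₂ ρ₁ ρ₃'

/-- The extractor `E` run on the statement and three responses to the same commitment message; the
law of (commitment message, three responses, output). -/
def runExtractor (E : Prog) (pk : Val) (c : P.Stmt) (y : Val × Val × Val × Val) :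
    PMF ((Val × Val × Val × Val) × Val) :=
  (E.out (.pair (input C t pk c) (.pair y.1 (.pair y.2.1 (.pair y.2.2.1 y.2.2.2))))).map
    fun v => (y, v)

/-- Argument of knowledge with soundness error `2/3`. There is a polynomial-time extractor `E` such
that for all statements, all probabilistic polynomial-time algorithms and all auxiliary strings of
polynomial length:
* an algorithm outputs three accepting transcripts with the same commitment message and all three
  challenges on which `E` fails to extract a witness with negligible probability only;
* a cheating prover is accepted with probability at most `2/3`, up to a negligible term and a third
  of the probability that `E`, run on its responses to the three challenges, extracts a witness. -/
def ArgumentOfKnowledge (P : ℕ → Params) : Prop :=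
  ∃ E : Prog, E.PolyTime ∧
    ∀ c : (t : ℕ) → (P t).Stmt, ∀ z : ℕ → Val, PolyLength z →
      (∀ A : Prog, A.PolyTime → Negligible fun t =>
        prob ((C.key t).bind fun pk =>
          (A.out (.pair (input C t pk (c t)) (z t))).bind fun y =>
            (runExtractor C t E pk (c t)
              (y.fst, y.snd.fst, y.snd.snd.fst, y.snd.snd.snd)).map fun o => (pk, o))
          {o | Accept C t o.1 (c t) o.2.1.1 0 o.2.1.2.1 ∧
            Accept C t o.1 (c t) o.2.1.1 1 o.2.1.2.2.1 ∧
            Accept C t o.1 (c t) o.2.1.1 2 o.2.1.2.2.2 ∧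
            ¬ Extracted C t (c t) o.2.1.2.1 o.2.1.2.2.1 o.2.2}) ∧
      (∀ P₁ P₂ : Prog, P₁.PolyTime → P₂.PolyTime → ∃ ε : ℕ → ℝ, Negligible ε ∧ ∀ t,
        prob ((C.key t).bind fun pk => (PMF.uniformOfFintype Challenge).bind fun ch =>
          (runProver P₁ P₂ (.pair (input C t pk (c t)) (z t)) ch).map fun x => (pk, ch, x))
          {y | Accept C t y.1 (c t) y.2.2.1 y.2.1 y.2.2.2} ≤
        2 / 3 + 1 / 3 *
          prob ((C.key t).bind fun pk =>
            (runRewound P₁ P₂ (.pair (input C t pk (c t)) (z t))).bind fun y =>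
              runExtractor C t E pk (c t) y)
            {o | Extracted C t (c t) o.1.2.1 o.1.2.2.1 o.2} + ε t)

/-- `T t` bounds the number of bits exchanged in every honest execution, for large `t`. -/
def CommunicationBound (P : ℕ → Params) (T : ℕ → ℝ) : Prop :=
  ∀ᶠ t in atTop, ∀ (c : (P t).Stmt) (w : (P t).Witness), Rel c w →
    ∀ pk ∈ (C.key t).support, ∀ (s : Coins C t (P t)) (ch : Challenge),
      (((proverCmt pk (secret w) s).size + (eChallenge ch).size +
        (proverRsp (secret w) s ch).size : ℕ) : ℝ) ≤ T t

end Stern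

end

/-!
The permutation `Gam η` translates the digits `(a, g, e)` behind a valid vector by the label `η`:
shifting the argument of `i ↦ [a - i]₃` by `b` replaces `a` by `[a + b]₃`. As the digits can be read
off a valid vector (`Params.ext_injective`), valid vectors and labels correspond to each other,
`Gam η` acts on them as a translation, and the translate of a fixed element by a uniform label is
uniform. Decomposition and recomposition are inverse to each other on bounded elements, and `M`
computes `a · g + e` from the products of digits (`Params.M_mulVec_red_ext`). Hence witnesses are the
same as valid solutions `w` of `M w = u`: the weights for `B` sum to exactly `B`, so everything that
is recomposed is bounded (`Params.rel_recompose`).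

*Running times.* `Feas` says that a randomised function with oracle is computed by a program in
polynomial time, and `PF` is the deterministic case. Both are closed under composition, branching and
loops with a polynomial number of passes and polynomially bounded states, which reduces every claim
about programs to writing down a function on data. Functions on encodings have the suffix `V`, and
each comes with an equation that relates it to the mathematical function.

*Zero knowledge.* The simulator guesses the challenge, prepares the two commitments that this
challenge opens, and puts an arbitrary message into the third one. It starts anew when the verifier
asks for something else, up to `t` times. Under the bijection `Stern.reparam` of the random choices,
the simulator with guess `g` and the honest prover produce the same openings, so that they differ in
one unopened commitment only; hiding makes the difference negligible (`Stern.statClose_hitOr`). In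
the ideal experiment, in which the commitment message does not depend on the guess, each run succeeds
with probability `1/3` independently of the transcript, so rejection sampling reproduces the real
transcript up to `(2/3)^t` (`statClose_retry`). Replacing the `t` runs one after the other costs `t`
times the hiding error (`statClose_key_retry`).

*Argument of knowledge.* Three accepting transcripts with the same commitment message open each of
the three commitments twice. If all of these openings agree, then the second and third response
contain the same `η` and satisfy `Γ_η(w₂ - w₃) = t_w`, `M (w₂ - w₃) = u`; as `Γ_η` is injective, the
digits of `t_w` minus `η` solve the linear equation, and they are recomposed to a witness
(`Stern.extracted_or_collision`). Otherwise there is a collision, and the algorithm together with one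
of three simple functions contradicts the binding property. For the soundness error, let `x, y, z`
be the probabilities with which a prover answers the three challenges from a given state: then
`(x + y + z) / 3 ≤ 2 / 3 + x y z / 3`, and `x y z` is the probability that all three answers are
accepted after rewinding.

*Communication.* Every message has length `O(L · log q)`, where `L = O(n² log³ q)` and
`log q = O(log n)`.
-/

noncomputable section

namespace Val

theorem size_num (n : ℕ) : (num n).size = 2 * n.size + 2 := by
  have h : ∀ l : List Bool, (l.flatMap fun b => [true, b]).length = 2 * l.length := by
    intro l
    induction l with
    | nil => rfl
    | cons b l ih => simp [List.flatMap_cons]; omega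
  simp [size, code, h, Nat.size_eq_bits_len]

theorem size_pair (a b : Val) : (pair a b).size = a.size + b.size + 1 := by
  simp [size, code]

theorem two_le_size (v : Val) : 2 ≤ v.size := by
  cases v with
  | num n => rw [size_num]; omega
  | pair a b =>
    have ha : a.size ≠ 0 := by cases a <;> simp [size, code]
    have hb : b.size ≠ 0 := by cases b <;> simp [size, code]
    rw [size_pair]; omega

theorem size_fst_le (v : Val) : v.fst.size ≤ v.size := by
  cases v with
  | num n => simp [fst, size_num]
  | pair a b => simp only [fst, size_pair]; omega

theorem size_snd_le (v : Val) : v.snd.size ≤ v.size := by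
  cases v with
  | num n => simp [snd, size_num]
  | pair a b => simp only [snd, size_pair]; omega

@[simp] theorem fst_pair (a b : Val) : (pair a b).fst = a := rfl
@[simp] theorem snd_pair (a b : Val) : (pair a b).snd = b := rfl

/-- The number at a leaf, and `0` at an inner node. -/
def toNat : Val → ℕ
  | num n => n
  | pair _ _ => 0

@[simp] theorem toNat_num (n : ℕ) : (num n).toNat = n := rfl

end Val

open Val

theorem polyNat_mono (p : ℕ[X]) {a b : ℕ} (h : a ≤ b) : p.eval a ≤ p.eval b := by
  simp only [Polynomial.eval_eq_sum_range]
  gcongr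

/-! ### Output laws and running times of programs -/

/-- Iteration of a Markov kernel on data. -/
def iterK (F : Val → PMF Val) : ℕ → Val → PMF Val
  | 0, y => PMF.pure y
  | k + 1, y => (iterK F k y).bind F

theorem iterK_succ' (F : Val → PMF Val) (k : ℕ) (y : Val) :
    iterK F (k + 1) y = (F y).bind (iterK F k) := by
  induction k with
  | zero => 
    show (PMF.pure y).bind F = (F y).bind PMF.pure
    simp
  | succ k ih =>
    show (iterK F (k + 1) y).bind F = _
    rw [ih, PMF.bind_bind]; rfl

theorem iterK_pure (F : Val → Val) (k : ℕ) (y : Val) :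
    iterK (fun x => PMF.pure (F x)) k y = PMF.pure (F^[k] y) := by
  induction k with
  | zero => rfl
  | succ k ih => simp [iterK, ih, Function.iterate_succ_apply']

namespace Prog

variable (O : Val → Val)

theorem outWith_op (p : Op) (x : Val) : (op p).outWith O x = PMF.pure (p.apply x) := by
  simp [outWith, eval, PMF.pure_map]

theorem outWith_seq (f g : Prog) (x : Val) :
    (seq f g).outWith O x = (f.outWith O x).bind (g.outWith O) := by
  simp only [outWith, eval, PMF.map_bind, PMF.map_comp, PMF.bind_map]
  rfl

theorem outWith_fork (f g : Prog) (x : Val) :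
    (fork f g).outWith O x = (f.outWith O x).bind fun a => (g.outWith O x).map (pair a) := by
  simp only [outWith, eval, PMF.map_bind, PMF.map_comp, PMF.bind_map]
  rfl

theorem outWith_cond (c f g : Prog) (x : Val) :
    (cond c f g).outWith O x = (c.outWith O x).bind fun a =>
      if a.isZero then g.outWith O x else f.outWith O x := by
  simp only [outWith, eval, PMF.map_bind, PMF.map_comp, PMF.bind_map]
  congr 1
  funext r
  by_cases h : r.1.isZero = true <;> simp [h, PMF.map, Function.comp_def]

/-- The law of result and running time of `k` passes through a loop body, where `s` is charged for
setting up the loop. -/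
def loopLaw (f : Prog) (s : ℕ) (y : Val) : ℕ → PMF (Val × ℕ)
  | 0 => PMF.pure (y, s)
  | k + 1 => (loopLaw f s y k).bind fun r => (f.eval O r.1).map fun s => (s.1, r.2 + s.2 + 1)

theorem eval_loop (f : Prog) (k : ℕ) (y : Val) :
    (loop f).eval O (pair (num k) y) = loopLaw O f (pair (num k) y).size y k := by
  have h : ∀ (s j : ℕ), Nat.rec (motive := fun _ => PMF (Val × ℕ)) (PMF.pure (y, s))
      (fun _ ih => ih.bind fun r => (f.eval O r.1).map fun s => (s.1, r.2 + s.2 + 1)) j =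
        loopLaw O f s y j := by
    intro s j
    induction j with
    | zero => rfl
    | succ j ih => simp only [loopLaw, ← ih]
  exact h _ k

theorem map_fst_loopLaw (f : Prog) (s k : ℕ) (y : Val) :
    (loopLaw O f s y k).map Prod.fst = iterK (f.outWith O) k y := by
  induction k with
  | zero => simp [loopLaw, iterK, PMF.pure_map]
  | succ k ih =>
    rw [iterK, ← ih]
    simp only [loopLaw, PMF.map_bind, PMF.map_comp, PMF.bind_map]
    rfl

theorem outWith_loop (f : Prog) (k : ℕ) (y : Val) :
    (loop f).outWith O (pair (num k) y) = iterK (f.outWith O) k y := by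
  rw [outWith, eval_loop, map_fst_loopLaw]

theorem mem_support_outWith {f : Prog} {x : Val} {r : Val × ℕ} (h : r ∈ (f.eval O x).support) :
    r.1 ∈ (f.outWith O x).support := by
  rw [outWith, PMF.support_map]
  exact ⟨r, h, rfl⟩

/-- Writing the output is part of the running time. -/
theorem size_le_time (f : Prog) : ∀ (x : Val), ∀ r ∈ (f.eval O x).support, r.1.size ≤ r.2 := by
  induction f with
  | op p => intro x r hr; simp [eval] at hr; subst hr; simp
  | seq f g hf hg =>
    intro x r hr
    simp only [eval, PMF.mem_support_bind_iff, PMF.support_map, Set.mem_image] at hr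
    obtain ⟨a, ha, b, hb, rfl⟩ := hr
    have := hg _ _ hb
    simp only; omega
  | fork f g hf hg =>
    intro x r hr
    simp only [eval, PMF.mem_support_bind_iff, PMF.support_map, Set.mem_image] at hr
    obtain ⟨a, ha, b, hb, rfl⟩ := hr
    have := hf _ _ ha
    have := hg _ _ hb
    simp only [size_pair]; omega
  | cond c f g hc hf hg =>
    intro x r hr
    simp only [eval, PMF.mem_support_bind_iff, PMF.support_map, Set.mem_image] at hr
    obtain ⟨a, ha, b, hb, rfl⟩ := hr
    split at hb
    · have := hg _ _ hb
      simp only; omega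
    · have := hf _ _ hb
      simp only; omega
  | loop f hf =>
    have key : ∀ (s : ℕ) (y : Val), y.size ≤ s → ∀ k, ∀ r ∈ (loopLaw O f s y k).support,
        r.1.size ≤ r.2 := by
      intro s y hs k
      induction k with
      | zero => intro r hr; simp [loopLaw] at hr; subst hr; exact hs
      | succ k ih =>
        intro r hr
        simp only [loopLaw, PMF.mem_support_bind_iff, PMF.support_map, Set.mem_image] at hr
        obtain ⟨a, ha, b, hb, rfl⟩ := hr
        have := hf _ _ hb
        simp only; omega
    intro x r hr
    match x with
    | .pair (.num k) y =>
      rw [eval_loop] at hr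
      refine key _ y ?_ k r hr
      rw [size_pair]; omega
    | .pair (.pair a b) y => simp [eval] at hr; subst hr; simp
    | .num n => simp [eval] at hr; subst hr; simp
  | rand =>
    intro x r hr
    match x with
    | .num 0 => simp [eval] at hr; subst hr; simp
    | .num (m + 1) => 
      simp only [eval, PMF.support_map, Set.mem_image] at hr
      obtain ⟨i, -, rfl⟩ := hr
      simp
    | .pair a b => simp [eval] at hr; subst hr; simp
  | oracle => intro x r hr; simp [eval] at hr; subst hr; simp

/-- Replace oracle queries by the constant `0`. -/
def strip : Prog → Prog
  | op p => op p
  | seq f g => seq f.strip g.strip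
  | fork f g => fork f.strip g.strip
  | cond c f g => cond c.strip f.strip g.strip
  | loop f => loop f.strip
  | rand => rand
  | oracle => op (.const (num 0))

theorem eval_strip (f : Prog) : f.strip.eval O = f.eval fun _ => num 0 := by
  induction f with
  | op p => rfl
  | seq f g hf hg => funext x; simp only [strip, eval, hf, hg]
  | fork f g hf hg => funext x; simp only [strip, eval, hf, hg]
  | cond c f g hc hf hg => funext x; simp only [strip, eval, hc, hf, hg]
  | loop f hf =>
    funext x
    match x with
    | .pair (.num k) y => simp only [strip, eval, hf]
    | .pair (.pair a b) y => simp only [strip, eval]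
    | .num n => simp only [strip, eval]
  | rand =>
    funext x
    match x with
    | .num 0 => simp only [strip, eval]
    | .num (m + 1) => simp only [strip, eval]
    | .pair a b => simp only [strip, eval]
  | oracle => funext x; rfl

theorem outWith_strip (f : Prog) : f.strip.outWith O = f.out := by
  funext x; rw [outWith, eval_strip]; rfl

end Prog

/-! ### Feasible randomised functions -/

/-- The oracles whose answers are short. -/
def SmallOracle (O : Val → Val) : Prop := ∀ x, (O x).size ≤ 8

/-- `f` is bounded by a polynomial in the length of the datum. -/
def PolyBdd (f : Val → ℕ) : Prop := ∃ p : ℕ[X], ∀ x, f x ≤ p.eval x.size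

/-- The randomised function `f`, relative to an oracle, is computed by a program that runs in
polynomial time on all inputs and with all oracles whose answers are short. -/
def Feas (f : (Val → Val) → Val → PMF Val) : Prop :=
  ∃ (g : Prog) (p : ℕ[X]), ∀ O, SmallOracle O → ∀ x,
    g.outWith O x = f O x ∧ ∀ r ∈ (g.eval O x).support, r.2 ≤ p.eval x.size

theorem smallOracle_zero : SmallOracle fun _ => num 0 := fun _ => by simp [size_num]

theorem Feas.exists_prog {f : (Val → Val) → Val → PMF Val} (hf : Feas f) :
    ∃ g : Prog, g.PolyTime ∧ ∀ x, g.out x = f (fun _ => num 0) x := by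
  obtain ⟨g, p, h⟩ := hf
  exact ⟨g, ⟨p, fun x => (h _ smallOracle_zero x).2⟩, fun x => (h _ smallOracle_zero x).1⟩

/-- The running time of `g` is bounded only for the zero oracle, so the queries of `g` are replaced
by the constant answer before `g` is run next to another oracle. -/
theorem Feas.out {g : Prog} (hg : g.PolyTime) : Feas fun _ x => g.out x := by
  obtain ⟨p, h⟩ := hg
  refine ⟨g.strip, p, fun O _ x => ⟨by rw [Prog.outWith_strip], fun r hr => ?_⟩⟩
  rw [Prog.eval_strip] at hr
  exact h x r hr

theorem Feas.size_le {f : (Val → Val) → Val → PMF Val} (hf : Feas f) :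
    ∃ p : ℕ[X], ∀ O, SmallOracle O → ∀ x, ∀ v ∈ (f O x).support, v.size ≤ p.eval x.size := by
  obtain ⟨g, p, h⟩ := hf
  refine ⟨p, fun O hO x v hv => ?_⟩
  rw [← (h O hO x).1, Prog.outWith, PMF.support_map] at hv
  obtain ⟨r, hr, rfl⟩ := hv
  exact (Prog.size_le_time O g x r hr).trans ((h O hO x).2 r hr)

theorem Feas.bind_comp {f g : (Val → Val) → Val → PMF Val} (hf : Feas f) (hg : Feas g) :
    Feas fun O x => (f O x).bind (g O) := by
  obtain ⟨F, p, hF⟩ := hf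
  obtain ⟨G, r, hG⟩ := hg
  refine ⟨.seq F G, p + r.comp p, fun O hO x => ⟨?_, ?_⟩⟩
  · rw [Prog.outWith_seq, (hF O hO x).1]
    congr 1; funext y; exact (hG O hO y).1
  · intro s hs
    simp only [Prog.eval, PMF.mem_support_bind_iff, PMF.support_map, Set.mem_image] at hs
    obtain ⟨a, ha, b, hb, rfl⟩ := hs
    have h1 := (hF O hO x).2 a ha
    have h2 := (hG O hO a.1).2 b hb
    have h3 := polyNat_mono r ((Prog.size_le_time O F x a ha).trans h1)
    simp only [eval_add, eval_comp]; omega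

theorem Feas.pair {f g : (Val → Val) → Val → PMF Val} (hf : Feas f) (hg : Feas g) :
    Feas fun O x => (f O x).bind fun a => (g O x).map (Val.pair a) := by
  obtain ⟨F, p, hF⟩ := hf
  obtain ⟨G, r, hG⟩ := hg
  refine ⟨.fork F G, p + r + 1, fun O hO x => ⟨?_, ?_⟩⟩
  · rw [Prog.outWith_fork, (hF O hO x).1, (hG O hO x).1]
  · intro s hs
    simp only [Prog.eval, PMF.mem_support_bind_iff, PMF.support_map, Set.mem_image] at hs
    obtain ⟨a, ha, b, hb, rfl⟩ := hs
    have h1 := (hF O hO x).2 a ha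
    have h2 := (hG O hO x).2 b hb
    simp only [eval_add, eval_one]; omega

theorem Feas.cond {c f g : (Val → Val) → Val → PMF Val} (hc : Feas c) (hf : Feas f)
    (hg : Feas g) :
    Feas fun O x => (c O x).bind fun a => if a.isZero then g O x else f O x := by
  obtain ⟨C, t, hC⟩ := hc
  obtain ⟨F, p, hF⟩ := hf
  obtain ⟨G, r, hG⟩ := hg
  refine ⟨.cond C F G, t + p + r, fun O hO x => ⟨?_, ?_⟩⟩
  · rw [Prog.outWith_cond, (hF O hO x).1, (hG O hO x).1, (hC O hO x).1]
  · intro s hs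
    simp only [Prog.eval, PMF.mem_support_bind_iff, PMF.support_map, Set.mem_image] at hs
    obtain ⟨a, ha, b, hb, rfl⟩ := hs
    have h1 := (hC O hO x).2 a ha
    simp only [eval_add]
    split at hb
    · have h2 := (hG O hO x).2 b hb
      omega
    · have h2 := (hF O hO x).2 b hb
      omega

theorem Feas.oracle : Feas fun O x => PMF.pure (O x) := by
  refine ⟨.oracle, X + 8, fun O hO x => ⟨?_, ?_⟩⟩
  · simp [Prog.outWith, Prog.eval, PMF.pure_map]
  · intro s hs
    simp [Prog.eval] at hs
    subst hs
    have := hO x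
    simp; omega

/-- A loop runs in polynomial time if the number of passes and the length of the state are
polynomially bounded. -/
theorem Feas.loop {F : (Val → Val) → Val → PMF Val} (hF : Feas F)
    {k : Val → ℕ} (hkb : PolyBdd k) {y : Val → Val}
    (hky : Feas fun _ x => PMF.pure (Val.pair (num (k x)) (y x)))
    (hb : ∃ p : ℕ[X], ∀ O, SmallOracle O → ∀ x, ∀ i ≤ k x, ∀ v ∈ (iterK (F O) i (y x)).support,
      v.size ≤ p.eval x.size) :
    Feas fun O x => iterK (F O) (k x) (y x) := by
  obtain ⟨f, p, hf⟩ := hF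
  obtain ⟨pk, hkb⟩ := hkb
  obtain ⟨pb, hb⟩ := hb
  have hsz := hky.size_le
  obtain ⟨ps, hsz⟩ := hsz
  suffices h : ∃ q : ℕ[X], ∀ O, SmallOracle O → ∀ x,
      ∀ r ∈ ((Prog.loop f).eval O (Val.pair (num (k x)) (y x))).support, r.2 ≤ q.eval x.size by
    obtain ⟨q, hq⟩ := h
    obtain ⟨g, r, hg⟩ := hky
    refine ⟨.seq g (.loop f), r + q, fun O hO x => ⟨?_, ?_⟩⟩
    · rw [Prog.outWith_seq, (hg O hO x).1, PMF.pure_bind, Prog.outWith_loop]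
      congr 1; funext x; exact (hf O hO x).1
    · intro s hs
      simp only [Prog.eval, PMF.mem_support_bind_iff, PMF.support_map, Set.mem_image] at hs
      obtain ⟨a, ha, b, hb, rfl⟩ := hs
      have h1 := (hg O hO x).2 a ha
      have h2 := Prog.mem_support_outWith O ha
      rw [(hg O hO x).1, PMF.support_pure, Set.mem_singleton_iff] at h2
      rw [h2] at hb
      have h3 := hq O hO x b hb
      simp only [eval_add]; omega
  -- setting up the loop, and a bound for one pass on each of the states that occur
  refine ⟨ps + pk * (p.comp pb + 1), fun O hO x => ?_⟩
  have hs := hsz O hO x _ (by rw [PMF.support_pure]; rfl)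
  rw [Prog.eval_loop]
  have key : ∀ i ≤ k x, ∀ r ∈ (Prog.loopLaw O f (Val.pair (num (k x)) (y x)).size (y x) i).support,
      r.1 ∈ (iterK (F O) i (y x)).support ∧
        r.2 ≤ ps.eval x.size + i * (p.eval (pb.eval x.size) + 1) := by
    intro i
    induction i with
    | zero => 
      intro _ r hr
      simp only [Prog.loopLaw, PMF.support_pure, Set.mem_singleton_iff] at hr
      subst hr
      simpa [iterK] using hs
    | succ i ih =>
      intro hi r hr
      simp only [Prog.loopLaw, PMF.mem_support_bind_iff, PMF.support_map, Set.mem_image] at hr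
      obtain ⟨a, ha, b, hbb, rfl⟩ := hr
      obtain ⟨h1, h2⟩ := ih (by omega) a ha
      refine ⟨?_, ?_⟩
      · simp only [iterK, PMF.mem_support_bind_iff]
        refine ⟨a.1, h1, ?_⟩
        rw [← (hf O hO a.1).1]
        exact Prog.mem_support_outWith O hbb
      · have h3 := (hf O hO a.1).2 b hbb
        have h4 := polyNat_mono p (hb O hO x i (by omega) _ h1)
        have : (i + 1) * (p.eval (pb.eval x.size) + 1) =
          i * (p.eval (pb.eval x.size) + 1) + (p.eval (pb.eval x.size) + 1) := by ring
        simp only [this]; omega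
  intro r hr
  refine (key _ le_rfl r hr).2.trans ?_
  simp only [eval_add, eval_mul, eval_comp, eval_one]
  gcongr
  exact hkb x

end

noncomputable section
open Val

/-! ### Functions computable in polynomial time -/

/-- Types whose elements are written as data. -/
class Coded (α : Type) where
  /-- the datum that stands for an element -/
  toVal : α → Val

instance : Coded Val := ⟨id⟩

instance : Coded ℕ := ⟨num⟩

open Classical in
/-- A truth value is written as `1` or `0`. -/
instance : Coded Prop := ⟨fun p => num (if p then 1 else 0)⟩

/-- `f` is computed by a deterministic program in polynomial time. The closure properties are
registered with `fun_prop`, which then plays the part of a compiler. -/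
@[fun_prop]
def PF {α : Type} [Coded α] (f : Val → α) : Prop :=
  Feas fun _ x => PMF.pure (Coded.toVal (f x))

attribute [fun_prop] PolyBdd

theorem toVal_val (v : Val) : Coded.toVal v = v := rfl

theorem Feas.op (p : Op) : Feas fun _ x => PMF.pure (p.apply x) := by
  suffices h : ∃ q : ℕ[X], ∀ x : Val, (p.apply x).size ≤ q.eval x.size by
    obtain ⟨q, hq⟩ := h
    refine ⟨.op p, X + q, fun O _ x => ⟨Prog.outWith_op O p x, fun r hr => ?_⟩⟩
    simp only [Prog.eval, PMF.support_pure, Set.mem_singleton_iff] at hr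
    subst hr
    have := hq x
    simp; omega
  have h0 : ∀ x : Val, (num 0).size ≤ (X + 2 : ℕ[X]).eval x.size := by
    intro x; simp [size_num]
  have h1 : ∀ x : Val, (num 1).size ≤ (X + 2 : ℕ[X]).eval x.size := by
    intro x; have := two_le_size x; simp [size_num]; omega
  have hsz : ∀ a b : ℕ, b ≤ a → b.size ≤ a.size := fun a b h => Nat.size_le_size h
  cases p with
  | id => exact ⟨X, fun x => by simp [Op.apply]⟩
  | const v => exact ⟨Polynomial.C v.size, fun x => by simp [Op.apply]⟩
  | fst => exact ⟨X, fun x => by simpa [Op.apply] using size_fst_le x⟩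
  | snd => exact ⟨X, fun x => by simpa [Op.apply] using size_snd_le x⟩
  | isPair =>
    refine ⟨X + 2, fun x => ?_⟩
    cases x with
    | num n => exact h0 _
    | pair a b => exact h1 _
  | eq =>
    refine ⟨X + 2, fun x => ?_⟩
    cases x with
    | num n => exact h0 _
    | pair a b =>
      simp only [Op.apply]
      split
      · exact h1 _
      · exact h0 _
  | lt =>
    refine ⟨X + 2, fun x => ?_⟩
    match x with
    | .num n => exact h0 _
    | .pair (.num a) (.num b) =>
      simp only [Op.apply]
      split
      · exact h1 _
      · exact h0 _
    | .pair (.pair a b) c => exact h0 _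
    | .pair (.num a) (.pair b c) => exact h0 _
  | len =>
    refine ⟨2 * X + 2, fun x => ?_⟩
    have : x.size.size ≤ x.size := Nat.size_le.2 Nat.lt_two_pow_self
    simp [Op.apply, size_num]; omega
  | add =>
    refine ⟨X + 2, fun x => ?_⟩
    match x with
    | .num n => exact h0 _
    | .pair (.num a) (.num b) =>
      have : (a + b).size ≤ a.size + b.size + 1 := by
        rw [Nat.size_le]
        have h1 := Nat.lt_size_self a
        have h2 := Nat.lt_size_self b
        have h3 : 2 ^ a.size ≤ 2 ^ (a.size + b.size) := Nat.pow_le_pow_right (by omega) (by omega)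
        have h4 : 2 ^ b.size ≤ 2 ^ (a.size + b.size) := Nat.pow_le_pow_right (by omega) (by omega)
        rw [pow_succ]; omega
      simp [Op.apply, size_num, size_pair]; omega
    | .pair (.pair a b) c => exact h0 _
    | .pair (.num a) (.pair b c) => exact h0 _
  | sub =>
    refine ⟨X + 2, fun x => ?_⟩
    match x with
    | .num n => exact h0 _
    | .pair (.num a) (.num b) =>
      have := hsz a (a - b) (by omega)
      simp [Op.apply, size_num, size_pair]; omega
    | .pair (.pair a b) c => exact h0 _
    | .pair (.num a) (.pair b c) => exact h0 _
  | mul =>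
    refine ⟨X + 2, fun x => ?_⟩
    match x with
    | .num n => exact h0 _
    | .pair (.num a) (.num b) =>
      have : (a * b).size ≤ a.size + b.size := by
        rw [Nat.size_le, pow_add]
        exact Nat.mul_lt_mul'' (Nat.lt_size_self a) (Nat.lt_size_self b)
      simp [Op.apply, size_num, size_pair]; omega
    | .pair (.pair a b) c => exact h0 _
    | .pair (.num a) (.pair b c) => exact h0 _
  | div =>
    refine ⟨X + 2, fun x => ?_⟩
    match x with
    | .num n => exact h0 _
    | .pair (.num a) (.num b) =>
      have := hsz a (a / b) (Nat.div_le_self a b)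
      simp [Op.apply, size_num, size_pair]; omega
    | .pair (.pair a b) c => exact h0 _
    | .pair (.num a) (.pair b c) => exact h0 _
  | mod =>
    refine ⟨X + 2, fun x => ?_⟩
    match x with
    | .num n => exact h0 _
    | .pair (.num a) (.num b) =>
      have := hsz a (a % b) (Nat.mod_le a b)
      simp [Op.apply, size_num, size_pair]; omega
    | .pair (.pair a b) c => exact h0 _
    | .pair (.num a) (.pair b c) => exact h0 _

theorem PF.op (p : Op) : PF p.apply := Feas.op p

@[fun_prop]
theorem PF.id' : PF fun x : Val => x := PF.op .id

@[fun_prop]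
theorem PF.const {α : Type} [Coded α] (a : α) : PF fun _ => a := Feas.op (.const (Coded.toVal a))

theorem Feas.comp {f : (Val → Val) → Val → PMF Val} {g : Val → Val} (hf : Feas f) (hg : PF g) :
    Feas fun O x => f O (g x) := by
  have h := Feas.bind_comp hg hf
  simpa only [PMF.pure_bind, toVal_val] using h

@[fun_prop]
theorem PF.comp {α : Type} [Coded α] {f : Val → α} {g : Val → Val} (hf : PF f) (hg : PF g) :
    PF fun x => f (g x) :=
  Feas.comp (f := fun _ x => PMF.pure (Coded.toVal (f x))) hf hg

@[fun_prop]
protected theorem PF.pair {f g : Val → Val} (hf : PF f) (hg : PF g) :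
    PF fun x => Val.pair (f x) (g x) := by
  have h := Feas.pair hf hg
  simp only [PMF.pure_bind, PMF.pure_map] at h
  exact h

@[fun_prop]
protected theorem PF.num {f : Val → ℕ} (hf : PF f) : PF fun x => num (f x) := hf

@[fun_prop]
protected theorem PF.fst {f : Val → Val} (hf : PF f) : PF fun x => (f x).fst := (PF.op .fst).comp hf

@[fun_prop]
protected theorem PF.snd {f : Val → Val} (hf : PF f) : PF fun x => (f x).snd := (PF.op .snd).comp hf

@[fun_prop]
protected theorem PF.toNat {f : Val → Val} (hf : PF f) : PF fun x => (f x).toNat := by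
  have h : PF fun x => Op.add.apply (Val.pair (f x) (.num 0)) :=
    (PF.op .add).comp (hf.pair (PF.const _))
  have e : (fun x => Op.add.apply (Val.pair (f x) (.num 0))) = fun x => .num (f x).toNat := by
    funext x
    cases f x <;> rfl
  rwa [e] at h

@[fun_prop]
theorem PF.add {f g : Val → ℕ} (hf : PF f) (hg : PF g) : PF fun x => f x + g x :=
  (PF.op .add).comp (hf.num.pair hg.num)

@[fun_prop]
theorem PF.sub {f g : Val → ℕ} (hf : PF f) (hg : PF g) : PF fun x => f x - g x :=
  (PF.op .sub).comp (hf.num.pair hg.num)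

@[fun_prop]
theorem PF.mul {f g : Val → ℕ} (hf : PF f) (hg : PF g) : PF fun x => f x * g x :=
  (PF.op .mul).comp (hf.num.pair hg.num)

@[fun_prop]
theorem PF.div {f g : Val → ℕ} (hf : PF f) (hg : PF g) : PF fun x => f x / g x :=
  (PF.op .div).comp (hf.num.pair hg.num)

@[fun_prop]
theorem PF.mod {f g : Val → ℕ} (hf : PF f) (hg : PF g) : PF fun x => f x % g x :=
  (PF.op .mod).comp (hf.num.pair hg.num)

@[fun_prop]
protected theorem PF.size {f : Val → Val} (hf : PF f) : PF fun x => (f x).size := (PF.op .len).comp hf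

@[fun_prop]
theorem PF.natSize {f : Val → ℕ} (hf : PF f) : PF fun x => (f x).size := by
  have h : PF fun x => ((Val.num (f x)).size - 2) / 2 := by fun_prop
  simpa [size_num] using h

@[fun_prop]
theorem PF.eq {f g : Val → Val} (hf : PF f) (hg : PF g) : PF fun x => f x = g x := by
  have h : PF fun x => Op.eq.apply (Val.pair (f x) (g x)) := (PF.op .eq).comp (hf.pair hg)
  have e : (fun x => Op.eq.apply (Val.pair (f x) (g x))) = fun x => Coded.toVal (f x = g x) := by
    funext x
    simp only [Op.apply, Coded.toVal]
    split <;> simp_all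
  rw [e] at h
  exact h

@[fun_prop]
theorem PF.natEq {f g : Val → ℕ} (hf : PF f) (hg : PF g) : PF fun x => f x = g x := by
  have h : PF fun x => Val.num (f x) = .num (g x) := by fun_prop
  simpa only [Val.num.injEq] using h

@[fun_prop]
theorem PF.natLt {f g : Val → ℕ} (hf : PF f) (hg : PF g) : PF fun x => f x < g x := by
  have h : PF fun x => Op.lt.apply (Val.pair (.num (f x)) (.num (g x))) :=
    (PF.op .lt).comp (hf.num.pair hg.num)
  have e : (fun x => Op.lt.apply (Val.pair (.num (f x)) (.num (g x)))) =
      fun x => Coded.toVal (f x < g x) := by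
    funext x
    simp only [Op.apply, Coded.toVal]
    split <;> simp_all
  rw [e] at h
  exact h

@[fun_prop]
protected theorem PF.ite {α : Type} [Coded α] {p : Val → Prop} [∀ x, Decidable (p x)] {f g : Val → α}
    (hp : PF p) (hf : PF f) (hg : PF g) : PF fun x => if p x then f x else g x := by
  have h := Feas.cond hp hf hg
  have e : (fun (_ : Val → Val) x => PMF.pure (Coded.toVal (if p x then f x else g x))) =
      fun O x => (PMF.pure (Coded.toVal (p x))).bind fun a =>
        if a.isZero then PMF.pure (Coded.toVal (g x)) else PMF.pure (Coded.toVal (f x)) := by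
    funext O x
    by_cases hx : p x
    · simp [hx, Coded.toVal, Val.isZero]
    · simp [hx, Coded.toVal, Val.isZero]
  unfold PF
  rw [e]
  exact h

open Classical in
@[fun_prop]
protected theorem PF.not {p : Val → Prop} (hp : PF p) : PF fun x => ¬ p x := by
  have h : PF fun x => if p x then False else True := by fun_prop
  have e : (fun x => if p x then False else True) = fun x => ¬ p x := by
    funext x; by_cases hx : p x <;> simp [hx]
  rwa [e] at h

@[fun_prop]
theorem PF.natLe {f g : Val → ℕ} (hf : PF f) (hg : PF g) : PF fun x => f x ≤ g x := by
  have h : PF fun x => ¬ g x < f x := by fun_prop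
  simpa only [not_lt] using h

open Classical in
@[fun_prop]
protected theorem PF.and {p q : Val → Prop} (hp : PF p) (hq : PF q) : PF fun x => p x ∧ q x := by
  have h : PF fun x => if p x then q x else False := by fun_prop
  have e : (fun x => if p x then q x else False) = fun x => p x ∧ q x := by
    funext x; by_cases hx : p x <;> simp [hx]
  rwa [e] at h

@[fun_prop]
protected theorem PF.min {f g : Val → ℕ} (hf : PF f) (hg : PF g) : PF fun x => min (f x) (g x) := by
  have h : PF fun x => if f x ≤ g x then f x else g x := by fun_prop
  simpa only [← min_def] using h

/-! ### Polynomially bounded quantities -/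

theorem PF.polyBdd_size {f : Val → Val} (hf : PF f) : PolyBdd fun x => (f x).size := by
  obtain ⟨p, h⟩ := Feas.size_le hf
  exact ⟨p, fun x => h _ smallOracle_zero x _ (by rw [PMF.support_pure]; rfl)⟩

theorem PolyBdd.mono {f g : Val → ℕ} (hg : PolyBdd g) (h : ∀ x, f x ≤ g x) : PolyBdd f := by
  obtain ⟨p, hp⟩ := hg
  exact ⟨p, fun x => (h x).trans (hp x)⟩

@[fun_prop]
theorem PolyBdd.const (k : ℕ) : PolyBdd fun _ => k := ⟨Polynomial.C k, fun x => by simp⟩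

@[fun_prop]
theorem PolyBdd.comp {f : Val → ℕ} {g : Val → Val} (hf : PolyBdd f) (hg : PF g) :
    PolyBdd fun x => f (g x) := by
  obtain ⟨p, hp⟩ := hf
  obtain ⟨r, hr⟩ := hg.polyBdd_size
  refine ⟨p.comp r, fun x => (hp _).trans ?_⟩
  rw [eval_comp]
  exact polyNat_mono p (hr x)

theorem PolyBdd.natSize {f : Val → ℕ} (hf : PF f) : PolyBdd fun x => (f x).size :=
  hf.num.polyBdd_size.mono fun x => by rw [size_num]; omega

/-! ### Loops over an index -/

theorem Feas.bind {f g : (Val → Val) → Val → PMF Val} (hf : Feas f) (hg : Feas g) :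
    Feas fun O x => (f O x).bind fun v => g O (Val.pair x v) := by
  have h := Feas.bind_comp (Feas.pair PF.id' hf) hg
  simpa only [PMF.pure_bind, PMF.bind_map, toVal_val, Function.comp_def] using h

theorem Feas.map {f : (Val → Val) → Val → PMF Val} (hf : Feas f) {g : Val → Val} (hg : PF g) :
    Feas fun O x => (f O x).map fun v => g (Val.pair x v) :=
  Feas.bind hf hg

theorem PF.iterate {F : Val → Val} (hF : PF F) {k : Val → ℕ} (hk : PF k) (hkb : PolyBdd k)
    {y : Val → Val} (hy : PF y)
    (hb : ∃ p : ℕ[X], ∀ x, ∀ i ≤ k x, (F^[i] (y x)).size ≤ p.eval x.size) :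
    PF fun x => F^[k x] (y x) := by
  obtain ⟨p, hb⟩ := hb
  have h := Feas.loop hF hkb (hk.num.pair hy) ⟨p, fun O _ x i hi v hv => by
    rw [show (fun x => PMF.pure (Coded.toVal (F x))) = fun x => PMF.pure (F x) from rfl,
      iterK_pure, PMF.support_pure, Set.mem_singleton_iff] at hv
    subst hv; exact hb x i hi⟩
  have e : (fun (_ : Val → Val) x => iterK (fun x => PMF.pure (Coded.toVal (F x))) (k x) (y x)) =
      fun _ x => PMF.pure (Coded.toVal (F^[k x] (y x))) := by
    funext O x; exact iterK_pure F _ _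
  rwa [e] at h

/-- Draw `f (n - 1), …, f 0` and combine them one after the other with an accumulator. -/
def rfold (op : Val → Val → Val) (f : ℕ → PMF Val) : ℕ → Val → PMF Val
  | 0, a => PMF.pure a
  | n + 1, a => (f n).bind fun v => rfold op f n (op v a)

/-- The length condition on `op` keeps the accumulator polynomially long. -/
protected theorem Feas.rfold {op : Val → Val → Val} (hop : PF fun z => op z.fst z.snd)
    (hsz : ∀ a b, (op a b).size ≤ a.size + b.size + 1) {k : Val → ℕ} (hk : PF k)
    (hkb : PolyBdd k) {f : (Val → Val) → Val → ℕ → PMF Val}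
    (hf : Feas fun O y => f O y.fst y.snd.toNat) (a : Val) :
    Feas fun O x => rfold op (f O x) (k x) a := by
  obtain ⟨pf, hpf⟩ := hf.size_le
  obtain ⟨pk, (hpk : ∀ x, (Val.num (k x)).size ≤ _)⟩ := hk.num.polyBdd_size
  obtain ⟨pb, hpb⟩ := id hkb
  -- the loop state consists of a counter, the accumulator and the input
  let F : (Val → Val) → Val → PMF Val := fun O s =>
    (f O s.snd.snd (s.fst.toNat - 1)).map fun v =>
      .pair (.num (s.fst.toNat - 1)) (.pair (op v s.snd.fst) s.snd.snd)
  have hF : Feas F := by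
    have h1 : Feas fun O s => f O s.snd.snd (s.fst.toNat - 1) :=
      Feas.comp (g := fun s => .pair s.snd.snd (.num (s.fst.toNat - 1))) hf (by fun_prop)
    have hop' : PF fun y : Val => op y.snd y.fst.snd.fst :=
      hop.comp (g := fun y => .pair y.snd y.fst.snd.fst) (by fun_prop)
    exact h1.map (g := fun y => .pair (.num (y.fst.fst.toNat - 1))
      (.pair (op y.snd y.fst.snd.fst) y.fst.snd.snd))
      (PF.pair (by fun_prop) (hop'.pair (by fun_prop)))
  have hy : PF fun x => Val.pair (.num (k x)) (.pair (.num (k x)) (.pair a x)) := by fun_prop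
  have hstate : ∀ O x n a, (iterK (F O) n (.pair (.num n) (.pair a x))).map
      (fun v => v.snd.fst) = _root_.rfold op (f O x) n a := by
    intro O x n
    induction n with
    | zero => intro a; simp [iterK, _root_.rfold, PMF.pure_map]
    | succ n ih =>
      intro a
      rw [iterK_succ', PMF.map_bind]
      simp only [F, PMF.bind_map, _root_.rfold, snd_pair, fst_pair, toNat_num,
        Nat.add_sub_cancel, Function.comp_def, ih]
  have hloop := Feas.loop hF hkb hy ⟨pk + Polynomial.C a.size + pb * (pf.comp (X + pk + 1) + 1) +
      X + 2, fun O hO x i hi v hv => ?_⟩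
  · have h := hloop.map (g := fun y => y.snd.snd.fst) (by fun_prop)
    simpa only [snd_pair, hstate] using h
  · have key : ∀ i ≤ k x, ∀ v ∈ (iterK (F O) i (.pair (.num (k x)) (.pair a x))).support,
        ∃ b : Val, v = .pair (.num (k x - i)) (.pair b x) ∧
          b.size ≤ a.size + i * (pf.eval (x.size + pk.eval x.size + 1) + 1) := by
      intro i
      induction i with
      | zero =>
        intro _ v hv
        simp only [iterK, PMF.support_pure, Set.mem_singleton_iff] at hv
        exact ⟨a, by simpa using hv, by simp⟩
      | succ i ih =>
        intro hi v hv
        simp only [iterK, PMF.mem_support_bind_iff] at hv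
        obtain ⟨w, hw, hv⟩ := hv
        obtain ⟨b, rfl, hb⟩ := ih (by omega) w hw
        simp only [F, PMF.support_map, Set.mem_image, snd_pair, fst_pair, toNat_num] at hv
        obtain ⟨u, hu, rfl⟩ := hv
        refine ⟨op u b, by rw [Nat.sub_sub], ?_⟩
        have h1 := hpf O hO (.pair x (.num (k x - i - 1))) u hu
        have h2 : pf.eval (Val.pair x (.num (k x - i - 1))).size ≤
            pf.eval (x.size + pk.eval x.size + 1) := by
          refine polyNat_mono _ ?_
          have h3 := hpk x
          have h4 : (k x - i - 1).size ≤ (k x).size := Nat.size_le_size (by omega)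
          rw [size_num] at h3
          rw [size_pair, size_num]; omega
        have h3 := hsz u b
        rw [Nat.succ_mul]; omega
    obtain ⟨b, rfl, hb⟩ := key i hi v hv
    have h3 := hpk x
    have h4 : (k x - i).size ≤ (k x).size := Nat.size_le_size (by omega)
    have h5 : i * (pf.eval (x.size + pk.eval x.size + 1) + 1) ≤
        pb.eval x.size * (pf.eval (x.size + pk.eval x.size + 1) + 1) := by
      gcongr; exact hi.trans (hpb x)
    rw [size_num] at h3
    rw [size_pair, size_pair, size_num]
    simp only [eval_add, eval_mul, eval_comp, eval_C, eval_X, eval_one, eval_ofNat]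
    omega

/-- The deterministic version of `rfold`. -/
def dfold (op : Val → Val → Val) (f : ℕ → Val) : ℕ → Val → Val
  | 0, a => a
  | n + 1, a => dfold op f n (op (f n) a)

theorem rfold_pure (op : Val → Val → Val) (f : ℕ → Val) (n : ℕ) (a : Val) :
    rfold op (fun i => PMF.pure (f i)) n a = PMF.pure (dfold op f n a) := by
  induction n generalizing a with
  | zero => rfl
  | succ n ih => simp [rfold, dfold, ih]

protected theorem PF.dfold {op : Val → Val → Val} (hop : PF fun z => op z.fst z.snd)
    (hsz : ∀ a b, (op a b).size ≤ a.size + b.size + 1) {k : Val → ℕ} (hk : PF k)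
    (hkb : PolyBdd k) {f : Val → ℕ → Val}
    (hf : PF fun y => f y.fst y.snd.toNat) (a : Val) :
    PF fun x => dfold op (f x) (k x) a := by
  have h := Feas.rfold hop hsz hk hkb (f := fun _ x i => PMF.pure (f x i)) hf a
  simpa only [rfold_pure, PF, toVal_val] using h

/-- The list of the values `f 0, …, f (k - 1)`. -/
def tab (k : ℕ) (f : ℕ → Val) : Val := (List.ofFn fun i : Fin k => f i).foldr Val.pair (num 0)

theorem dfold_pair (f : ℕ → Val) (n : ℕ) (a : Val) :
    dfold Val.pair f n a = (List.ofFn fun i : Fin n => f i).foldr Val.pair a := by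
  induction n generalizing a with
  | zero => rfl
  | succ n ih => rw [List.ofFn_succ']; simp [dfold, ih]

@[fun_prop]
protected theorem PF.tab {k : Val → ℕ} (hk : PF k) (hkb : PolyBdd k) {f : Val → ℕ → Val}
    (hf : PF fun y => f y.fst y.snd.toNat) : PF fun x => tab (k x) (fun i => f x i) := by
  have h := PF.dfold (op := Val.pair) (by fun_prop) (fun a b => (size_pair a b).le) hk hkb hf
    (.num 0)
  simpa only [dfold_pair, _root_.tab] using h

@[fun_prop]
protected theorem PF.sum {k : Val → ℕ} (hk : PF k) (hkb : PolyBdd k) {f : Val → ℕ → ℕ}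
    (hf : PF fun y => f y.fst y.snd.toNat) :
    PF fun x => ∑ i ∈ Finset.range (k x), f x i := by
  have hadd : ∀ (f : ℕ → ℕ) (n a : ℕ), _root_.dfold (fun u v => .num (u.toNat + v.toNat))
      (fun i => .num (f i)) n (.num a) = .num (∑ i ∈ Finset.range n, f i + a) := by
    intro f n
    induction n with
    | zero => intro a; simp [_root_.dfold]
    | succ n ih => intro a; simp [_root_.dfold, ih, Finset.sum_range_succ]; ring
  have h := PF.dfold (op := fun u v => .num (u.toNat + v.toNat)) (by fun_prop) (fun u v => by
    have h1 : ∀ v : Val, 2 * v.toNat.size + 2 ≤ v.size := by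
      intro v
      cases v with
      | num n => simp [size_num]
      | pair a b => simpa [Val.toNat] using two_le_size _
    have h2 : (u.toNat + v.toNat).size ≤ u.toNat.size + v.toNat.size + 1 := by
      rw [Nat.size_le]
      have h1 := Nat.lt_size_self u.toNat
      have h2 := Nat.lt_size_self v.toNat
      have h3 : 2 ^ u.toNat.size ≤ 2 ^ (u.toNat.size + v.toNat.size) :=
        Nat.pow_le_pow_right (by omega) (by omega)
      have h4 : 2 ^ v.toNat.size ≤ 2 ^ (u.toNat.size + v.toNat.size) :=
        Nat.pow_le_pow_right (by omega) (by omega)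
      rw [pow_succ]; omega
    have h3 := h1 u
    have h4 := h1 v
    rw [size_num]; omega) hk hkb (f := fun x i => .num (f x i)) hf.num (.num 0)
  simp only [hadd, add_zero] at h
  exact h

/-- The entry with index `i` of a list. -/
def nth (l : Val) (i : ℕ) : Val := (snd^[i] l).fst

theorem iterate_snd_zero (i : ℕ) : snd^[i] (num 0) = num 0 := by
  induction i with
  | zero => rfl
  | succ i ih => rw [Function.iterate_succ_apply]; exact ih

theorem iterate_snd_of_size_le (l : Val) : ∀ i, l.size ≤ i → snd^[i] l = num 0 := by
  induction l with
  | num n =>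
    intro i hi
    rw [size_num] at hi
    obtain ⟨i, rfl⟩ : ∃ j, i = j + 1 := ⟨i - 1, by omega⟩
    rw [Function.iterate_succ_apply]
    exact iterate_snd_zero i
  | pair a b _ ih =>
    intro i hi
    rw [size_pair] at hi
    obtain ⟨i, rfl⟩ : ∃ j, i = j + 1 := ⟨i - 1, by omega⟩
    rw [Function.iterate_succ_apply]
    exact ih i (by omega)

theorem size_iterate_snd_le (l : Val) (i : ℕ) : (snd^[i] l).size ≤ l.size := by
  induction i with
  | zero => exact le_rfl
  | succ i ih => rw [Function.iterate_succ_apply']; exact (size_snd_le _).trans ih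

@[fun_prop]
protected theorem PF.nth {l : Val → Val} {i : Val → ℕ} (hl : PF l) (hi : PF i) :
    PF fun x => nth (l x) (i x) := by
  -- beyond the length of the list nothing changes, so the number of passes can be cut there
  have h : PF fun x => Val.snd^[min (i x) (l x).size] (l x) := by
    refine PF.iterate (F := Val.snd) (by fun_prop) (by fun_prop)
      (hl.polyBdd_size.mono fun x => min_le_right _ _) hl ?_
    obtain ⟨p, hp⟩ := hl.polyBdd_size
    exact ⟨p, fun x i _ => (size_iterate_snd_le _ _).trans (hp x)⟩
  have e : (fun x => _root_.nth (l x) (i x)) = fun x => (Val.snd^[min (i x) (l x).size] (l x)).fst := by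
    funext x
    rcases le_total (i x) (l x).size with h | h
    · rw [min_eq_left h]; rfl
    · rw [min_eq_right h, iterate_snd_of_size_le _ _ le_rfl, _root_.nth,
        iterate_snd_of_size_le _ _ h]
  rw [e]
  exact h.fst

theorem nth_tab {k : ℕ} (f : ℕ → Val) {i : ℕ} (hi : i < k) : nth (tab k f) i = f i := by
  unfold tab
  induction k generalizing i f with
  | zero => omega
  | succ k ih =>
    rw [List.ofFn_succ, List.foldr_cons]
    cases i with
    | zero => rfl
    | succ i =>
      rw [nth, Function.iterate_succ_apply]
      exact ih (fun i => f (i + 1)) (by omega)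

/-- The exponent need not be small: the quotient is `0` once `t` exceeds the length of `a`. -/
@[fun_prop]
theorem PF.div_two_pow {a t : Val → ℕ} (ha : PF a) (ht : PF t) :
    PF fun x => a x / 2 ^ t x := by
  have hit : ∀ i n, (fun v : Val => .num (v.toNat / 2))^[i] (.num n) = .num (n / 2 ^ i) := by
    intro i n
    induction i with
    | zero => simp
    | succ i ih =>
      rw [Function.iterate_succ_apply', ih, pow_succ, ← Nat.div_div_eq_div_mul]; rfl
  have h : PF fun x => (fun v : Val => Val.num (v.toNat / 2))^[min (t x) (a x).size]
      (.num (a x)) := by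
    refine PF.iterate (by fun_prop) (by fun_prop)
      ((PolyBdd.natSize ha).mono fun x => min_le_right _ _) (by fun_prop) ?_
    obtain ⟨p, (hp : ∀ x, (Val.num (a x)).size ≤ _)⟩ := ha.num.polyBdd_size
    refine ⟨p, fun x i _ => (le_trans ?_ (hp x))⟩
    rw [hit, size_num, size_num]
    have := Nat.size_le_size (Nat.div_le_self (a x) (2 ^ i))
    omega
  have e : (fun x => .num (a x / 2 ^ t x)) =
      fun x => (fun v : Val => Val.num (v.toNat / 2))^[min (t x) (a x).size] (.num (a x)) := by
    funext x
    rw [hit]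
    rcases le_total (t x) (a x).size with h | h
    · rw [min_eq_left h]
    · have h1 := Nat.lt_size_self (a x)
      have h2 : 2 ^ (a x).size ≤ 2 ^ t x := Nat.pow_le_pow_right (by omega) h
      rw [min_eq_right h, Nat.div_eq_of_lt h1, Nat.div_eq_of_lt (by omega)]
  rw [← e] at h
  exact h

@[fun_prop]
theorem PF.two_pow_natSize {a : Val → ℕ} (ha : PF a) : PF fun x => 2 ^ (a x).size := by
  have hit : ∀ i, (fun v : Val => .num (2 * v.toNat))^[i] (.num 1) = .num (2 ^ i) := by
    intro i
    induction i with
    | zero => simp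
    | succ i ih => rw [Function.iterate_succ_apply', ih, pow_succ, mul_comm]; rfl
  have h : PF fun x => (fun v : Val => Val.num (2 * v.toNat))^[(a x).size] (.num 1) := by
    refine PF.iterate (by fun_prop) (by fun_prop) (PolyBdd.natSize ha) (by fun_prop) ?_
    obtain ⟨p, (hp : ∀ x, (Val.num (a x)).size ≤ _)⟩ := ha.num.polyBdd_size
    refine ⟨p + 2, fun x i hi => ?_⟩
    have := hp x
    rw [size_num] at this
    rw [hit, size_num, Nat.size_pow]
    simp only [eval_add, eval_ofNat]; omega
  simp only [hit] at h
  exact h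

end

noncomputable section

/-! ### Arithmetic of trits -/

theorem Trit.bounds (z : Trit) : -1 ≤ (z : ℤ) ∧ (z : ℤ) ≤ 1 := z.2

theorem br3_spec (b : ℤ) : ∃ k : ℤ, (br3 b : ℤ) = b + 3 * k := by
  refine ⟨-((b - Int.bmod b 3) / 3), ?_⟩
  have h : (3 : ℤ) ∣ b - Int.bmod b 3 := by
    rw [Int.bmod_def]
    split <;> omega
  show Int.bmod b 3 = _
  omega

theorem br3_eq_of_dvd {x : ℤ} {z : Trit} (h : (3 : ℤ) ∣ x - z) : br3 x = z := by
  obtain ⟨k, hk⟩ := br3_spec x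
  have h1 := Trit.bounds z
  have h2 := Trit.bounds (br3 x)
  apply Subtype.ext
  omega

theorem br3_congr {x y : ℤ} (h : (3 : ℤ) ∣ x - y) : br3 x = br3 y := by
  obtain ⟨k, hk⟩ := br3_spec y
  exact br3_eq_of_dvd (by omega)

theorem br3_coe (z : Trit) : br3 z = z := br3_eq_of_dvd (by simp)

theorem br3_sub_br3 (a b : Trit) (i : ℤ) :
    br3 ((a : ℤ) - br3 (-(b : ℤ) + i)) = br3 ((br3 ((a : ℤ) + b) : ℤ) - i) := by
  obtain ⟨k, hk⟩ := br3_spec (-(b : ℤ) + i)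
  obtain ⟨l, hl⟩ := br3_spec ((a : ℤ) + b)
  exact br3_congr (by omega)

theorem permPhi_mult3 (a b g e : Trit) :
    permPhi b e (mult3 a g) = mult3 (br3 ((a : ℤ) + b)) (br3 ((g : ℤ) + e)) := by
  funext x
  simp only [permPhi, mult3, br3_sub_br3]

theorem permPi_enc3 (z e : Trit) : permPi e (enc3 z) = enc3 (br3 ((z : ℤ) + e)) := by
  funext i
  simp only [permPi, enc3, br3_sub_br3]

theorem br3_neg_add_br3 (b i : Trit) : br3 (-(b : ℤ) + br3 ((b : ℤ) + i)) = i := by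
  obtain ⟨k, hk⟩ := br3_spec ((b : ℤ) + i)
  exact br3_eq_of_dvd (by omega)

theorem permPhi_injective {A : Type} (b e : Trit) :
    Function.Injective (permPhi (A := A) b e) := by
  intro v w h
  funext x
  have := congrFun h (br3 ((b : ℤ) + x.1), br3 ((e : ℤ) + x.2))
  simpa only [permPhi, br3_neg_add_br3] using this

theorem permPi_injective {A : Type} (e : Trit) : Function.Injective (permPi (A := A) e) := by
  intro v w h
  funext x
  have := congrFun h (br3 ((e : ℤ) + x))
  simpa only [permPi, br3_neg_add_br3] using this

theorem eq_mult3_iff (a b g e : Trit) (v : Trit × Trit → ℤ) :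
    v = mult3 a g ↔ permPhi b e v = mult3 (br3 ((a : ℤ) + b)) (br3 ((g : ℤ) + e)) := by
  rw [← permPhi_mult3, (permPhi_injective b e).eq_iff]

theorem eq_multV_iff {ι κ : Type} (a b : ι → Trit) (g e : κ → Trit)
    (v : ι → κ → Trit × Trit → ℤ) :
    v = multV a g ↔ permPhiV b e v = multV (addT a b) (addT g e) := by
  simp only [funext_iff (f := v), funext_iff (f := v _), funext_iff (f := permPhiV b e v),
    funext_iff (f := permPhiV b e v _)]
  exact forall_congr' fun i => forall_congr' fun j =>
    eq_mult3_iff (a i) (b i) (g j) (e j) (v i j)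

theorem br3_sub_eq_zero {a i : Trit} : (br3 ((a : ℤ) - i) : ℤ) = 0 ↔ a = i := by
  obtain ⟨k, hk⟩ := br3_spec ((a : ℤ) - i)
  have h1 := Trit.bounds a
  have h2 := Trit.bounds i
  have h3 := Trit.bounds (br3 ((a : ℤ) - i))
  rw [Subtype.ext_iff]
  omega

theorem exists_trit_ne (g : Trit) : ∃ j : Trit, g ≠ j := by
  refine ⟨br3 ((g : ℤ) + 1), fun h => ?_⟩
  obtain ⟨k, hk⟩ := br3_spec ((g : ℤ) + 1)
  rw [← h] at hk
  omega

/-- The first factor of a product is the row in which all entries of `mult3` vanish. -/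
theorem mult3_row_eq_zero {a g i : Trit} : (∀ j, mult3 a g (i, j) = 0) ↔ a = i := by
  constructor
  · intro h
    obtain ⟨j, hj⟩ := exists_trit_ne g
    have := h j
    simp only [mult3, mul_eq_zero, br3_sub_eq_zero] at this
    tauto
  · rintro rfl j
    simp only [mult3, mul_eq_zero]
    exact Or.inl (br3_sub_eq_zero.2 rfl)

theorem mult3_col_eq_zero {a g j : Trit} : (∀ i, mult3 a g (i, j) = 0) ↔ g = j := by
  constructor
  · intro h
    obtain ⟨i, hi⟩ := exists_trit_ne a
    have := h i
    simp only [mult3, mul_eq_zero, br3_sub_eq_zero] at this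
    tauto
  · rintro rfl i
    simp only [mult3, mul_eq_zero]
    exact Or.inr (br3_sub_eq_zero.2 rfl)

theorem mult3_injective {a g a' g' : Trit} (h : mult3 a g = mult3 a' g') : a = a' ∧ g = g' :=
  ⟨mult3_row_eq_zero.1 fun j => by rw [h]; exact mult3_row_eq_zero.2 rfl j,
    mult3_col_eq_zero.1 fun i => by rw [h]; exact mult3_col_eq_zero.2 rfl i⟩

theorem enc3_injective {z z' : Trit} (h : enc3 z = enc3 z') : z = z' := by
  have := congrFun h z'
  simp only [enc3, br3_sub_eq_zero.2 (rfl : z' = z')] at this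
  exact br3_sub_eq_zero.1 this

/-! ### The set of valid vectors and its permutations -/

namespace Params

variable {P : Params}

instance : NeZero P.n := ⟨by have := P.two_le_n; omega⟩

instance : NeZero P.ell := ⟨Nat.succ_ne_zero _⟩

instance : NeZero P.dB := ⟨Nat.succ_ne_zero _⟩

/-- `extend` on triples. The digits `(a, g, e)` of a valid vector range over the same set as the
labels, so both have the type `Label`. -/
def ext (l : P.Label) : P.Idx → ℤ := extend l.1 l.2.1 l.2.2

/-- Coordinatewise addition modulo 3. -/
def addLab (l m : P.Label) : P.Label :=
  (fun i => addT (l.1 i) (m.1 i), addT l.2.1 m.2.1, addT l.2.2 m.2.2)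

/-- Coordinatewise subtraction modulo 3. -/
def subLab (l m : P.Label) : P.Label :=
  (fun i k => br3 ((l.1 i k : ℤ) - m.1 i k), fun k => br3 ((l.2.1 k : ℤ) - m.2.1 k),
    fun k => br3 ((l.2.2 k : ℤ) - m.2.2 k))

theorem Gam_ext (η l : P.Label) : Gam η (ext l) = ext (addLab l η) := by
  funext x
  rcases x with ⟨i, k, m, s⟩ | ⟨y, s⟩
  · exact congrFun (permPhi_mult3 (l.1 i k) (η.1 i k) (l.2.1 m) (η.2.1 m)) s
  · exact congrFun (permPi_enc3 (l.2.2 y) (η.2.2 y)) s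

theorem ext_injective : Function.Injective (ext (P := P)) := by
  intro l m h
  have h1 : ∀ i k j, mult3 (l.1 i k) (l.2.1 j) = mult3 (m.1 i k) (m.2.1 j) := fun i k j =>
    funext fun s => congrFun h (.inl (i, k, j, s))
  refine Prod.ext ?_ (Prod.ext ?_ ?_)
  · funext i k
    exact (mult3_injective (h1 i k (0, 0))).1
  · funext j
    exact (mult3_injective (h1 0 (0, 0) j)).2
  · funext y
    exact enc3_injective (funext fun s => congrFun h (.inr (y, s)))

theorem VALID_eq_range : P.VALID = Set.range (ext (P := P)) := by
  ext v
  constructor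
  · rintro ⟨a, g, e, rfl⟩
    exact ⟨(a, g, e), rfl⟩
  · rintro ⟨l, rfl⟩
    exact ⟨l.1, l.2.1, l.2.2, rfl⟩

theorem ext_mem_VALID (l : P.Label) : ext l ∈ P.VALID := ⟨_, _, _, rfl⟩

theorem addLab_subLab (l m : P.Label) : addLab (subLab l m) m = l := by
  have h : ∀ a b : Trit, br3 ((br3 ((a : ℤ) - b) : ℤ) + b) = a := by
    intro a b
    obtain ⟨k, hk⟩ := br3_spec ((a : ℤ) - b)
    exact br3_eq_of_dvd (by omega)
  refine Prod.ext ?_ (Prod.ext ?_ ?_) <;> funext <;> exact h _ _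

theorem subLab_addLab (l m : P.Label) : subLab (addLab l m) m = l := by
  have h : ∀ a b : Trit, br3 ((br3 ((a : ℤ) + b) : ℤ) - b) = a := by
    intro a b
    obtain ⟨k, hk⟩ := br3_spec ((a : ℤ) + b)
    exact br3_eq_of_dvd (by omega)
  refine Prod.ext ?_ (Prod.ext ?_ ?_) <;> funext <;> exact h _ _

theorem addLab_comm (l m : P.Label) : addLab l m = addLab m l := by
  refine Prod.ext ?_ (Prod.ext ?_ ?_) <;> funext <;> simp only [addLab, addT, add_comm]

/-- Translation of labels is a bijection. -/
def addLabEquiv (l : P.Label) : P.Label ≃ P.Label where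
  toFun := addLab l
  invFun m := subLab m l
  left_inv m := by show subLab (addLab l m) l = m; rw [addLab_comm, subLab_addLab]
  right_inv m := by show addLab l (subLab m l) = m; rw [addLab_comm, addLab_subLab]

theorem Gam_injective {A : Type} (η : P.Label) : Function.Injective (Gam (A := A) η) := by
  intro v w h
  funext x
  rcases x with ⟨i, k, m, s⟩ | ⟨y, s⟩
  · have h1 : permPhi (η.1 i k) (η.2.1 m) (fun s => v (.inl (i, k, m, s))) =
        permPhi (η.1 i k) (η.2.1 m) (fun s => w (.inl (i, k, m, s))) :=
      _root_.funext fun s => congrFun h (.inl (i, k, m, s))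
    exact congrFun (permPhi_injective _ _ h1) s
  · have h1 : permPi (η.2.2 y) (fun s => v (.inr (y, s))) =
        permPi (η.2.2 y) (fun s => w (.inr (y, s))) :=
      _root_.funext fun s => congrFun h (.inr (y, s))
    exact congrFun (permPi_injective _ h1) s

theorem mem_VALID_iff_Gam (η : P.Label) (v : P.Idx → ℤ) : v ∈ P.VALID ↔ Gam η v ∈ P.VALID := by
  simp only [VALID_eq_range]
  constructor
  · rintro ⟨l, rfl⟩
    exact ⟨_, (Gam_ext η l).symm⟩
  · rintro ⟨l, hl⟩
    refine ⟨subLab l η, Gam_injective η ?_⟩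
    rw [Gam_ext, addLab_subLab, hl]

end Params

theorem PMF.map_equiv_uniformOfFintype {α β : Type*} [Fintype α] [Nonempty α] [Fintype β]
    [Nonempty β] (e : α ≃ β) :
    (PMF.uniformOfFintype α).map e = PMF.uniformOfFintype β := by
  ext b
  rw [PMF.map_apply, tsum_eq_single (e.symm b)]
  · simp [Fintype.card_congr e]
  · intro a ha
    rw [if_neg]
    rintro rfl
    simp at ha

theorem PMF.map_apply_of_injective {α β : Type*} (μ : PMF α) {f : α → β}
    (hf : Function.Injective f) (a : α) : μ.map f (f a) = μ a := by
  rw [PMF.map_apply, tsum_eq_single a]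
  · simp
  · intro b hb
    rw [if_neg]
    exact fun h => hb (hf h).symm

namespace Params

variable {P : Params}

/-- `Gam η` translates the digits by `η`, and a translate of a uniform label is uniform. -/
theorem map_Gam_uniform (l : P.Label) :
    (PMF.uniformOfFintype P.Label).map (fun η => Gam η (ext l)) =
      (PMF.uniformOfFintype P.Label).map ext := by
  have h : (fun η => Gam η (ext l)) = ext ∘ addLabEquiv l := _root_.funext fun η => Gam_ext η l
  rw [h, ← PMF.map_comp, PMF.map_equiv_uniformOfFintype]

theorem map_Gam_uniform_apply {w v : P.Idx → ℤ} (hw : w ∈ P.VALID) (hv : v ∈ P.VALID) :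
    (PMF.uniformOfFintype P.Label).map (fun η => Gam η w) v = (P.VALID.ncard : ENNReal)⁻¹ := by
  rw [VALID_eq_range] at hw hv ⊢
  obtain ⟨l, rfl⟩ := hw
  obtain ⟨m, rfl⟩ := hv
  rw [map_Gam_uniform, PMF.map_apply_of_injective _ ext_injective, PMF.uniformOfFintype_apply,
    ← Set.image_univ, Set.ncard_image_of_injective _ ext_injective, Set.ncard_univ,
    Nat.card_eq_fintype_card]

end Params

/-! ### Greedy decomposition -/

theorem weight_eq (B t : ℕ) : weight B t = (B / 2 ^ t + 1) / 2 := by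
  rw [weight, pow_succ, ← Nat.div_div_eq_div_mul, Nat.add_div_right _ (by positivity)]

theorem weight_add_div (B t : ℕ) : weight B t + B / 2 ^ (t + 1) = B / 2 ^ t := by
  rw [weight_eq, pow_succ, ← Nat.div_div_eq_div_mul]
  omega

theorem sum_weight (B t : ℕ) : ∑ s ∈ Finset.range t, weight B s + B / 2 ^ t = B := by
  induction t with
  | zero => simp
  | succ t ih => rw [Finset.sum_range_succ, add_assoc, weight_add_div, ih]

theorem div_two_pow_delta (B : ℕ) : B / 2 ^ delta B = 0 :=
  Nat.div_eq_of_lt (Nat.lt_pow_succ_log_self (by norm_num) B)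

theorem sum_weight_delta (B : ℕ) : ∑ s : Fin (delta B), weight B s = B := by
  have := sum_weight B (delta B)
  rwa [div_two_pow_delta, add_zero, Finset.sum_range] at this

/-- The invariant of the greedy decomposition: what is left after `t` steps is at most the sum
`⌊B / 2^t⌋` of the remaining weights. -/
theorem idecRem_le {B a : ℕ} (ha : a ≤ B) (t : ℕ) : idecRem B a t ≤ B / 2 ^ t := by
  induction t with
  | zero => simpa [idecRem]
  | succ t ih =>
    have h1 := weight_add_div B t
    have h2 := weight_eq B t
    rw [idecRem]
    split <;> omega

/-- The chosen weights and the remainder sum up to the number that is decomposed. -/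
theorem sum_idec {B : ℕ} (a t : ℕ) :
    (∑ s ∈ Finset.range t, if weight B s ≤ idecRem B a s then weight B s else 0) +
      idecRem B a t = a := by
  induction t with
  | zero => simp [idecRem]
  | succ t ih =>
    rw [Finset.sum_range_succ, idecRem]
    split <;> omega

theorem sum_sdec {B : ℕ} {z : ℤ} (hz : z.natAbs ≤ B) :
    ∑ t : Fin (delta B), (weight B t : ℤ) * (sdec B z t : ℤ) = z := by
  have h := sum_idec (B := B) z.natAbs (delta B)
  have h0 : idecRem B z.natAbs (delta B) = 0 := by
    have := idecRem_le hz (delta B)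
    rw [div_two_pow_delta] at this; omega
  rw [h0, add_zero, Finset.sum_range] at h
  have h1 : ∀ t : Fin (delta B), (weight B t : ℤ) * (sdec B z t : ℤ) =
      z.sign * ((if weight B t ≤ idecRem B z.natAbs t then weight B t else 0 : ℕ) : ℤ) := by
    intro t
    simp only [sdec]
    split
    · exact mul_comm _ _
    · simp
  simp only [h1, ← Finset.mul_sum, ← Nat.cast_sum]
  rw [h]
  exact Int.sign_mul_natAbs z

theorem gadget_mulVec {R ι : Type} [CommSemiring R] [Fintype ι] [DecidableEq ι] (B : ℕ)
    (v : ι × Fin (delta B) → R) (i : ι) :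
    (gadget R ι B).mulVec v i = ∑ t : Fin (delta B), (weight B t : R) * v (i, t) := by
  rw [Matrix.mulVec, dotProduct, Fintype.sum_prod_type, Finset.sum_eq_single i]
  · simp [gadget]
  · intro j _ hj
    simp [gadget, hj.symm]
  · simp

end

noncomputable section

/-! ### The linear equation behind the relation -/

namespace Params

variable {P : Params}

theorem tau_add (a b : P.Rq) : P.tau (a + b) = P.tau a + P.tau b := by
  funext i; simp [tau]

theorem tau_smul (x : P.Zq) (a : P.Rq) : P.tau (x • a) = x • P.tau a := by
  funext i; simp [tau]

theorem tau_sum {ι : Type} (s : Finset ι) (a : ι → P.Rq) :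
    P.tau (∑ i ∈ s, a i) = ∑ i ∈ s, P.tau (a i) := by
  funext j; simp [tau]

theorem nontrivial_Zq : Nontrivial P.Zq :=
  ZMod.nontrivial_iff.2 (by have := P.three_le_q; omega)

theorem natDegree_modulus : P.modulus.natDegree = P.n := by
  have : Nontrivial (ZMod P.q) := nontrivial_Zq
  rw [modulus, natDegree_X_pow_add_C]

theorem tau_root_pow {k : ℕ} (hk : k < P.n) (i : Fin P.n) :
    P.tau (AdjoinRoot.root P.modulus ^ k) i = if (i : ℕ) = k then 1 else 0 := by
  have : Nontrivial P.Zq := nontrivial_Zq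
  rw [tau, AdjoinRoot.root, ← map_pow, AdjoinRoot.modByMonicHom_mk,
    (modByMonic_eq_self_iff P.modulus_monic).2, coeff_X_pow]
  rw [degree_X_pow, degree_eq_natDegree P.modulus_monic.ne_zero, natDegree_modulus]
  exact_mod_cast hk

theorem root_pow_n : AdjoinRoot.root P.modulus ^ P.n = -1 := by
  have h : AdjoinRoot.mk P.modulus (X ^ P.n + Polynomial.C 1) = 0 := AdjoinRoot.mk_self
  rw [map_add, map_pow, AdjoinRoot.mk_X, AdjoinRoot.mk_C, map_one] at h
  exact eq_neg_of_add_eq_zero_left h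

theorem tau_injective : Function.Injective P.tau := by
  have : Nontrivial P.Zq := nontrivial_Zq
  intro a b h
  rw [← AdjoinRoot.mk_leftInverse P.modulus_monic a, ← AdjoinRoot.mk_leftInverse P.modulus_monic b]
  congr 1
  have hdeg : ∀ a : P.Rq, (AdjoinRoot.modByMonicHom P.modulus_monic a).natDegree < P.n := by
    intro a
    obtain ⟨f, rfl⟩ := AdjoinRoot.mk_surjective a
    rw [AdjoinRoot.modByMonicHom_mk, ← natDegree_modulus]
    refine natDegree_modByMonic_lt f P.modulus_monic fun h1 => ?_
    have := natDegree_modulus (P := P)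
    rw [h1, natDegree_one] at this
    have := P.two_le_n
    omega
  ext i
  by_cases hi : i < P.n
  · exact congrFun h ⟨i, hi⟩
  · rw [coeff_eq_zero_of_natDegree_lt, coeff_eq_zero_of_natDegree_lt] <;>
    · have := hdeg a
      have := hdeg b
      omega

/-- The ring element with given coefficients. -/
def ofTau (x : Fin P.n → P.Zq) : P.Rq := ∑ i, x i • AdjoinRoot.root P.modulus ^ (i : ℕ)

theorem tau_ofTau (x : Fin P.n → P.Zq) : P.tau (ofTau x) = x := by
  funext j
  simp only [ofTau, tau_sum, tau_smul, Finset.sum_apply, Pi.smul_apply, tau_root_pow (Fin.is_lt _),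
    Fin.val_inj, smul_eq_mul, mul_ite, mul_one, mul_zero, Finset.sum_ite_eq, Finset.mem_univ,
    if_true]

theorem ofTau_tau (a : P.Rq) : ofTau (P.tau a) = a := tau_injective (tau_ofTau _)

theorem tau_mul (a b : P.Rq) (r : Fin P.n) :
    P.tau (a * b) r = ∑ i : Fin P.n, ∑ j : Fin P.n,
      P.rot (AdjoinRoot.root P.modulus ^ (j : ℕ)) r i * P.tau a i * P.tau b j := by
  conv_lhs => rw [← ofTau_tau a, ← ofTau_tau b]
  simp only [ofTau, Finset.sum_mul, Finset.mul_sum, tau_sum, Finset.sum_apply, rot]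
  rw [Finset.sum_comm]
  refine Finset.sum_congr rfl fun i _ => Finset.sum_congr rfl fun j _ => ?_
  rw [smul_mul_smul_comm, tau_smul, Pi.smul_apply, smul_eq_mul,
    mul_comm (AdjoinRoot.root P.modulus ^ (i : ℕ))]
  ring

/-- The entries of the rotation matrices of the powers of `X`. -/
def rotCoeff (P : Params) (k r : ℕ) : P.Zq := if k = r then 1 else if k = r + P.n then -1 else 0

theorem rot_root_pow (j r i : Fin P.n) :
    P.rot (AdjoinRoot.root P.modulus ^ (j : ℕ)) r i = P.rotCoeff (j + i) r := by
  have hr := r.2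
  have hi := i.2
  have hj := j.2
  rw [rot, ← pow_add, rotCoeff]
  by_cases h : (j : ℕ) + i < P.n
  · rw [tau_root_pow h]
    simp only [eq_comm (a := (r : ℕ))]
    split
    · rfl
    · rw [if_neg (by omega)]
  · obtain ⟨k, hk⟩ : ∃ k, (j : ℕ) + i = k + P.n := ⟨j + i - P.n, by omega⟩
    have h1 : AdjoinRoot.root P.modulus ^ (k + P.n) =
        (-1 : P.Zq) • AdjoinRoot.root P.modulus ^ k := by
      rw [pow_add, root_pow_n, neg_one_smul, mul_neg_one]
    rw [hk, h1, tau_smul, Pi.smul_apply, tau_root_pow (by omega), smul_eq_mul]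
    have h3 : ¬ k + P.n = r := by omega
    by_cases h2 : (r : ℕ) = k
    · rw [if_pos h2, if_neg h3, if_pos (by omega), mul_one]
    · have h4 : ¬ k + P.n = r + P.n := by omega
      rw [if_neg h2, if_neg h3, if_neg h4, mul_zero]

theorem Q0_apply (r : Fin P.n) (k : P.AIdx) (m : P.GIdx) :
    P.Q0 r (k, m) = P.rotCoeff (m.1 + k.1) r * (weight P.half k.2 : P.Zq) * weight P.B m.2 := by
  rw [Q0, Matrix.mul_apply, Finset.sum_eq_single k, Matrix.mul_apply, Finset.sum_eq_single k.1]
  · rw [H, gadget, if_pos rfl, gadget, if_pos rfl, rot_root_pow]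
  · intro b _ hb
    rw [H, gadget, if_neg hb, mul_zero]
  · simp
  · intro b _ hb
    simp only [gadget]
    rw [if_neg hb, mul_zero]
  · simp

theorem sum_trit_ite {R : Type} [AddCommMonoid R] (f : Trit → R) :
    (∑ s : Trit, if (s : ℤ) = 0 then f s else 0) = f (br3 0) := by
  have h0 : ((br3 0 : Trit) : ℤ) = 0 := rfl
  rw [Finset.sum_eq_single (br3 0), if_pos h0]
  · intro b _ hb
    rw [if_neg]
    exact fun h => hb (Subtype.ext (h.trans h0.symm))
  · simp

/-- Only the entries labelled `(0, 0)` and `0` of the extended blocks meet nonzero columns. -/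
theorem M_mulVec (v : P.Idx → P.Zq) (i : Fin P.ell) (r : Fin P.n) :
    P.M.mulVec v (i, r) = (∑ k : P.AIdx, ∑ m : P.GIdx,
      P.rotCoeff (m.1 + k.1) r * (weight P.half k.2 : P.Zq) * (weight P.B m.2 : P.Zq) *
        v (.inl (i, k, m, (br3 0, br3 0)))) +
      ∑ t : Fin P.dB, (weight P.B t : P.Zq) * v (.inr (((i, r), t), br3 0)) := by
  rw [Matrix.mulVec, dotProduct, Fintype.sum_sum_type]
  congr 1
  · rw [Fintype.sum_prod_type, Finset.sum_eq_single i]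
    · rw [Fintype.sum_prod_type]
      refine Finset.sum_congr rfl fun k _ => ?_
      rw [Fintype.sum_prod_type]
      refine Finset.sum_congr rfl fun m _ => ?_
      rw [Fintype.sum_prod_type]
      simp only [M, M0, if_true, ite_mul, zero_mul, Q0_apply, ite_and]
      have h1 : ∀ x : Trit, (∑ y : Trit, if (x : ℤ) = 0 then if (y : ℤ) = 0 then
          P.rotCoeff (m.1 + k.1) r * (weight P.half k.2 : P.Zq) * (weight P.B m.2 : P.Zq) *
          v (.inl (i, k, m, (x, y))) else 0 else 0) = if (x : ℤ) = 0 then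
          P.rotCoeff (m.1 + k.1) r * (weight P.half k.2 : P.Zq) * (weight P.B m.2 : P.Zq) *
          v (.inl (i, k, m, (x, br3 0))) else 0 := by
        intro x
        split
        · exact sum_trit_ite fun y => P.rotCoeff (m.1 + k.1) r * (weight P.half k.2 : P.Zq) *
            (weight P.B m.2 : P.Zq) * v (.inl (i, k, m, (x, y)))
        · simp
      simp only [h1]
      exact sum_trit_ite fun x => P.rotCoeff (m.1 + k.1) r * (weight P.half k.2 : P.Zq) *
            (weight P.B m.2 : P.Zq) * v (.inl (i, k, m, (x, br3 0)))
    · intro i' _ hi'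
      refine Finset.sum_eq_zero fun x _ => ?_
      simp [M, M0, hi'.symm]
    · simp
  · rw [Fintype.sum_prod_type]
    have h1 : ∀ y : P.EIdx, (∑ s : Trit, P.M (i, r) (.inr (y, s)) * v (.inr (y, s))) =
        P.HlB (i, r) y * v (.inr (y, br3 0)) := by
      intro y
      simp only [M, M0, ite_mul, zero_mul]
      exact sum_trit_ite fun s => P.HlB (i, r) y * v (.inr (y, s))
    simp only [h1]
    exact gadget_mulVec P.B (fun y => v (.inr (y, br3 0))) (i, r)

theorem red_ext_inl (l : P.Label) (i : Fin P.ell) (k : P.AIdx) (m : P.GIdx) :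
    red (ext l) (.inl (i, k, m, (br3 0, br3 0))) = ((l.1 i k : ℤ) : P.Zq) * ((l.2.1 m : ℤ) : P.Zq) := by
  have h0 : ((br3 0 : Trit) : ℤ) = 0 := rfl
  simp [red, ext, extend, join, multV, mult3, h0, br3_coe]

theorem red_ext_inr (l : P.Label) (y : P.EIdx) :
    red (ext l) (.inr (y, br3 0)) = ((l.2.2 y : ℤ) : P.Zq) := by
  have h0 : ((br3 0 : Trit) : ℤ) = 0 := rfl
  simp [red, ext, extend, join, encV, enc3, h0, br3_coe]

/-- The elements `(a, g, e)` whose coefficients are recomposed from given digits. -/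
def recompose (l : P.Label) : P.Witness where
  a i := ofTau (P.H.mulVec fun k => ((l.1 i k : ℤ) : P.Zq))
  g := ofTau (P.HB.mulVec fun m => ((l.2.1 m : ℤ) : P.Zq))
  e i := ofTau fun r => P.HlB.mulVec (fun x => ((l.2.2 x : ℤ) : P.Zq)) (i, r)

/-- The matrix `M` computes `a · g + e` from the digits. -/
theorem M_mulVec_red_ext (l : P.Label) :
    P.M.mulVec (red (ext l)) = target fun i => (recompose l).a i * (recompose l).g +
      (recompose l).e i := by
  funext ⟨i, r⟩
  rw [M_mulVec, target, tau_add, Pi.add_apply, tau_mul]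
  congr 1
  · rw [Fintype.sum_prod_type]
    refine Finset.sum_congr rfl fun r' _ => ?_
    simp only [recompose, tau_ofTau, H, HB, gadget_mulVec, red_ext_inl, Fintype.sum_prod_type,
      rot_root_pow]
    rw [Finset.sum_comm]
    refine Finset.sum_congr rfl fun j _ => ?_
    rw [mul_assoc, Finset.sum_mul_sum, Finset.mul_sum]
    refine Finset.sum_congr rfl fun s _ => ?_
    rw [Finset.mul_sum]
    refine Finset.sum_congr rfl fun t _ => ?_
    ring
  · simp only [recompose, tau_ofTau, HlB, gadget_mulVec, red_ext_inr]

/-- The digits of the coefficients of a witness. -/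
def digits (w : P.Witness) : P.Label :=
  (fun i k => sdec P.half (P.tau (w.a i) k.1).valMinAbs k.2,
    fun m => sdec P.B (P.tau w.g m.1).valMinAbs m.2,
    fun x => sdec P.B (P.tau (w.e x.1.1) x.1.2).valMinAbs x.2)

theorem secret_eq_ext (w : P.Witness) : secret w = ext (digits w) := rfl

theorem sum_weight_mul_sdec {B : ℕ} (x : P.Zq) (hx : x.valMinAbs.natAbs ≤ B) :
    ∑ t : Fin (delta B), (weight B t : P.Zq) * ((sdec B x.valMinAbs t : ℤ) : P.Zq) = x := by
  have h := congrArg (Int.cast : ℤ → P.Zq) (sum_sdec hx)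
  push_cast at h
  simpa using h

/-- The components `g` and `e` have to be bounded, as their decomposition covers `[-B, B]` only; the
weights for `(q - 1) / 2` cover all of `Z_q`. -/
theorem recompose_digits {w : P.Witness} (hg : P.Bounded w.g) (he : ∀ i, P.Bounded (w.e i)) :
    recompose (digits w) = w := by
  have hhalf : ∀ x : P.Zq, x.valMinAbs.natAbs ≤ P.half := by
    intro x
    have h1 := ZMod.natAbs_valMinAbs_le x
    obtain ⟨k, hk⟩ := P.odd_q
    show _ ≤ (P.q - 1) / 2
    omega
  obtain ⟨a, g, e⟩ := w
  refine Witness.mk.injEq .. ▸ ⟨?_, ?_, ?_⟩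
  · funext i
    refine tau_injective ?_
    funext r
    rw [tau_ofTau, H, gadget_mulVec]
    exact sum_weight_mul_sdec (P.tau (a i) r) (hhalf _)
  · refine tau_injective ?_
    funext r
    rw [tau_ofTau, HB, gadget_mulVec]
    exact sum_weight_mul_sdec (P.tau g r) (hg r)
  · funext i
    refine tau_injective ?_
    funext r
    rw [tau_ofTau, HlB, gadget_mulVec]
    exact sum_weight_mul_sdec (P.tau (e i) r) (he i r)

theorem target_injective : Function.Injective (target (P := P)) := by
  intro c d h
  funext i
  exact tau_injective (_root_.funext fun r => congrFun h (i, r))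

theorem secret_mem_VALID (w : P.Witness) : secret w ∈ P.VALID := ext_mem_VALID (digits w)

theorem eq_iff_M_mulVec_secret (c : P.Stmt) {w : P.Witness} (hg : P.Bounded w.g)
    (he : ∀ i, P.Bounded (w.e i)) :
    (c = fun i => w.a i * w.g + w.e i) ↔ P.M.mulVec (red (secret w)) = target c := by
  rw [secret_eq_ext, M_mulVec_red_ext, recompose_digits hg he, target_injective.eq_iff, eq_comm]

/-- Since the weights for `B` sum to `B ≤ (q - 1) / 2`, recomposed elements are `B`-bounded. -/
theorem bounded_sum_weight (z : Fin P.dB → Trit) :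
    (∑ t : Fin P.dB, (weight P.B t : P.Zq) * ((z t : ℤ) : P.Zq)).valMinAbs.natAbs ≤ P.B := by
  have h1 : (∑ t : Fin P.dB, (weight P.B t : P.Zq) * ((z t : ℤ) : P.Zq)) =
      ((∑ t : Fin P.dB, (weight P.B t : ℤ) * (z t : ℤ) : ℤ) : P.Zq) := by push_cast; rfl
  have h2 : |∑ t : Fin P.dB, (weight P.B t : ℤ) * (z t : ℤ)| ≤ P.B := by
    refine (Finset.abs_sum_le_sum_abs _ _).trans ?_
    conv_rhs => rw [← sum_weight_delta P.B]
    push_cast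
    refine Finset.sum_le_sum fun t _ => ?_
    rw [abs_mul, Nat.abs_cast]
    exact mul_le_of_le_one_right (by positivity) (abs_le.2 (Trit.bounds (z t)))
  rw [h1]
  set N := ∑ t : Fin P.dB, (weight P.B t : ℤ) * (z t : ℤ)
  have h3 : ((N : ℤ) : P.Zq).valMinAbs = N := by
    rw [ZMod.valMinAbs_spec]
    refine ⟨rfl, ?_⟩
    have := abs_le.1 h2
    have := P.B_le
    have := P.three_le_q
    rw [Set.mem_Ioc]
    omega
  rw [h3]
  have := abs_le.1 h2
  omega

/-- Soundness of the reduction: any valid solution of the linear equation comes from a witness. -/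
theorem rel_recompose {c : P.Stmt} {l : P.Label} (h : P.M.mulVec (red (ext l)) = target c) :
    Rel c (recompose l) := by
  refine ⟨fun r => ?_, fun i r => ?_, ?_⟩
  · rw [recompose, tau_ofTau, HB, gadget_mulVec]
    exact bounded_sum_weight fun t => l.2.1 (r, t)
  · rw [recompose, tau_ofTau, HlB, gadget_mulVec]
    exact bounded_sum_weight fun t => l.2.2 ((i, r), t)
  · rw [M_mulVec_red_ext] at h
    exact (target_injective h).symm

end Params

end

noncomputable section
open Val

/-! ### Digits of trits -/

/-- The digit `z + 1 ∈ {0, 1, 2}` of a trit. -/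
def dig (z : Trit) : ℕ := ((z : ℤ) + 1).toNat

/-- The trit with digit `d` modulo 3. -/
def trit (d : ℕ) : Trit := br3 ((d : ℤ) - 1)

theorem dig_spec (z : Trit) : (dig z : ℤ) = z + 1 := by
  have := Trit.bounds z
  rw [dig]; omega

theorem dig_lt (z : Trit) : dig z < 3 := by
  have := Trit.bounds z
  have := dig_spec z
  omega

theorem trit_spec (d : ℕ) : ∃ k : ℤ, (trit d : ℤ) = d - 1 + 3 * k := br3_spec _

theorem dig_trit (d : ℕ) : dig (trit d) = d % 3 := by
  obtain ⟨k, hk⟩ := trit_spec d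
  have := dig_spec (trit d)
  have := dig_lt (trit d)
  omega

theorem trit_dig (z : Trit) : trit (dig z) = z := by
  have := dig_spec z
  exact br3_eq_of_dvd (by omega)

theorem dig_br3_sub (d : ℕ) (z : Trit) :
    dig (br3 ((trit d : ℤ) - z)) = (d + 2 * dig z + 1) % 3 := by
  obtain ⟨k, hk⟩ := trit_spec d
  obtain ⟨l, hl⟩ := br3_spec ((trit d : ℤ) - z)
  have := dig_spec z
  have := dig_spec (br3 ((trit d : ℤ) - z))
  have := dig_lt (br3 ((trit d : ℤ) - z))
  omega

theorem dig_br3_neg_add (d : ℕ) (z : Trit) :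
    dig (br3 (-(trit d : ℤ) + z)) = (dig z + 2 * d + 1) % 3 := by
  obtain ⟨k, hk⟩ := trit_spec d
  obtain ⟨l, hl⟩ := br3_spec (-(trit d : ℤ) + z)
  have := dig_spec z
  have := dig_spec (br3 (-(trit d : ℤ) + z))
  have := dig_lt (br3 (-(trit d : ℤ) + z))
  omega

theorem trit_add (a b : ℕ) : trit (a + b + 2) = br3 ((trit a : ℤ) + trit b) := by
  obtain ⟨k, hk⟩ := trit_spec a
  obtain ⟨l, hl⟩ := trit_spec b
  exact br3_congr (by omega)

theorem trit_sub (a b : ℕ) : trit (a + 2 * b + 1) = br3 ((trit a : ℤ) - trit b) := by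
  obtain ⟨k, hk⟩ := trit_spec a
  obtain ⟨l, hl⟩ := trit_spec b
  exact br3_congr (by push_cast; omega)

/-- The digit of a product in terms of the digits of the factors. -/
theorem toNat_mul_trit (y z : Trit) :
    ((y : ℤ) * z + 1).toNat = dig y * dig z + 2 - (dig y + dig z) := by
  have h1 := dig_spec y
  have h2 := dig_spec z
  have h3 := dig_lt y
  have h4 := dig_lt z
  have h5 : (y : ℤ) = dig y - 1 := by omega
  have h6 : (z : ℤ) = dig z - 1 := by omega
  rw [h5, h6]
  generalize dig y = a at *
  generalize dig z = b at *
  clear h1 h2 h5 h6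
  interval_cases a <;> interval_cases b <;> rfl

theorem cast_mul_trit {q : ℕ} [NeZero q] (y z : Trit) : (((y : ℤ) * z : ℤ) : ZMod q) =
    ((dig y * dig z + 2 - (dig y + dig z) + (q - 1) : ℕ) : ZMod q) := by
  have h : (-1 : ℤ) ≤ (y : ℤ) * z := by
    have h1 := Trit.bounds y
    have h2 := Trit.bounds z
    nlinarith
  have h1 : ((y : ℤ) * z : ℤ) = ((dig y * dig z + 2 - (dig y + dig z) : ℕ) : ℤ) - 1 := by
    rw [← toNat_mul_trit]; omega
  have h2 : ((q - 1 : ℕ) : ZMod q) = -1 := by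
    rw [Nat.cast_sub (NeZero.one_le)]; simp
  rw [h1, Nat.cast_add, h2]
  push_cast
  ring

theorem cast_trit {q : ℕ} [NeZero q] (z : Trit) :
    ((z : ℤ) : ZMod q) = ((dig z + (q - 1) : ℕ) : ZMod q) := by
  have h2 : ((q - 1 : ℕ) : ZMod q) = -1 := by
    rw [Nat.cast_sub (NeZero.one_le)]; simp
  have h := dig_spec z
  rw [show (z : ℤ) = (dig z : ℤ) - 1 by omega, Nat.cast_add, h2]
  push_cast
  ring

/-! ### Encodings as tables -/

theorem tab_eq_ofFun {k : ℕ} {f : ℕ → Val} {g : Fin k → Val} (h : ∀ i : Fin k, f i = g i) :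
    tab k f = ofFun g := by
  rw [tab, ofFun]
  congr 2
  exact funext h

theorem nth_ofFun {k : ℕ} (f : Fin k → Val) (i : Fin k) : nth (ofFun f) i = f i := by
  have h : ofFun f = tab k fun j => if hj : j < k then f ⟨j, hj⟩ else num 0 :=
    (tab_eq_ofFun fun i => by simp).symm
  rw [h, nth_tab _ i.2, dif_pos i.2]

namespace Params

theorem eOver_eq_tab (f : Trit → Val) : eOver f = tab 3 fun d => f (trit d) := by
  refine (tab_eq_ofFun fun i => ?_).symm
  fin_cases i <;> rfl

theorem nth_eOver (f : Trit → Val) (z : Trit) : nth (eOver f) (dig z) = f z := by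
  rw [eOver_eq_tab, nth_tab _ (dig_lt z), trit_dig]

/-- `eIdx` for functions of natural numbers; trits are replaced by their digits. -/
def encIdx (n l d : ℕ) (f : ℕ → ℕ → ℕ → ℕ → ℕ → ℕ → ℕ → Val) (g : ℕ → ℕ → ℕ → ℕ → Val) : Val :=
  .pair
    (tab l fun i => tab n fun j => tab n fun r => tab l fun s => tab d fun t =>
      tab 3 fun y => tab 3 fun x => f i j r s t y x)
    (tab l fun i => tab n fun r => tab d fun t => tab 3 fun x => g i r t x)

/-- The vector of the values of functions of natural numbers. -/
def idxOf {P : Params} {A : Type} (f : ℕ → ℕ → ℕ → ℕ → ℕ → ℕ → ℕ → A) (g : ℕ → ℕ → ℕ → ℕ → A) :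
    P.Idx → A
  | .inl (i, k, m, s) => f i m.1 k.1 k.2 m.2 (dig s.2) (dig s.1)
  | .inr (y, x) => g y.1.1 y.1.2 y.2 (dig x)

variable {P : Params}

theorem encIdx_eq (f : ℕ → ℕ → ℕ → ℕ → ℕ → ℕ → ℕ → Val) (g : ℕ → ℕ → ℕ → ℕ → Val) :
    encIdx P.n P.ell P.dB f g = eIdx (P := P) (idxOf f g) := by
  unfold encIdx eIdx
  congr 1

/-- The entry of an encoded extended vector at a position of the first kind. -/
def atI (v : Val) (i j r s t y x : ℕ) : Val :=
  nth (nth (nth (nth (nth (nth (nth v.fst i) j) r) s) t) y) x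

/-- The entry of an encoded extended vector at a position of the second kind. -/
def atE (v : Val) (i r t x : ℕ) : Val := nth (nth (nth (nth v.snd i) r) t) x

theorem idxOf_at_eIdx (f : P.Idx → Val) : idxOf (atI (eIdx f)) (atE (eIdx f)) = f := by
  funext z
  rcases z with ⟨i, ⟨r, s⟩, ⟨j, t⟩, ⟨x, y⟩⟩ | ⟨⟨⟨i, r⟩, t⟩, x⟩
  · simp only [idxOf, atI, eIdx, fst_pair, nth_ofFun, nth_eOver]
  · simp only [idxOf, atE, eIdx, snd_pair, nth_ofFun, nth_eOver]

/-- The number in the encoding of an element of `Z_q`. -/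
def decZ (q : ℕ) (v : Val) : ℕ := v.toNat - 2 ^ q.size

/-- The encoding of the residue class of a number in `Z_q`. -/
def mkZ (q N : ℕ) : Val := num (2 ^ q.size + N % q)

theorem mkZ_eq (N : ℕ) : mkZ P.q N = eZq (N : P.Zq) := by
  rw [mkZ, eZq, word, ZMod.val_natCast]

theorem decZ_eZq (z : P.Zq) : decZ P.q (eZq z) = z.val := by
  rw [decZ, eZq, word, toNat_num, Nat.add_sub_cancel_left]

/-- The vector that is read off from an arbitrary datum. -/
def decV (v : Val) : P.Idx → P.Zq := fun z => ((decZ P.q (idxOf (atI v) (atE v) z) : ℕ) : P.Zq)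

theorem decV_eVec (v : P.Idx → P.Zq) : decV (eVec v) = v := by
  funext z
  rw [decV, eVec, idxOf_at_eIdx, decZ_eZq, ZMod.natCast_zmod_val]

/-- The rows that are read off from an arbitrary datum. -/
def decR (v : Val) : Fin P.ell × Fin P.n → P.Zq := fun z =>
  ((decZ P.q (nth (nth v z.1) z.2) : ℕ) : P.Zq)

theorem decR_eRows (u : Fin P.ell × Fin P.n → P.Zq) : decR (eRows u) = u := by
  funext z
  rw [decR, eRows, nth_ofFun, nth_ofFun, decZ_eZq, ZMod.natCast_zmod_val]

theorem eStmt_eq (c : P.Stmt) : eStmt c = eRows (target c) := rfl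

/-- The digit in the encoding of a trit. -/
def decT (v : Val) : ℕ := v.toNat - 4

theorem eTrit_eq (z : Trit) : eTrit z = num (4 + dig z) := rfl

theorem decT_eTrit (z : Trit) : decT (eTrit z) = dig z := by
  rw [decT, eTrit_eq, toNat_num, Nat.add_sub_cancel_left]

/-- Digits of the first component of an encoded label. -/
def labA (v : Val) (i r s : ℕ) : ℕ := decT (nth (nth (nth v.fst i) r) s)

/-- Digits of the second component of an encoded label. -/
def labG (v : Val) (j t : ℕ) : ℕ := decT (nth (nth v.snd.fst j) t)

/-- Digits of the third component of an encoded label. -/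
def labE (v : Val) (i r t : ℕ) : ℕ := decT (nth (nth (nth v.snd.snd i) r) t)

/-- The label with given digits, which count modulo 3. -/
def labOf (A : ℕ → ℕ → ℕ → ℕ) (G : ℕ → ℕ → ℕ) (E : ℕ → ℕ → ℕ → ℕ) : P.Label :=
  (fun i k => trit (A i k.1 k.2), fun m => trit (G m.1 m.2), fun x => trit (E x.1.1 x.1.2 x.2))

/-- The label that is read off from an arbitrary datum. -/
def decL (v : Val) : P.Label := labOf (labA v) (labG v) (labE v)

theorem decL_eLabel (η : P.Label) : decL (eLabel η) = η := by
  refine Prod.ext ?_ (Prod.ext ?_ ?_)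
  · funext i ⟨r, s⟩
    simp only [decL, labOf, labA, eLabel, fst_pair, nth_ofFun, decT_eTrit, trit_dig]
  · funext ⟨j, t⟩
    simp only [decL, labOf, labG, eLabel, fst_pair, snd_pair, nth_ofFun, decT_eTrit, trit_dig]
  · funext ⟨⟨i, r⟩, t⟩
    simp only [decL, labOf, labE, eLabel, snd_pair, nth_ofFun, decT_eTrit, trit_dig]

/-! ### Reading the public input -/

/-- The length of a string `1^k`. -/
def unLen (v : Val) : ℕ := v.size / 2 - 2

theorem unLen_unary (k : ℕ) : unLen (unary k) = k := by
  rw [unLen, unary, size_num, Nat.size_pow]; omega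

/-- The security parameter in a public input. -/
def inT (x : Val) : ℕ := unLen x.fst

/-- The dimension in a public input. -/
def inN (x : Val) : ℕ := unLen x.snd.fst

/-- The modulus in a public input. -/
def inQ (x : Val) : ℕ := x.snd.snd.fst.toNat

/-- The norm bound in a public input. -/
def inB (x : Val) : ℕ := x.snd.snd.snd.fst.toNat

/-- The number of coin strings in a public input. -/
def inW (x : Val) : ℕ := x.snd.snd.snd.snd.fst.toNat

/-- The key in a public input. -/
def inK (x : Val) : Val := x.snd.snd.snd.snd.snd.fst

/-- The statement in a public input. -/
def inC (x : Val) : Val := x.snd.snd.snd.snd.snd.snd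

/-- `ℓ`, computed from a public input. -/
def inL (x : Val) : ℕ := ((inQ x - 1) / 2).size

/-- `δ_B`, computed from a public input. -/
def inD (x : Val) : ℕ := (inB x).size

@[fun_prop] theorem pF_inT : PF inT := by unfold inT unLen; fun_prop
@[fun_prop] theorem pF_inN : PF inN := by unfold inN unLen; fun_prop
@[fun_prop] theorem pF_inQ : PF inQ := by unfold inQ; fun_prop
@[fun_prop] theorem pF_inB : PF inB := by unfold inB; fun_prop
@[fun_prop] theorem pF_inW : PF inW := by unfold inW; fun_prop
@[fun_prop] theorem pF_inK : PF inK := by unfold inK; fun_prop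
@[fun_prop] theorem pF_inC : PF inC := by unfold inC; fun_prop
@[fun_prop] theorem pF_inL : PF inL := by unfold inL; fun_prop
@[fun_prop] theorem pF_inD : PF inD := by unfold inD; fun_prop

theorem polyBdd_unLen {f : Val → Val} (hf : PF f) : PolyBdd fun x => unLen (f x) :=
  hf.polyBdd_size.mono fun x => by rw [unLen]; omega

@[fun_prop] theorem polyBdd_inT : PolyBdd inT := polyBdd_unLen (by fun_prop)
@[fun_prop] theorem polyBdd_inN : PolyBdd inN := polyBdd_unLen (by fun_prop)
@[fun_prop] theorem polyBdd_inL : PolyBdd inL := PolyBdd.natSize (by fun_prop)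
@[fun_prop] theorem polyBdd_inD : PolyBdd inD := PolyBdd.natSize (by fun_prop)

/-- `x` is a public input for the parameters `P`. -/
structure Reads (P : Params) (x : Val) : Prop where
  n : inN x = P.n
  q : inQ x = P.q
  B : inB x = P.B
  ell : inL x = P.ell
  dB : inD x = P.dB

theorem size_eq_delta {b : ℕ} (hb : 1 ≤ b) : b.size = delta b := by
  rw [delta]
  refine le_antisymm (Nat.size_le.2 (Nat.lt_pow_succ_log_self (by norm_num) b)) ?_
  exact Nat.lt_size.2 (Nat.pow_log_le_self 2 (by omega))

theorem reads_input (C : CommitmentScheme) (t : ℕ) (pk : Val) (c : P.Stmt) :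
    Reads P (Stern.input C t pk c) where
  n := unLen_unary _
  q := rfl
  B := rfl
  ell := size_eq_delta (by have := P.three_le_q; show 1 ≤ (P.q - 1) / 2; omega)
  dB := size_eq_delta P.one_le_B

/-! ### The operations of the protocol on encodings -/

/-- The encoding of the vector over `Z_q` with given entries. -/
def mkV (x : Val) (f : ℕ → ℕ → ℕ → ℕ → ℕ → ℕ → ℕ → ℕ) (g : ℕ → ℕ → ℕ → ℕ → ℕ) : Val :=
  encIdx (inN x) (inL x) (inD x) (fun i j r s t y z => mkZ (inQ x) (f i j r s t y z))
    fun i r t z => mkZ (inQ x) (g i r t z)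

/-- The encoding of the rows over `Z_q` with given entries. -/
def mkR (x : Val) (f : ℕ → ℕ → ℕ) : Val :=
  tab (inL x) fun i => tab (inN x) fun r => mkZ (inQ x) (f i r)

/-- The encoding of the label with given digits. -/
def mkL (x : Val) (A : ℕ → ℕ → ℕ → ℕ) (G : ℕ → ℕ → ℕ) (E : ℕ → ℕ → ℕ → ℕ) : Val :=
  .pair (tab (inL x) fun i => tab (inN x) fun r => tab (inL x) fun s => num (4 + A i r s % 3))
    (.pair (tab (inN x) fun j => tab (inD x) fun t => num (4 + G j t % 3))
      (tab (inL x) fun i => tab (inN x) fun r => tab (inD x) fun t => num (4 + E i r t % 3)))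

variable {x : Val}

theorem mkV_eq (hx : Reads P x) {f : ℕ → ℕ → ℕ → ℕ → ℕ → ℕ → ℕ → ℕ} {g : ℕ → ℕ → ℕ → ℕ → ℕ}
    {v : P.Idx → P.Zq}
    (h : ∀ z, ((idxOf (P := P) f g z : ℕ) : P.Zq) = v z) : mkV x f g = eVec v := by
  rw [mkV, hx.n, hx.ell, hx.dB, hx.q, encIdx_eq, eVec]
  congr 1
  funext z
  rw [← h z]
  rcases z with ⟨i, k, m, s⟩ | ⟨y, s⟩ <;> exact mkZ_eq _

theorem mkR_eq (hx : Reads P x) {f : ℕ → ℕ → ℕ} {u : Fin P.ell × Fin P.n → P.Zq}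
    (h : ∀ i r, ((f (i : Fin P.ell) (r : Fin P.n) : ℕ) : P.Zq) = u (i, r)) :
    mkR x f = eRows u := by
  rw [mkR, hx.n, hx.ell, hx.q]
  exact tab_eq_ofFun fun i => tab_eq_ofFun fun r => by rw [mkZ_eq, h]

theorem mkL_eq (hx : Reads P x) (A : ℕ → ℕ → ℕ → ℕ) (G : ℕ → ℕ → ℕ) (E : ℕ → ℕ → ℕ → ℕ) :
    mkL x A G E = eLabel (P := P) (labOf A G E) := by
  have h : ∀ d, num (4 + d % 3) = eTrit (trit d) := fun d => by rw [eTrit_eq, dig_trit]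
  simp only [mkL, hx.n, hx.ell, hx.dB, h]
  unfold eLabel
  congr 1

end Params
end

noncomputable section
open Val

namespace Params

@[fun_prop]
theorem pF_mkZ {q N : Val → ℕ} (hq : PF q) (hN : PF N) : PF fun z => mkZ (q z) (N z) := by
  unfold mkZ; fun_prop

@[fun_prop]
theorem pF_decZ {q : Val → ℕ} {v : Val → Val} (hq : PF q) (hv : PF v) :
    PF fun z => decZ (q z) (v z) := by
  unfold decZ; fun_prop

@[fun_prop]
theorem pF_decT {v : Val → Val} (hv : PF v) : PF fun z => decT (v z) := by
  unfold decT; fun_prop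

@[fun_prop]
theorem pF_atI {v : Val → Val} {i j r s t y x : Val → ℕ} (hv : PF v) (hi : PF i) (hj : PF j)
    (hr : PF r) (hs : PF s) (ht : PF t) (hy : PF y) (hx : PF x) :
    PF fun z => atI (v z) (i z) (j z) (r z) (s z) (t z) (y z) (x z) := by
  unfold atI; fun_prop

@[fun_prop]
theorem pF_atE {v : Val → Val} {i r t x : Val → ℕ} (hv : PF v) (hi : PF i)
    (hr : PF r) (ht : PF t) (hx : PF x) :
    PF fun z => atE (v z) (i z) (r z) (t z) (x z) := by
  unfold atE; fun_prop

@[fun_prop]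
theorem pF_labA {v : Val → Val} {i r s : Val → ℕ} (hv : PF v) (hi : PF i) (hr : PF r)
    (hs : PF s) : PF fun z => labA (v z) (i z) (r z) (s z) := by
  unfold labA; fun_prop

@[fun_prop]
theorem pF_labG {v : Val → Val} {j t : Val → ℕ} (hv : PF v) (hj : PF j) (ht : PF t) :
    PF fun z => labG (v z) (j z) (t z) := by
  unfold labG; fun_prop

@[fun_prop]
theorem pF_labE {v : Val → Val} {i r t : Val → ℕ} (hv : PF v) (hi : PF i) (hr : PF r)
    (ht : PF t) : PF fun z => labE (v z) (i z) (r z) (t z) := by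
  unfold labE; fun_prop

@[fun_prop]
theorem pF_weight {B t : Val → ℕ} (hB : PF B) (ht : PF t) : PF fun z => weight (B z) (t z) := by
  simp only [weight_eq]; fun_prop

/-- `Gam` on encodings. -/
def gamV (x l v : Val) : Val :=
  mkV x
    (fun i j r s t y z => decZ (inQ x) (atI v i j r s t ((y + 2 * labG l j t + 1) % 3)
      ((z + 2 * labA l i r s + 1) % 3)))
    fun i r t z => decZ (inQ x) (atE v i r t ((z + 2 * labE l i r t + 1) % 3))

@[fun_prop]
theorem pF_gamV {x l v : Val → Val} (hx : PF x) (hl : PF l) (hv : PF v) :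
    PF fun z => gamV (x z) (l z) (v z) := by
  unfold gamV mkV encIdx; fun_prop

variable {P : Params} {x : Val}

theorem gamV_eq (hx : Reads P x) (l v : Val) :
    gamV x l v = eVec (P := P) (Gam (decL l) (decV v)) := by
  refine mkV_eq hx fun z => ?_
  rcases z with ⟨i, ⟨r, s⟩, ⟨j, t⟩, ⟨z, y⟩⟩ | ⟨⟨⟨i, r⟩, t⟩, z⟩
  · simp only [Gam, join, permPhiV, permPhi, decV, idxOf, decL, labOf, dig_br3_neg_add, hx.q]
  · simp only [Gam, join, permPiV, permPi, decV, idxOf, decL, labOf, dig_br3_neg_add, hx.q]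

/-- The digit of the entry with digits `(x, y)` of `mult3`, from the digits of its arguments. -/
def multDig (a g x y : ℕ) : ℕ :=
  (a + 2 * x + 1) % 3 * ((g + 2 * y + 1) % 3) + 2 - ((a + 2 * x + 1) % 3 + (g + 2 * y + 1) % 3)

@[fun_prop]
theorem pF_multDig {a g x y : Val → ℕ} (ha : PF a) (hg : PF g) (hx : PF x) (hy : PF y) :
    PF fun z => multDig (a z) (g z) (x z) (y z) := by
  unfold multDig; fun_prop

/-- `extend` on encodings. -/
def extV (x l : Val) : Val :=
  encIdx (inN x) (inL x) (inD x)
    (fun i j r s t y z => num (4 + multDig (labA l i r s) (labG l j t) z y))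
    fun i r t z => num (4 + (labE l i r t + 2 * z + 1) % 3)

@[fun_prop]
theorem pF_extV {x l : Val → Val} (hx : PF x) (hl : PF l) : PF fun z => extV (x z) (l z) := by
  unfold extV encIdx; fun_prop

theorem ext_labOf_inl (A : ℕ → ℕ → ℕ → ℕ) (G : ℕ → ℕ → ℕ) (E : ℕ → ℕ → ℕ → ℕ) (i : Fin P.ell)
    (k : P.AIdx) (m : P.GIdx) (s : Trit × Trit) :
    eTrit (ext (labOf A G E) (.inl (i, k, m, s))) =
      num (4 + multDig (A i k.1 k.2) (G m.1 m.2) (dig s.1) (dig s.2)) := by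
  rw [multDig, ← dig_br3_sub, ← dig_br3_sub, ← toNat_mul_trit]
  rfl

theorem ext_labOf_inr (A : ℕ → ℕ → ℕ → ℕ) (G : ℕ → ℕ → ℕ) (E : ℕ → ℕ → ℕ → ℕ) (y : P.EIdx)
    (s : Trit) :
    eTrit (ext (labOf A G E) (.inr (y, s))) =
      num (4 + (E y.1.1 y.1.2 y.2 + 2 * dig s + 1) % 3) := by
  rw [← dig_br3_sub]
  rfl

theorem extV_eq (hx : Reads P x) (l : Val) : extV x l = eShort (P := P) (ext (decL l)) := by
  rw [extV, hx.n, hx.ell, hx.dB, encIdx_eq, eShort]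
  congr 1
  funext z
  rcases z with ⟨i, k, m, s⟩ | ⟨y, s⟩
  · rw [decL, ext_labOf_inl]; rfl
  · rw [decL, ext_labOf_inr]; rfl

/-- `red` composed with `extend`, on encodings. -/
def redExtV (x l : Val) : Val :=
  mkV x (fun i j r s t y z => multDig (labA l i r s) (labG l j t) z y + (inQ x - 1))
    fun i r t z => (labE l i r t + 2 * z + 1) % 3 + (inQ x - 1)

@[fun_prop]
theorem pF_redExtV {x l : Val → Val} (hx : PF x) (hl : PF l) :
    PF fun z => redExtV (x z) (l z) := by
  unfold redExtV mkV encIdx; fun_prop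

theorem redExtV_eq (hx : Reads P x) (l : Val) :
    redExtV x l = eVec (P := P) (red (ext (decL l))) := by
  refine mkV_eq hx fun z => ?_
  rcases z with ⟨i, k, m, s⟩ | ⟨y, s⟩
  · simp only [idxOf, multDig, ← dig_br3_sub, hx.q]
    exact (cast_mul_trit _ _).symm
  · simp only [idxOf, ← dig_br3_sub, hx.q]
    exact (cast_trit _).symm

/-- The sum of two labels, on encodings. -/
def addLV (x l m : Val) : Val :=
  mkL x (fun i r s => labA l i r s + labA m i r s + 2) (fun j t => labG l j t + labG m j t + 2)
    fun i r t => labE l i r t + labE m i r t + 2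

@[fun_prop]
theorem pF_addLV {x l m : Val → Val} (hx : PF x) (hl : PF l) (hm : PF m) :
    PF fun z => addLV (x z) (l z) (m z) := by
  unfold addLV mkL; fun_prop

theorem addLV_eq (hx : Reads P x) (l m : Val) :
    addLV x l m = eLabel (P := P) (addLab (decL l) (decL m)) := by
  rw [addLV, mkL_eq hx]
  congr 1
  refine Prod.ext ?_ (Prod.ext ?_ ?_) <;> funext <;> exact trit_add _ _

/-- The difference of two labels, on encodings. -/
def subLV (x l m : Val) : Val :=
  mkL x (fun i r s => labA l i r s + 2 * labA m i r s + 1)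
    (fun j t => labG l j t + 2 * labG m j t + 1) fun i r t => labE l i r t + 2 * labE m i r t + 1

@[fun_prop]
theorem pF_subLV {x l m : Val → Val} (hx : PF x) (hl : PF l) (hm : PF m) :
    PF fun z => subLV (x z) (l z) (m z) := by
  unfold subLV mkL; fun_prop

theorem subLV_eq (hx : Reads P x) (l m : Val) :
    subLV x l m = eLabel (P := P) (subLab (decL l) (decL m)) := by
  rw [subLV, mkL_eq hx]
  congr 1
  refine Prod.ext ?_ (Prod.ext ?_ ?_) <;> funext <;> exact trit_sub _ _

/-- The encoding of the label that an arbitrary datum is read as. -/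
def canonL (x l : Val) : Val := mkL x (labA l) (labG l) (labE l)

@[fun_prop]
theorem pF_canonL {x l : Val → Val} (hx : PF x) (hl : PF l) : PF fun z => canonL (x z) (l z) := by
  unfold canonL mkL; fun_prop

theorem canonL_eq (hx : Reads P x) (l : Val) : canonL x l = eLabel (P := P) (decL l) :=
  mkL_eq hx _ _ _

/-- The encoding of the vector that an arbitrary datum is read as. -/
def canonV (x v : Val) : Val :=
  mkV x (fun i j r s t y z => decZ (inQ x) (atI v i j r s t y z))
    fun i r t z => decZ (inQ x) (atE v i r t z)

@[fun_prop]
theorem pF_canonV {x v : Val → Val} (hx : PF x) (hv : PF v) : PF fun z => canonV (x z) (v z) := by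
  unfold canonV mkV encIdx; fun_prop

theorem canonV_eq (hx : Reads P x) (v : Val) : canonV x v = eVec (P := P) (decV v) := by
  refine mkV_eq hx fun z => ?_
  rcases z with ⟨i, k, m, s⟩ | ⟨y, s⟩ <;> simp only [idxOf, decV, hx.q]

/-- The sum of two vectors, on encodings. -/
def addV (x u v : Val) : Val :=
  mkV x (fun i j r s t y z => decZ (inQ x) (atI u i j r s t y z) +
      decZ (inQ x) (atI v i j r s t y z))
    fun i r t z => decZ (inQ x) (atE u i r t z) + decZ (inQ x) (atE v i r t z)

@[fun_prop]
theorem pF_addV {x u v : Val → Val} (hx : PF x) (hu : PF u) (hv : PF v) :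
    PF fun z => addV (x z) (u z) (v z) := by
  unfold addV mkV encIdx; fun_prop

theorem addV_eq (hx : Reads P x) (u v : Val) :
    addV x u v = eVec (P := P) (decV u + decV v) := by
  refine mkV_eq hx fun z => ?_
  rcases z with ⟨i, k, m, s⟩ | ⟨y, s⟩ <;>
    simp only [idxOf, decV, hx.q, Nat.cast_add, Pi.add_apply]

/-- The difference of two vectors of rows, on encodings; the factor `q - 1` stands for `-1`. -/
def subR (x u v : Val) : Val :=
  mkR x fun i r => decZ (inQ x) (nth (nth u i) r) + (inQ x - 1) * decZ (inQ x) (nth (nth v i) r)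

@[fun_prop]
theorem pF_subR {x u v : Val → Val} (hx : PF x) (hu : PF u) (hv : PF v) :
    PF fun z => subR (x z) (u z) (v z) := by
  unfold subR mkR; fun_prop

theorem cast_q_sub_one : ((P.q - 1 : ℕ) : P.Zq) = -1 := by
  rw [Nat.cast_sub (NeZero.one_le)]; simp

theorem subR_eq (hx : Reads P x) (u v : Val) :
    subR x u v = eRows (P := P) (decR u - decR v) := by
  refine mkR_eq hx fun i r => ?_
  rw [Nat.cast_add, Nat.cast_mul, hx.q, cast_q_sub_one, Pi.sub_apply, decR, decR]
  ring

/-- The entries of the rotation matrices of the powers of `X`, as numbers modulo `q`. -/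
def rotN (q n k r : ℕ) : ℕ := if k = r then 1 else if k = r + n then q - 1 else 0

@[fun_prop]
theorem pF_rotN {q n k r : Val → ℕ} (hq : PF q) (hn : PF n) (hk : PF k) (hr : PF r) :
    PF fun z => rotN (q z) (n z) (k z) (r z) := by
  unfold rotN; fun_prop

theorem rotN_eq (k r : ℕ) : ((rotN P.q P.n k r : ℕ) : P.Zq) = P.rotCoeff k r := by
  rw [rotN, rotCoeff]
  split_ifs
  · exact Nat.cast_one
  · exact cast_q_sub_one
  · exact Nat.cast_zero

/-- Multiplication by `M`, on encodings. Only the entries labelled `(0, 0)` and `0` enter, and the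
trit `0` has the digit `1`. -/
def mulMV (x v : Val) : Val :=
  mkR x fun i r =>
    (∑ r' ∈ Finset.range (inN x), ∑ s ∈ Finset.range (inL x), ∑ j ∈ Finset.range (inN x),
      ∑ t ∈ Finset.range (inD x), rotN (inQ x) (inN x) (j + r') r * weight ((inQ x - 1) / 2) s *
        weight (inB x) t * decZ (inQ x) (atI v i j r' s t 1 1)) +
    ∑ t ∈ Finset.range (inD x), weight (inB x) t * decZ (inQ x) (atE v i r t 1)

@[fun_prop]
theorem pF_mulMV {x v : Val → Val} (hx : PF x) (hv : PF v) : PF fun z => mulMV (x z) (v z) := by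
  unfold mulMV mkR; fun_prop

theorem mulMV_eq (hx : Reads P x) (v : Val) :
    mulMV x v = eRows (P := P) (P.M.mulVec (decV v)) := by
  refine mkR_eq hx fun i r => ?_
  simp only [M_mulVec, Finset.sum_range, hx.n, hx.ell, hx.dB, hx.q, hx.B, Nat.cast_add,
    Nat.cast_sum, Nat.cast_mul, rotN_eq, Fintype.sum_prod_type, decV, idxOf]
  rfl

/-- The row of a `3 × 3` table that consists of encoded zeros; a zero is encoded as `5`. -/
def zeroRow (f : ℕ → ℕ → Val) : ℕ :=
  if (f 0 0).toNat = 5 ∧ (f 0 1).toNat = 5 ∧ (f 0 2).toNat = 5 then 0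
  else if (f 1 0).toNat = 5 ∧ (f 1 1).toNat = 5 ∧ (f 1 2).toNat = 5 then 1 else 2

@[fun_prop]
theorem pF_zeroRow {f : Val → ℕ → ℕ → Val} (h : ∀ i j : ℕ, PF fun z => f z i j) :
    PF fun z => zeroRow (f z) := by
  unfold zeroRow
  have := h 0 0
  have := h 0 1
  have := h 0 2
  have := h 1 0
  have := h 1 1
  have := h 1 2
  fun_prop

theorem forall_trit_iff {p : ℕ → Prop} : (∀ z : Trit, p (dig z)) ↔ p 0 ∧ p 1 ∧ p 2 := by
  constructor
  · intro h
    exact ⟨by simpa [dig_trit] using h (trit 0), by simpa [dig_trit] using h (trit 1),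
      by simpa [dig_trit] using h (trit 2)⟩
  · rintro ⟨h0, h1, h2⟩ z
    have := dig_lt z
    generalize dig z = d at *
    interval_cases d <;> assumption

theorem zeroRow_eq {f : ℕ → ℕ → Val} {a : Trit}
    (h : ∀ y : Trit, (∀ z : Trit, (f (dig y) (dig z)).toNat = 5) ↔ a = y) :
    zeroRow f = dig a := by
  have h1 : ∀ d < 3, ((f d 0).toNat = 5 ∧ (f d 1).toNat = 5 ∧ (f d 2).toNat = 5) ↔ dig a = d := by
    intro d hd
    have h2 := h (trit d)
    rw [dig_trit, Nat.mod_eq_of_lt hd, forall_trit_iff (p := fun z => (f d z).toNat = 5)] at h2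
    rw [h2]
    constructor
    · rintro rfl
      rw [dig_trit, Nat.mod_eq_of_lt hd]
    · rintro rfl
      exact (trit_dig a).symm
  have h2 := dig_lt a
  simp only [zeroRow, h1 0 (by norm_num), h1 1 (by norm_num)]
  split_ifs <;> omega

theorem toNat_eTrit_eq_five {z : ℤ} : (eTrit z).toNat = 5 ↔ z = 0 := by
  show 2 ^ 2 + (z + 1).toNat = 5 ↔ z = 0
  omega

/-- Read digits `a, g, e` off the encoding of an extended vector: a digit is the position of the zero
row or column in the first block to which it belongs. -/
def readLV (x v : Val) : Val :=
  mkL x (fun i r s => zeroRow fun z y => atI v i 0 r s 0 y z)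
    (fun j t => zeroRow fun y z => atI v 0 j 0 0 t y z)
    fun i r t => zeroRow fun z _ => atE v i r t z

@[fun_prop]
theorem pF_readLV {x v : Val → Val} (hx : PF x) (hv : PF v) : PF fun z => readLV (x z) (v z) := by
  unfold readLV mkL; fun_prop

/-- The digits `a, g, e` that are read off an arbitrary datum. -/
def readL (v : Val) : P.Label :=
  labOf (fun i r s => zeroRow fun z y => atI v i 0 r s 0 y z)
    (fun j t => zeroRow fun y z => atI v 0 j 0 0 t y z)
    fun i r t => zeroRow fun z _ => atE v i r t z

theorem readLV_eq (hx : Reads P x) (v : Val) : readLV x v = eLabel (P := P) (readL v) :=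
  mkL_eq hx _ _ _

theorem readL_eShort_ext (l : P.Label) : readL (eShort (ext l)) = l := by
  have hI : ∀ (i : Fin P.ell) (k : P.AIdx) (m : P.GIdx) (y z : Trit),
      atI (eShort (ext l)) i m.1 k.1 k.2 m.2 (dig y) (dig z) =
        eTrit (mult3 (l.1 i k) (l.2.1 m) (z, y)) := fun i k m y z =>
    congrFun (idxOf_at_eIdx fun x => eTrit (ext l x)) (.inl (i, k, m, (z, y)))
  have hE : ∀ (y : P.EIdx) (z : Trit), atE (eShort (ext l)) y.1.1 y.1.2 y.2 (dig z) =
      eTrit (enc3 (l.2.2 y) z) := fun y z =>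
    congrFun (idxOf_at_eIdx fun x => eTrit (ext l x)) (.inr (y, z))
  refine Prod.ext ?_ (Prod.ext ?_ ?_)
  · funext i k
    have h := zeroRow_eq (f := fun z y => atI (eShort (ext l)) i 0 k.1 k.2 0 y z) (a := l.1 i k)
      fun y => by
        rw [← mult3_row_eq_zero (g := l.2.1 (0, 0))]
        refine forall_congr' fun z => ?_
        rw [← toNat_eTrit_eq_five]
        exact iff_of_eq (congrArg (fun v : Val => v.toNat = 5) (hI i k (0, 0) z y))
    exact (congrArg trit h).trans (trit_dig _)
  · funext m
    have h := zeroRow_eq (f := fun y z => atI (eShort (ext l)) 0 m.1 0 0 m.2 y z) (a := l.2.1 m)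
      fun y => by
        rw [← mult3_col_eq_zero (a := l.1 0 (0, 0))]
        refine forall_congr' fun z => ?_
        rw [← toNat_eTrit_eq_five]
        exact iff_of_eq (congrArg (fun v : Val => v.toNat = 5) (hI 0 (0, 0) m y z))
    exact (congrArg trit h).trans (trit_dig _)
  · funext y
    have h := zeroRow_eq (f := fun z _ => atE (eShort (ext l)) y.1.1 y.1.2 y.2 z) (a := l.2.2 y)
      fun z => by
        simp only [hE, toNat_eTrit_eq_five, enc3, forall_const]
        exact br3_sub_eq_zero
    exact (congrArg trit h).trans (trit_dig _)

/-- The witness recomposed from a label, on encodings. A trit is its digit minus `1`, and `q - 1`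
stands for `-1`. -/
def recomposeV (x l : Val) : Val :=
  .pair
    (tab (inL x) fun i => tab (inN x) fun r => mkZ (inQ x)
      (∑ s ∈ Finset.range (inL x), weight ((inQ x - 1) / 2) s * (labA l i r s % 3 + (inQ x - 1))))
    (.pair
      (tab (inN x) fun r => mkZ (inQ x)
        (∑ t ∈ Finset.range (inD x), weight (inB x) t * (labG l r t % 3 + (inQ x - 1))))
      (tab (inL x) fun i => tab (inN x) fun r => mkZ (inQ x)
        (∑ t ∈ Finset.range (inD x), weight (inB x) t * (labE l i r t % 3 + (inQ x - 1)))))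

@[fun_prop]
theorem pF_recomposeV {x l : Val → Val} (hx : PF x) (hl : PF l) :
    PF fun z => recomposeV (x z) (l z) := by
  unfold recomposeV; fun_prop

theorem recomposeV_eq (hx : Reads P x) (l : Val) :
    recomposeV x l = eWitness (P := P) (recompose (decL l)) := by
  have h : ∀ d, ((trit d : ℤ) : P.Zq) = ((d % 3 + (P.q - 1) : ℕ) : P.Zq) := by
    intro d
    rw [cast_trit, dig_trit]
  rw [recomposeV, hx.n, hx.ell, hx.dB, hx.q, hx.B, eWitness]
  congr 1
  · refine tab_eq_ofFun fun i => tab_eq_ofFun fun r => ?_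
    rw [mkZ_eq]
    simp only [recompose, tau_ofTau, H, gadget_mulVec, decL, labOf, h, Finset.sum_range,
      Nat.cast_sum, Nat.cast_mul]
  · congr 1
    · refine tab_eq_ofFun fun r => ?_
      rw [mkZ_eq]
      simp only [recompose, tau_ofTau, HB, gadget_mulVec, decL, labOf, h, Finset.sum_range,
        Nat.cast_sum, Nat.cast_mul]
    · refine tab_eq_ofFun fun i => tab_eq_ofFun fun r => ?_
      rw [mkZ_eq]
      simp only [recompose, tau_ofTau, HlB, gadget_mulVec, decL, labOf, h, Finset.sum_range,
        Nat.cast_sum, Nat.cast_mul]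

/-! ### Decomposition on encodings -/

theorem weight_eq_zero {B t : ℕ} (h : B.size ≤ t) : weight B t = 0 := by
  have h1 : B < 2 ^ t := (Nat.lt_size_self B).trans_le (Nat.pow_le_pow_right (by norm_num) h)
  rw [weight_eq, Nat.div_eq_of_lt h1]

/-- Beyond the length of `B` the weights vanish, and the remainder does not change any more. -/
theorem idecRem_min (B a t : ℕ) : idecRem B a (min t B.size) = idecRem B a t := by
  rcases le_total t B.size with h | h
  · rw [min_eq_left h]
  · rw [min_eq_right h]
    induction t, h using Nat.le_induction with
    | base => rfl
    | succ t ht ih => rw [idecRem, weight_eq_zero ht, if_pos (Nat.zero_le _), Nat.sub_zero, ih]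

theorem idecRem_le_self (B a t : ℕ) : idecRem B a t ≤ a := by
  induction t with
  | zero => exact le_rfl
  | succ t ih => rw [idecRem]; split <;> omega

@[fun_prop]
theorem pF_idecRem {B a t : Val → ℕ} (hB : PF B) (ha : PF a) (ht : PF t) :
    PF fun z => idecRem (B z) (a z) (t z) := by
  -- the loop state consists of a counter, the remainder and `B`
  let F : Val → Val := fun v => .pair (num (v.fst.toNat + 1)) (.pair
    (num (if weight v.snd.snd.toNat v.fst.toNat ≤ v.snd.fst.toNat then
      v.snd.fst.toNat - weight v.snd.snd.toNat v.fst.toNat else v.snd.fst.toNat)) v.snd.snd)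
  have hit : ∀ B a t, F^[t] (.pair (num 0) (.pair (num a) (num B))) =
      .pair (num t) (.pair (num (idecRem B a t)) (num B)) := by
    intro B a t
    induction t with
    | zero => rfl
    | succ t ih => rw [Function.iterate_succ_apply', ih]; rfl
  have h : PF fun z => F^[min (t z) (B z).size] (.pair (num 0) (.pair (num (a z)) (num (B z)))) := by
    refine PF.iterate (by fun_prop) (by fun_prop)
      ((PolyBdd.natSize hB).mono fun x => min_le_right _ _) (by fun_prop) ?_
    obtain ⟨p, (hp : ∀ x, (num (a x)).size ≤ _)⟩ := ha.num.polyBdd_size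
    obtain ⟨r, (hr : ∀ x, (num (B x)).size ≤ _)⟩ := hB.num.polyBdd_size
    refine ⟨p + r + r + 2, fun x i hi => ?_⟩
    have h1 := hp x
    have h2 := hr x
    have h3 := Nat.size_le_size (idecRem_le_self (B x) (a x) i)
    have h4 : i.size ≤ (B x).size :=
      (Nat.size_le.2 Nat.lt_two_pow_self).trans (hi.trans (min_le_right _ _))
    rw [size_num] at h1 h2
    rw [hit, size_pair, size_pair, size_num, size_num, size_num]
    simp only [eval_add, eval_ofNat]
    omega
  have h2 := h.snd.fst.toNat
  simp only [hit, snd_pair, fst_pair, toNat_num, idecRem_min] at h2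
  exact h2

/-- The digits of the greedy decomposition of the residue class of `a < q`; the trits `-1, 0, 1` have
the digits `0, 1, 2`. -/
def sdecN (q B a t : ℕ) : ℕ :=
  if weight B t ≤ idecRem B (if a ≤ q / 2 then a else q - a) t then
    if a = 0 then 1 else if a ≤ q / 2 then 2 else 0
  else 1

@[fun_prop]
theorem pF_sdecN {q B a t : Val → ℕ} (hq : PF q) (hB : PF B) (ha : PF a) (ht : PF t) :
    PF fun z => sdecN (q z) (B z) (a z) (t z) := by
  unfold sdecN; fun_prop

theorem dig_sdec (B : ℕ) (a : P.Zq) (t : Fin (delta B)) :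
    dig (sdec B a.valMinAbs t) = sdecN P.q B a.val t := by
  have hlt := ZMod.val_lt a
  have h := ZMod.valMinAbs_def_pos a
  have h1 : a.valMinAbs.natAbs = if a.val ≤ P.q / 2 then a.val else P.q - a.val := by
    rw [h]; split <;> omega
  have h2 : (a.valMinAbs.sign + 1).toNat =
      if a.val = 0 then 1 else if a.val ≤ P.q / 2 then 2 else 0 := by
    have h3 := Int.sign_eq_one_iff_pos (a := a.valMinAbs)
    have h4 := Int.sign_eq_neg_one_iff_neg (a := a.valMinAbs)
    have h5 := Int.sign_eq_zero_iff_zero (a := a.valMinAbs)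
    split_ifs with h6 h7
    · rw [if_pos (by omega)] at h
      rw [h5.2 (by omega)]; rfl
    · rw [if_pos h7] at h
      rw [h3.2 (by omega)]; rfl
    · rw [if_neg h7] at h
      rw [h4.2 (by omega)]; rfl
  rw [sdecN, ← h1, ← h2, sdec, dig]
  split <;> rfl

/-- The digits of a witness, on encodings. -/
def digitsV (x w : Val) : Val :=
  mkL x (fun i r s => sdecN (inQ x) ((inQ x - 1) / 2) (decZ (inQ x) (nth (nth w.fst i) r)) s)
    (fun j t => sdecN (inQ x) (inB x) (decZ (inQ x) (nth w.snd.fst j)) t)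
    fun i r t => sdecN (inQ x) (inB x) (decZ (inQ x) (nth (nth w.snd.snd i) r)) t

@[fun_prop]
theorem pF_digitsV {x w : Val → Val} (hx : PF x) (hw : PF w) :
    PF fun z => digitsV (x z) (w z) := by
  unfold digitsV mkL; fun_prop

theorem digitsV_eq (hx : Reads P x) (w : P.Witness) :
    digitsV x (eWitness w) = eLabel (digits w) := by
  rw [digitsV, mkL_eq hx, hx.q, hx.B]
  congr 1
  refine Prod.ext ?_ (Prod.ext ?_ ?_)
  · funext i ⟨r, s⟩
    simp only [labOf, eWitness, fst_pair, nth_ofFun, eRing, decZ_eZq, digits]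
    rw [← trit_dig (sdec _ _ _), dig_sdec]
  · funext ⟨j, t⟩
    simp only [labOf, eWitness, fst_pair, snd_pair, nth_ofFun, eRing, decZ_eZq, digits]
    rw [← trit_dig (sdec _ _ _), dig_sdec]
  · funext ⟨⟨i, r⟩, t⟩
    simp only [labOf, eWitness, snd_pair, nth_ofFun, eRing, decZ_eZq, digits]
    rw [← trit_dig (sdec _ _ _), dig_sdec]

/-! ### Coins -/

variable {C : CommitmentScheme} {t : ℕ}

/-- The coins that an arbitrary datum is read as. -/
def decCoin (C : CommitmentScheme) (t : ℕ) (v : Val) : C.Coin t :=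
  ⟨v.toNat % 2 ^ C.coinLen t, Nat.mod_lt _ (by positivity)⟩

/-- The encoding of the coins that an arbitrary datum is read as. -/
def canonC (x v : Val) : Val := num (inW x + v.toNat % inW x)

@[fun_prop]
theorem pF_canonC {x v : Val → Val} (hx : PF x) (hv : PF v) : PF fun z => canonC (x z) (v z) := by
  unfold canonC; fun_prop

theorem canonC_eq (pk : Val) (c : P.Stmt) (v : Val) :
    canonC (Stern.input C t pk c) v = C.coin (decCoin C t v) := rfl

theorem decCoin_coin (ρ : C.Coin t) : decCoin C t (C.coin ρ) = ρ := by
  apply Fin.ext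
  show (2 ^ C.coinLen t + (ρ : ℕ)) % 2 ^ C.coinLen t = ρ
  rw [Nat.add_mod_left, Nat.mod_eq_of_lt ρ.2]

end Params
end

noncomputable section
open Val

/-! ### Sampling -/

theorem PMF.uniformOfFintype_prod (α β : Type*) [Fintype α] [Nonempty α] [Fintype β] [Nonempty β] :
    PMF.uniformOfFintype (α × β) =
      (PMF.uniformOfFintype α).bind fun a => (PMF.uniformOfFintype β).map (Prod.mk a) := by
  ext ⟨a, b⟩
  rw [PMF.bind_apply, tsum_eq_single a]
  · rw [PMF.map_apply_of_injective _ (Prod.mk_right_injective a)]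
    simp only [PMF.uniformOfFintype_apply, Fintype.card_prod, Nat.cast_mul]
    rw [ENNReal.mul_inv] <;> simp
  · intro a' ha'
    rw [PMF.map_apply, ENNReal.tsum_eq_zero.2, mul_zero]
    intro b'
    rw [if_neg]
    exact fun h => ha' (Prod.mk.inj h).1.symm

theorem PMF.map_uniformOfFintype_of_equiv {α β γ : Type*} {_ : Fintype α} {_ : Nonempty α}
    {_ : Fintype β} {_ : Nonempty β} {f : α → γ} {g : β → γ} (e : α ≃ β) (h : ∀ a, f a = g (e a)) :
    (PMF.uniformOfFintype α).map f = (PMF.uniformOfFintype β).map g := by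
  rw [← PMF.map_equiv_uniformOfFintype e, PMF.map_comp]
  congr 1
  exact funext h

/-- A pair of independent samples. -/
def rpair (μ ν : PMF Val) : PMF Val := μ.bind fun a => ν.map (Val.pair a)

/-- A list of `k` independent samples. -/
def rvec (k : ℕ) (ν : PMF Val) : PMF Val := rfold Val.pair (fun _ => ν) k (num 0)

theorem Feas.rpair {f g : (Val → Val) → Val → PMF Val} (hf : Feas f) (hg : Feas g) :
    Feas fun O x => rpair (f O x) (g O x) := Feas.pair hf hg

theorem Feas.rvec {k : Val → ℕ} (hk : PF k) (hkb : PolyBdd k) {f : (Val → Val) → Val → PMF Val}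
    (hf : Feas f) : Feas fun O x => rvec (k x) (f O x) :=
  Feas.rfold (by fun_prop) (fun a b => (size_pair a b).le) hk hkb (f := fun O x _ => f O x)
    (hf.comp (by fun_prop)) _

theorem rpair_uniform {α β : Type*} [Fintype α] [Nonempty α] [Fintype β] [Nonempty β]
    (e : α → Val) (f : β → Val) :
    rpair ((PMF.uniformOfFintype α).map e) ((PMF.uniformOfFintype β).map f) =
      (PMF.uniformOfFintype (α × β)).map fun p => Val.pair (e p.1) (f p.2) := by
  rw [PMF.uniformOfFintype_prod, rpair]
  simp only [PMF.bind_map, PMF.map_bind, PMF.map_comp]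
  rfl

theorem rvec_uniform {α : Type*} [Fintype α] [Nonempty α] (e : α → Val) (k : ℕ) :
    rvec k ((PMF.uniformOfFintype α).map e) =
      (PMF.uniformOfFintype (Fin k → α)).map fun f => ofFun fun i => e (f i) := by
  have h : ∀ (k : ℕ) (a : Val), rfold Val.pair (fun _ => (PMF.uniformOfFintype α).map e) k a =
      (PMF.uniformOfFintype (Fin k → α)).map fun f =>
        (List.ofFn fun i => e (f i)).foldr Val.pair a := by
    intro k
    induction k with
    | zero =>
      intro a
      simp only [rfold, List.ofFn_zero, List.foldr_nil]
      exact (PMF.map_const _ a).symm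
    | succ k ih =>
      intro a
      rw [← PMF.map_equiv_uniformOfFintype (Fin.snocEquiv fun _ : Fin (k + 1) => α),
        PMF.uniformOfFintype_prod]
      simp only [rfold, ih, PMF.map_bind, PMF.map_comp, PMF.bind_map]
      congr 1
      funext b
      simp only [Function.comp_def]
      congr 1
      funext f
      rw [List.ofFn_succ']
      simp [Fin.snocEquiv]
  exact h k _

/-- The sampling step, with the sampled number as an element of `Fin (m + 1)` on the right. -/
theorem Prog.eval_rand (O : Val → Val) (m : ℕ) : Prog.rand.eval O (num (m + 1)) =
    (PMF.uniformOfFintype (Fin (m + 1))).map fun i : Fin (m + 1) =>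
      (num i, (num (m + 1)).size + (num i).size) := by
  have h : Prog.rand.eval O (num (m + 1)) =
      ((PMF.uniformOfFintype (Fin (m + 1))).map fun i : Fin (m + 1) => (i : ℕ)).map fun i =>
        (num i, (num (m + 1)).size + (num i).size) := by
    simp only [Prog.eval]
    rfl
  rw [h, PMF.map_comp]
  rfl

/-- A uniform number below `m`. -/
def randBelow (m : ℕ) : PMF Val := Prog.rand.out (num m)

theorem Feas.randBelow {m : Val → ℕ} (hm : PF m) : Feas fun _ x => randBelow (m x) := by
  have h : Prog.rand.PolyTime := by
    refine ⟨2 * X + 2, fun x r hr => ?_⟩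
    match x with
    | .num 0 =>
      simp only [Prog.eval, PMF.support_pure, Set.mem_singleton_iff] at hr
      subst hr
      simp [size_num]
    | .num (m + 1) =>
      rw [Prog.eval_rand, PMF.support_map] at hr
      obtain ⟨i, -, rfl⟩ := hr
      have : (i : ℕ).size ≤ (m + 1).size := Nat.size_le_size i.2.le
      simp [size_num]; omega
    | .pair a b =>
      simp only [Prog.eval, PMF.support_pure, Set.mem_singleton_iff] at hr
      subst hr
      simp [size_num]; omega
  exact (Feas.out h).comp (g := fun x => num (m x)) hm.num

theorem randBelow_eq (m : ℕ) [NeZero m] :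
    randBelow m = (PMF.uniformOfFintype (Fin m)).map fun i : Fin m => num i := by
  obtain ⟨k, rfl⟩ : ∃ k, m = k + 1 := ⟨m - 1, by have := NeZero.pos m; omega⟩
  simp only [randBelow, Prog.out, Prog.outWith, Prog.eval_rand, PMF.map_comp]
  rfl

namespace Params

variable {P : Params}

/-- Trits and digits. -/
def finEquivTrit : Fin 3 ≃ Trit where
  toFun i := trit i
  invFun z := ⟨dig z, dig_lt z⟩
  left_inv i := Fin.ext (by show dig (trit i) = i; rw [dig_trit, Nat.mod_eq_of_lt i.2])
  right_inv z := trit_dig z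

theorem rvec_three_uniform {α : Type*} [Fintype α] [Nonempty α] (e : α → Val) :
    rvec 3 ((PMF.uniformOfFintype α).map e) =
      (PMF.uniformOfFintype (Trit → α)).map fun f => eOver fun i => e (f i) := by
  rw [rvec_uniform, ← PMF.map_equiv_uniformOfFintype (finEquivTrit.arrowCongr (Equiv.refl α)),
    PMF.map_comp]
  congr 1

/-- A uniform trit. -/
def randT : PMF Val := (randBelow 3).map fun v => num (4 + v.toNat)

theorem randT_eq : randT = (PMF.uniformOfFintype Trit).map fun z : Trit => eTrit z := by
  rw [randT, randBelow_eq, ← PMF.map_equiv_uniformOfFintype finEquivTrit, PMF.map_comp,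
    PMF.map_comp]
  congr 1
  funext i
  show _ = eTrit (trit i)
  rw [eTrit_eq, dig_trit, Nat.mod_eq_of_lt i.2]
  rfl

/-- A uniform element of `Z_q`. -/
def randZ (x : Val) : PMF Val := (randBelow (inQ x)).map fun v => mkZ (inQ x) v.toNat

/-- Residue classes and their least representatives. -/
def finEquivZq : Fin P.q ≃ P.Zq where
  toFun i := ((i : ℕ) : P.Zq)
  invFun z := ⟨z.val, ZMod.val_lt z⟩
  left_inv i := Fin.ext (ZMod.val_cast_of_lt i.2)
  right_inv z := ZMod.natCast_zmod_val z

theorem randZ_eq {x : Val} (hx : Reads P x) :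
    randZ x = (PMF.uniformOfFintype P.Zq).map eZq := by
  rw [randZ, hx.q, randBelow_eq, ← PMF.map_equiv_uniformOfFintype (finEquivZq (P := P)), PMF.map_comp,
    PMF.map_comp]
  congr 1
  funext i
  exact mkZ_eq _

/-- Uniform coins. -/
def randC (x : Val) : PMF Val := (randBelow (inW x)).map fun v => num (inW x + v.toNat)

theorem randC_eq (C : CommitmentScheme) (t : ℕ) (pk : Val) (c : P.Stmt) :
    randC (Stern.input C t pk c) = (PMF.uniformOfFintype (C.Coin t)).map C.coin := by
  rw [randC, show inW (Stern.input C t pk c) = 2 ^ C.coinLen t from rfl, randBelow_eq,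
    PMF.map_comp]
  rfl

/-- A uniform label. -/
def randL (x : Val) : PMF Val :=
  rpair (rvec (inL x) (rvec (inN x) (rvec (inL x) randT)))
    (rpair (rvec (inN x) (rvec (inD x) randT)) (rvec (inL x) (rvec (inN x) (rvec (inD x) randT))))

/-- A uniform vector over `Z_q`. -/
def randV (x : Val) : PMF Val :=
  rpair (rvec (inL x) (rvec (inN x) (rvec (inN x) (rvec (inL x) (rvec (inD x)
      (rvec 3 (rvec 3 (randZ x))))))))
    (rvec (inL x) (rvec (inN x) (rvec (inD x) (rvec 3 (randZ x)))))

/-- Uncurrying of labels. -/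
def labelEquiv : (Fin P.ell → Fin P.n → Fin P.ell → Trit) × (Fin P.n → Fin P.dB → Trit) ×
    (Fin P.ell → Fin P.n → Fin P.dB → Trit) ≃ P.Label where
  toFun f := (fun i k => f.1 i k.1 k.2, fun m => f.2.1 m.1 m.2, fun y => f.2.2 y.1.1 y.1.2 y.2)
  invFun η := (fun i r s => η.1 i (r, s), fun j t => η.2.1 (j, t), fun i r t => η.2.2 ((i, r), t))
  left_inv _ := rfl
  right_inv _ := rfl

/-- Uncurrying of vectors. -/
def idxEquiv (A : Type) :
    (Fin P.ell → Fin P.n → Fin P.n → Fin P.ell → Fin P.dB → Trit → Trit → A) ×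
      (Fin P.ell → Fin P.n → Fin P.dB → Trit → A) ≃ (P.Idx → A) where
  toFun f := fun
    | .inl (i, k, m, s) => f.1 i m.1 k.1 k.2 m.2 s.2 s.1
    | .inr (y, s) => f.2 y.1.1 y.1.2 y.2 s
  invFun v := (fun i j r s t y x => v (.inl (i, (r, s), (j, t), (x, y))),
    fun i r t x => v (.inr (((i, r), t), x)))
  left_inv _ := rfl
  right_inv v := by funext z; rcases z with ⟨i, k, m, s⟩ | ⟨y, s⟩ <;> rfl

theorem randL_eq {x : Val} (hx : Reads P x) :
    randL x = (PMF.uniformOfFintype P.Label).map eLabel := by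
  simp only [randL, randT_eq, rvec_uniform, rpair_uniform, hx.n, hx.ell, hx.dB]
  exact PMF.map_uniformOfFintype_of_equiv labelEquiv fun _ => rfl

theorem randV_eq {x : Val} (hx : Reads P x) :
    randV x = (PMF.uniformOfFintype (P.Idx → P.Zq)).map eVec := by
  simp only [randV, randZ_eq hx, rvec_three_uniform]
  simp only [rvec_uniform, rpair_uniform, hx.n, hx.ell, hx.dB]
  exact PMF.map_uniformOfFintype_of_equiv (idxEquiv P.Zq) fun _ => rfl

theorem feas_randT : Feas fun _ _ => randT :=
  (Feas.randBelow (PF.const 3)).map (g := fun y => num (4 + y.snd.toNat)) (by fun_prop)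

theorem feas_randZ : Feas fun _ x => randZ x :=
  (Feas.randBelow pF_inQ).map (g := fun y => mkZ (inQ y.fst) y.snd.toNat) (by fun_prop)

theorem feas_randC : Feas fun _ x => randC x :=
  (Feas.randBelow pF_inW).map (g := fun y => num (inW y.fst + y.snd.toNat)) (by fun_prop)

theorem feas_randL : Feas fun _ x => randL x :=
  .rpair (.rvec pF_inL polyBdd_inL (.rvec pF_inN polyBdd_inN (.rvec pF_inL polyBdd_inL
    feas_randT))) (.rpair (.rvec pF_inN polyBdd_inN (.rvec pF_inD polyBdd_inD feas_randT))
    (.rvec pF_inL polyBdd_inL (.rvec pF_inN polyBdd_inN (.rvec pF_inD polyBdd_inD feas_randT))))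

theorem feas_randV : Feas fun _ x => randV x :=
  .rpair (.rvec pF_inL polyBdd_inL (.rvec pF_inN polyBdd_inN (.rvec pF_inN polyBdd_inN
      (.rvec pF_inL polyBdd_inL (.rvec pF_inD polyBdd_inD (.rvec (.const 3) (.const 3)
        (.rvec (.const 3) (.const 3) feas_randZ)))))))
    (.rvec pF_inL polyBdd_inL (.rvec pF_inN polyBdd_inN (.rvec pF_inD polyBdd_inD
      (.rvec (.const 3) (.const 3) feas_randZ))))

/-- The random choices of the prover, encoded. -/
def randCoins (x : Val) : PMF Val :=
  rpair (randL x) (rpair (randV x) (rpair (randC x) (rpair (randC x) (randC x))))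

theorem feas_randCoins : Feas fun _ x => randCoins x :=
  .rpair feas_randL (.rpair feas_randV (.rpair feas_randC (.rpair feas_randC feas_randC)))

/-- The encoding of the random choices of the prover. -/
def eCoins {C : CommitmentScheme} {t : ℕ} (s : Stern.Coins C t P) : Val :=
  .pair (eLabel s.1) (.pair (eVec s.2.1) (.pair (C.coin s.2.2.1) (.pair (C.coin s.2.2.2.1)
    (C.coin s.2.2.2.2))))

theorem randCoins_eq (C : CommitmentScheme) (t : ℕ) (pk : Val) (c : P.Stmt) :
    randCoins (Stern.input C t pk c) =
      (PMF.uniformOfFintype (Stern.Coins C t P)).map eCoins := by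
  simp only [randCoins, randL_eq (reads_input C t pk c), randV_eq (reads_input C t pk c),
    randC_eq, rpair_uniform]
  rfl

end Params
end

noncomputable section
open Val

/-! ### The prover and the verifier as programs -/

@[fun_prop]
theorem CommitmentScheme.pF_com (C : CommitmentScheme) {pk m ρ : Val → Val} (hpk : PF pk)
    (hm : PF m) (hρ : PF ρ) : PF fun z => C.com (pk z) (m z) (ρ z) := by
  have h : Feas fun _ z => C.comProg.out (.pair (pk z) (.pair (m z) (ρ z))) :=
    (Feas.out C.comProg_polyTime).comp (g := fun z => .pair (pk z) (.pair (m z) (ρ z)))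
      (by fun_prop)
  simp only [C.comProg_out] at h
  exact h

namespace Stern

open Params

variable (C : CommitmentScheme)

/-- The commitment message, from the encoded digits of the witness and random choices. -/
def cmtV (x d R : Val) : Val :=
  cmt (C.com (inK x) (.pair R.fst (mulMV x R.snd.fst)) R.snd.snd.fst)
    (C.com (inK x) (gamV x R.fst R.snd.fst) R.snd.snd.snd.fst)
    (C.com (inK x) (gamV x R.fst (addV x (redExtV x d) R.snd.fst)) R.snd.snd.snd.snd)

/-- The response, from the encoded digits of the witness, random choices and challenge. -/
def rspV (x d R ch : Val) : Val :=
  if ch.toNat = 1 then .pair (extV x (addLV x d R.fst)) (.pair (gamV x R.fst R.snd.fst)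
    (.pair R.snd.snd.snd.fst R.snd.snd.snd.snd))
  else if ch.toNat = 2 then .pair R.fst (.pair (addV x (redExtV x d) R.snd.fst)
    (.pair R.snd.snd.fst R.snd.snd.snd.snd))
  else .pair R.fst (.pair R.snd.fst (.pair R.snd.snd.fst R.snd.snd.snd.fst))

@[fun_prop]
theorem pF_cmtV {x d R : Val → Val} (hx : PF x) (hd : PF d) (hR : PF R) :
    PF fun z => cmtV C (x z) (d z) (R z) := by
  unfold cmtV cmt; fun_prop

@[fun_prop]
theorem pF_rspV {x d R ch : Val → Val} (hx : PF x) (hd : PF d) (hR : PF R) (hch : PF ch) :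
    PF fun z => rspV (x z) (d z) (R z) (ch z) := by
  unfold rspV; fun_prop

variable {C} {P : Params} {t : ℕ}

theorem cmtV_eq (pk : Val) (c : P.Stmt) (l : P.Label) (s : Coins C t P) :
    cmtV C (input C t pk c) (eLabel l) (eCoins s) = proverCmt pk (ext l) s := by
  have hx := reads_input C t pk c
  obtain ⟨η, r, ρ₁, ρ₂, ρ₃⟩ := s
  simp only [cmtV, eCoins, fst_pair, snd_pair, mulMV_eq hx, gamV_eq hx, addV_eq hx, redExtV_eq hx,
    decL_eLabel, decV_eVec]
  rfl

theorem rspV_eq (pk : Val) (c : P.Stmt) (l : P.Label) (s : Coins C t P) (ch : Challenge) :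
    rspV (input C t pk c) (eLabel l) (eCoins s) (eChallenge ch) = proverRsp (ext l) s ch := by
  have hx := reads_input C t pk c
  obtain ⟨η, r, ρ₁, ρ₂, ρ₃⟩ := s
  simp only [rspV, eCoins, fst_pair, snd_pair, gamV_eq hx, addV_eq hx, redExtV_eq hx, extV_eq hx,
    addLV_eq hx, decL_eLabel, decV_eVec, ← Gam_ext]
  fin_cases ch <;> rfl

theorem exists_prover (C : CommitmentScheme) : ∃ P₁ P₂ : Prog, P₁.PolyTime ∧ P₂.PolyTime ∧
    ∀ (P : Params) (t : ℕ) (pk : Val) (c : P.Stmt) (w : P.Witness) (ch : Challenge),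
      runProver P₁ P₂ (.pair (input C t pk c) (eWitness w)) ch = honest C t pk w ch := by
  have h1 : Feas fun _ y => (randCoins y.fst).map fun R =>
      .pair (cmtV C y.fst (digitsV y.fst y.snd) R) (.pair y R) :=
    (Feas.comp feas_randCoins PF.id'.fst).map (g := fun z =>
      .pair (cmtV C z.fst.fst (digitsV z.fst.fst z.fst.snd) z.snd) z) (by fun_prop)
  have h2 : PF fun z => rspV z.fst.fst.fst (digitsV z.fst.fst.fst z.fst.fst.snd) z.fst.snd z.snd := by
    fun_prop
  obtain ⟨P₁, hP₁, h1⟩ := h1.exists_prog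
  obtain ⟨P₂, hP₂, h2⟩ := Feas.exists_prog h2
  refine ⟨P₁, P₂, hP₁, hP₂, fun P t pk c w ch => ?_⟩
  rw [runProver, h1]
  simp only [fst_pair, snd_pair, randCoins_eq, PMF.map_comp, PMF.bind_map, h2, toVal_val,
    digitsV_eq (reads_input C t pk c), Function.comp_def, cmtV_eq, rspV_eq, PMF.pure_map]
  rfl

/-- The verification of a transcript, on encodings: the parts of the response are decoded, and the
response must be their encoding. -/
def AcceptV (C : CommitmentScheme) (x m ch r : Val) : Prop :=
  m = .pair m.fst (.pair m.snd.fst m.snd.snd) ∧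
  if ch.toNat = 1 then
    r = .pair (extV x (readLV x r.fst)) (.pair (canonV x r.snd.fst)
      (.pair (canonC x r.snd.snd.fst) (canonC x r.snd.snd.snd))) ∧
    m.snd.fst = C.com (inK x) (canonV x r.snd.fst) (canonC x r.snd.snd.fst) ∧
    m.snd.snd = C.com (inK x) (addV x (redExtV x (readLV x r.fst)) (canonV x r.snd.fst))
      (canonC x r.snd.snd.snd)
  else
    r = .pair (canonL x r.fst) (.pair (canonV x r.snd.fst)
      (.pair (canonC x r.snd.snd.fst) (canonC x r.snd.snd.snd))) ∧
    if ch.toNat = 2 then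
      m.fst = C.com (inK x) (.pair (canonL x r.fst)
        (subR x (mulMV x (canonV x r.snd.fst)) (inC x))) (canonC x r.snd.snd.fst) ∧
      m.snd.snd = C.com (inK x) (gamV x (canonL x r.fst) (canonV x r.snd.fst))
        (canonC x r.snd.snd.snd)
    else
      m.fst = C.com (inK x) (.pair (canonL x r.fst) (mulMV x (canonV x r.snd.fst)))
        (canonC x r.snd.snd.fst) ∧
      m.snd.fst = C.com (inK x) (gamV x (canonL x r.fst) (canonV x r.snd.fst))
        (canonC x r.snd.snd.snd)

theorem pF_acceptV (C : CommitmentScheme) {x m ch r : Val → Val} (hx : PF x) (hm : PF m)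
    (hch : PF ch) (hr : PF r) : PF fun z => AcceptV C (x z) (m z) (ch z) (r z) := by
  unfold AcceptV; fun_prop

theorem acceptV_iff (pk : Val) (c : P.Stmt) (m : Val) (ch : Challenge) (r : Val) :
    AcceptV C (input C t pk c) m (eChallenge ch) r ↔ Accept C t pk c m ch r := by
  have hx := reads_input C t pk c
  have hC : inC (input C t pk c) = eRows (target c) := by
    simp only [inC, input, snd_pair, eStmt_eq]
  have hK : inK (input C t pk c) = pk := rfl
  simp only [AcceptV, extV_eq hx, readLV_eq hx, canonV_eq hx, canonC_eq, canonL_eq hx, addV_eq hx,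
    redExtV_eq hx, gamV_eq hx, mulMV_eq hx, subR_eq hx, decL_eLabel, decV_eVec, hC, hK, decR_eRows]
  constructor
  · rintro ⟨hm, h⟩
    refine ⟨m.fst, m.snd.fst, m.snd.snd, hm, ?_⟩
    fin_cases ch
    · obtain ⟨h1, h2, h3⟩ := h
      exact ⟨_, _, _, _, h1, ext_mem_VALID _, h2, h3⟩
    · obtain ⟨h1, h2, h3⟩ := h
      exact ⟨_, _, _, _, h1, h2, h3⟩
    · obtain ⟨h1, h2, h3⟩ := h
      exact ⟨_, _, _, _, h1, h2, h3⟩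
  · rintro ⟨C₁, C₂, C₃, rfl, h⟩
    refine ⟨rfl, ?_⟩
    fin_cases ch
    · obtain ⟨tw, tr, ρ₂, ρ₃, rfl, htw, rfl, rfl⟩ := h
      rw [VALID_eq_range] at htw
      obtain ⟨l, rfl⟩ := htw
      simp only [rspA, fst_pair, snd_pair, readL_eShort_ext, decV_eVec, decCoin_coin]
      exact ⟨trivial, rfl, rfl⟩
    · obtain ⟨η, w₂, ρ₁, ρ₃, rfl, rfl, rfl⟩ := h
      simp only [rspB, fst_pair, snd_pair, decL_eLabel, decV_eVec, decCoin_coin]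
      exact ⟨trivial, rfl, rfl⟩
    · obtain ⟨η, w₂, ρ₁, ρ₃, rfl, rfl, rfl⟩ := h
      simp only [rspB, fst_pair, snd_pair, decL_eLabel, decV_eVec, decCoin_coin]
      exact ⟨trivial, rfl, rfl⟩

theorem efficient (C : CommitmentScheme) (P : ℕ → Params) : Efficient C P := by
  constructor
  · obtain ⟨P₁, P₂, h₁, h₂, h⟩ := exists_prover C
    exact ⟨P₁, P₂, h₁, h₂, fun t pk c w _ ch => h (P t) t pk c w ch⟩
  · obtain ⟨V, hV, h⟩ := Feas.exists_prog (pF_acceptV C (x := fun z => z.fst)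
      (m := fun z => z.snd.fst) (ch := fun z => z.snd.snd.fst) (r := fun z => z.snd.snd.snd)
      (by fun_prop) (by fun_prop) (by fun_prop) (by fun_prop))
    refine ⟨V, hV, fun t pk c m ch rsp => ?_⟩
    rw [h]
    simp only [fst_pair, snd_pair, acceptV_iff]
    rfl

/-! ### Completeness -/

theorem Gam_add (η : P.Label) (u v : P.Idx → P.Zq) : Gam η (u + v) = Gam η u + Gam η v := by
  funext z
  rcases z with ⟨i, k, m, s⟩ | ⟨y, s⟩ <;> rfl

theorem Gam_red (η : P.Label) (v : P.Idx → ℤ) : Gam η (red v) = red (Gam η v) := by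
  funext z
  rcases z with ⟨i, k, m, s⟩ | ⟨y, s⟩ <;> rfl

theorem accept_honest {c : P.Stmt} {w : P.Witness} (h : Rel c w) (pk : Val) (s : Coins C t P)
    (ch : Challenge) :
    Accept C t pk c (proverCmt pk (secret w) s) ch (proverRsp (secret w) s ch) := by
  obtain ⟨η, r, ρ₁, ρ₂, ρ₃⟩ := s
  have hM : P.M.mulVec (red (secret w)) = target c := (eq_iff_M_mulVec_secret c h.1 h.2.1).1 h.2.2
  refine ⟨_, _, _, rfl, ?_⟩
  fin_cases ch
  · refine ⟨_, _, _, _, rfl, (mem_VALID_iff_Gam η _).1 (secret_mem_VALID w), rfl, ?_⟩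
    show _ = C.com pk (msg (red (Gam η (secret w)) + Gam η r)) (C.coin ρ₃)
    rw [Gam_add, Gam_red]
  · refine ⟨_, _, _, _, rfl, ?_, rfl⟩
    rw [Matrix.mulVec_add, hM, add_sub_cancel_left]
  · exact ⟨_, _, _, _, rfl, rfl, rfl⟩

end Stern
end

noncomputable section
open Val

/-! ### Probabilities and statistical distance -/

section Probability

variable {α β : Type}

theorem PMF.sum_toReal (μ : PMF α) : HasSum (fun a => (μ a).toReal) 1 := by
  have h := ENNReal.hasSum_toReal (f := fun a => μ a) (by simp [μ.tsum_coe])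
  rwa [← ENNReal.tsum_toReal_eq (fun a => μ.apply_ne_top a), μ.tsum_coe, ENNReal.toReal_one] at h

theorem PMF.summable_mul (μ : PMF α) {f : α → ℝ} (h0 : ∀ a, 0 ≤ f a) (h1 : ∀ a, f a ≤ 1) :
    Summable fun a => (μ a).toReal * f a :=
  Summable.of_nonneg_of_le (fun a => mul_nonneg ENNReal.toReal_nonneg (h0 a))
    (fun a => mul_le_of_le_one_right ENNReal.toReal_nonneg (h1 a)) μ.sum_toReal.summable

theorem prob_nonneg (μ : PMF α) (s : Set α) : 0 ≤ prob μ s := ENNReal.toReal_nonneg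

theorem toOuterMeasure_le_one (μ : PMF α) (s : Set α) : μ.toOuterMeasure s ≤ 1 := by
  rw [PMF.toOuterMeasure_apply, ← μ.tsum_coe]
  exact ENNReal.tsum_le_tsum fun a => Set.indicator_le_self s μ a

theorem toOuterMeasure_ne_top (μ : PMF α) (s : Set α) : μ.toOuterMeasure s ≠ ⊤ :=
  ne_top_of_le_ne_top ENNReal.one_ne_top (toOuterMeasure_le_one μ s)

theorem prob_le_one (μ : PMF α) (s : Set α) : prob μ s ≤ 1 :=
  ENNReal.toReal_le_of_le_ofReal zero_le_one (by simpa using toOuterMeasure_le_one μ s)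

theorem prob_mono (μ : PMF α) {s t : Set α} (h : s ⊆ t) : prob μ s ≤ prob μ t :=
  ENNReal.toReal_mono (toOuterMeasure_ne_top μ t) (μ.toOuterMeasure.mono h)

theorem prob_union_le (μ : PMF α) (s t : Set α) : prob μ (s ∪ t) ≤ prob μ s + prob μ t := by
  rw [prob, prob, prob, ← ENNReal.toReal_add (toOuterMeasure_ne_top μ s)
    (toOuterMeasure_ne_top μ t)]
  exact ENNReal.toReal_mono (ENNReal.add_ne_top.2 ⟨toOuterMeasure_ne_top μ s,
    toOuterMeasure_ne_top μ t⟩) (MeasureTheory.measure_union_le s t)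

theorem prob_bind (μ : PMF α) (f : α → PMF β) (s : Set β) :
    prob (μ.bind f) s = ∑' a, (μ a).toReal * prob (f a) s := by
  rw [prob, PMF.toOuterMeasure_bind_apply, ENNReal.tsum_toReal_eq]
  · simp only [ENNReal.toReal_mul]; rfl
  · exact fun a => ENNReal.mul_ne_top (μ.apply_ne_top a) (toOuterMeasure_ne_top _ s)

theorem prob_pure (a : α) (s : Set α) [Decidable (a ∈ s)] :
    prob (PMF.pure a) s = if a ∈ s then 1 else 0 := by
  rw [prob, PMF.toOuterMeasure_pure_apply]
  split_ifs <;> simp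

theorem prob_map (μ : PMF α) (f : α → β) (s : Set β) : prob (μ.map f) s = prob μ (f ⁻¹' s) := by
  rw [prob, PMF.toOuterMeasure_map_apply]; rfl

open Classical in
theorem prob_eq_tsum (μ : PMF α) (s : Set α) :
    prob μ s = ∑' a, (μ a).toReal * if a ∈ s then 1 else 0 := by
  conv_lhs => rw [← PMF.bind_pure μ]
  rw [prob_bind]
  simp only [prob_pure]

theorem prob_bind_congr_le (μ : PMF α) {f : α → PMF β} {s : Set β} {g : α → ℝ}
    (h0 : ∀ a, 0 ≤ g a) (h1 : ∀ a, g a ≤ 1) (h : ∀ a, prob (f a) s ≤ g a) :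
    prob (μ.bind f) s ≤ ∑' a, (μ a).toReal * g a := by
  rw [prob_bind]
  exact (μ.summable_mul (fun a => prob_nonneg _ s) fun a => prob_le_one _ s).tsum_le_tsum
    (fun a => mul_le_mul_of_nonneg_left (h a) ENNReal.toReal_nonneg) (μ.summable_mul h0 h1)

theorem prob_uniform_bind {α : Type} [Fintype α] [Nonempty α] (f : α → PMF β) (s : Set β) :
    prob ((PMF.uniformOfFintype α).bind f) s = (∑ a, prob (f a) s) / Fintype.card α := by
  rw [prob_bind, tsum_fintype, Finset.sum_div]
  refine Finset.sum_congr rfl fun a _ => ?_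
  rw [PMF.uniformOfFintype_apply, ENNReal.toReal_inv, ENNReal.toReal_natCast]
  ring

theorem StatClose.mono {μ ν : PMF α} {ε δ : ℝ} (h : StatClose μ ν ε) (hε : ε ≤ δ) :
    StatClose μ ν δ := fun s => (h s).trans hε

theorem StatClose.symm {μ ν : PMF α} {ε : ℝ} (h : StatClose μ ν ε) : StatClose ν μ ε :=
  fun s => abs_sub_comm (prob μ s) _ ▸ h s

theorem StatClose.trans {μ ν ξ : PMF α} {ε δ : ℝ} (h : StatClose μ ν ε) (h' : StatClose ν ξ δ) :
    StatClose μ ξ (ε + δ) :=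
  fun s => (abs_sub_le _ (prob ν s) _).trans (add_le_add (h s) (h' s))

theorem StatClose.refl (μ : PMF α) : StatClose μ μ 0 := fun s => by simp

theorem StatClose.bind_right (μ : PMF α) {f g : α → PMF β} {ε : ℝ}
    (h : ∀ a, StatClose (f a) (g a) ε) : StatClose (μ.bind f) (μ.bind g) ε := by
  intro s
  have hf := μ.summable_mul (fun a => prob_nonneg (f a) s) fun a => prob_le_one (f a) s
  have hg := μ.summable_mul (fun a => prob_nonneg (g a) s) fun a => prob_le_one (g a) s
  rw [prob_bind, prob_bind, ← hf.tsum_sub hg]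
  have hε : HasSum (fun a => (μ a).toReal * ε) ε := by
    simpa using μ.sum_toReal.mul_right ε
  have hs := hf.sub hg
  have hle : ∀ a, |(μ a).toReal * prob (f a) s - (μ a).toReal * prob (g a) s| ≤
      (μ a).toReal * ε := by
    intro a
    rw [← mul_sub, abs_mul, abs_of_nonneg ENNReal.toReal_nonneg]
    exact mul_le_mul_of_nonneg_left (h a s) ENNReal.toReal_nonneg
  rw [← hε.tsum_eq]
  refine abs_le.2 ⟨?_, ?_⟩
  · rw [← tsum_neg]
    exact hε.summable.neg.tsum_le_tsum (fun a => (abs_le.1 (hle a)).1) hs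
  · exact hs.tsum_le_tsum (fun a => (abs_le.1 (hle a)).2) hε.summable

/-- The set on which `μ` outweighs `ν` is the best test with values between `0` and `1`. -/
theorem StatClose.tsum_sub_le {μ ν : PMF α} {ε : ℝ} (h : StatClose μ ν ε) {f : α → ℝ}
    (h0 : ∀ a, 0 ≤ f a) (h1 : ∀ a, f a ≤ 1) :
    ∑' a, (μ a).toReal * f a - ∑' a, (ν a).toReal * f a ≤ ε := by
  classical
  refine le_trans ?_ ((le_abs_self _).trans (h {a | (ν a).toReal ≤ (μ a).toReal}))
  have hi : ∀ ξ : PMF α, Summable fun a => (ξ a).toReal *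
      if a ∈ {a | (ν a).toReal ≤ (μ a).toReal} then 1 else 0 := fun ξ =>
    ξ.summable_mul (fun a => by split <;> norm_num) fun a => by split <;> norm_num
  rw [prob_eq_tsum, prob_eq_tsum, ← (μ.summable_mul h0 h1).tsum_sub (ν.summable_mul h0 h1),
    ← (hi μ).tsum_sub (hi ν)]
  refine ((μ.summable_mul h0 h1).sub (ν.summable_mul h0 h1)).tsum_le_tsum (fun a => ?_)
    ((hi μ).sub (hi ν))
  rw [← sub_mul, ← sub_mul]
  simp only [Set.mem_ofPred_eq]
  split_ifs with hle
  · exact mul_le_mul_of_nonneg_left (h1 a) (sub_nonneg.2 hle)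
  · rw [mul_zero]
    exact mul_nonpos_of_nonpos_of_nonneg (by linarith) (h0 a)

theorem StatClose.bind_left {μ ν : PMF α} {ε : ℝ} (h : StatClose μ ν ε) (f : α → PMF β) :
    StatClose (μ.bind f) (ν.bind f) ε := by
  intro s
  rw [prob_bind, prob_bind]
  have h1 := h.tsum_sub_le (fun a => prob_nonneg (f a) s) fun a => prob_le_one (f a) s
  have h2 := h.symm.tsum_sub_le (fun a => prob_nonneg (f a) s) fun a => prob_le_one (f a) s
  exact abs_le.2 ⟨by linarith, h1⟩

theorem StatClose.map {μ ν : PMF α} {ε : ℝ} (h : StatClose μ ν ε) (f : α → β) :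
    StatClose (μ.map f) (ν.map f) ε := h.bind_left _

end Probability

/-! ### Rejection sampling -/

open Classical in
/-- Run an experiment up to `n` times, until its outcome differs from `0`. -/
def retry (T : PMF Val) : ℕ → PMF Val
  | 0 => PMF.pure (num 0)
  | n + 1 => T.bind fun o => if o = num 0 then retry T n else PMF.pure o

open Classical in
/-- If every outcome of `R` is kept with probability `1/3`, then rejection sampling leads back to
`R`, up to the probability that all runs fail. -/
theorem statClose_retry {R : PMF Val} {k : Val → Fin 3} (hR : ∀ v ∈ R.support, v ≠ num 0)
    (n : ℕ) :
    StatClose (retry (R.bind fun v => (PMF.uniformOfFintype (Fin 3)).map fun g : Fin 3 =>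
      if g = k v then v else num 0) n) R ((2 / 3) ^ n) := by
  intro s
  induction n with
  | zero =>
    have h1 := prob_nonneg (retry (R.bind fun v => (PMF.uniformOfFintype (Fin 3)).map
      fun g : Fin 3 => if g = k v then v else num 0) 0) s
    have h2 := prob_le_one (retry (R.bind fun v => (PMF.uniformOfFintype (Fin 3)).map
      fun g : Fin 3 => if g = k v then v else num 0) 0) s
    have h3 := prob_nonneg R s
    have h4 := prob_le_one R s
    rw [pow_zero, abs_le]
    constructor <;> linarith
  | succ n ih =>
    set T := R.bind fun v => (PMF.uniformOfFintype (Fin 3)).map fun g : Fin 3 =>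
      if g = k v then v else num 0 with hT
    have key : prob (retry T (n + 1)) s = 1 / 3 * prob R s + 2 / 3 * prob (retry T n) s := by
      have h1 : retry T (n + 1) = R.bind fun v => (PMF.uniformOfFintype (Fin 3)).bind fun g =>
          if (if g = k v then v else num 0) = num 0 then retry T n
          else PMF.pure (if g = k v then v else num 0) := by
        conv_lhs => rw [retry]
        nth_rewrite 1 [hT]
        simp only [PMF.bind_bind, PMF.bind_map]
        rfl
      have h2 : ∀ v ∈ R.support, prob ((PMF.uniformOfFintype (Fin 3)).bind fun g =>
          if (if g = k v then v else num 0) = num 0 then retry T n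
          else PMF.pure (if g = k v then v else num 0)) s =
          1 / 3 * (if v ∈ s then 1 else 0) + 2 / 3 * prob (retry T n) s := by
        intro v hv
        have hv := hR v hv
        rw [prob_uniform_bind]
        have h3 : ∀ g : Fin 3, prob (if (if g = k v then v else num 0) = num 0 then retry T n
            else PMF.pure (if g = k v then v else num 0)) s =
            if g = k v then (if v ∈ s then 1 else 0) else prob (retry T n) s := by
          intro g
          by_cases hg : g = k v
          · rw [if_pos hg, if_pos hg, if_neg hv, prob_pure]
          · rw [if_neg hg, if_neg hg, if_pos rfl]
        simp only [h3, Fin.sum_univ_three, Fintype.card_fin]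
        generalize k v = j
        generalize (if v ∈ s then (1 : ℝ) else 0) = b
        fin_cases j <;> simp <;> ring
      rw [h1, prob_bind, prob_eq_tsum R]
      have h4 : ∀ v, (R v).toReal * prob ((PMF.uniformOfFintype (Fin 3)).bind fun g =>
          if (if g = k v then v else num 0) = num 0 then retry T n
          else PMF.pure (if g = k v then v else num 0)) s =
          1 / 3 * ((R v).toReal * if v ∈ s then 1 else 0) +
            (R v).toReal * (2 / 3 * prob (retry T n) s) := by
        intro v
        by_cases hv : v ∈ R.support
        · rw [h2 v hv]; ring
        · rw [PMF.mem_support_iff, not_not] at hv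
          simp [hv]
      simp only [h4]
      have hs : Summable fun v => (R v).toReal * if v ∈ s then (1 : ℝ) else 0 :=
        R.summable_mul (fun a => by split <;> norm_num) fun a => by split <;> norm_num
      rw [(hs.mul_left _).tsum_add (R.sum_toReal.mul_right _).summable, tsum_mul_left,
        (R.sum_toReal.mul_right _).tsum_eq, one_mul]
    rw [key, pow_succ, show 1 / 3 * prob R s + 2 / 3 * prob (retry T n) s - prob R s =
      2 / 3 * (prob (retry T n) s - prob R s) by ring, abs_mul, abs_of_pos (by norm_num), mul_comm]
    gcongr

open Classical in
/-- Replacing the experiments of rejection sampling one by one: the error grows linearly with the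
number of runs. The experiments may share a random key. -/
theorem statClose_key_retry {κ : Type} {K : PMF κ} {T T' : κ → PMF Val} {ε : ℝ}
    (h : StatClose (K.bind fun pk => (T pk).map fun v => (pk, v))
      (K.bind fun pk => (T' pk).map fun v => (pk, v)) ε) (n : ℕ) :
    StatClose (K.bind fun pk => (retry (T pk) n).map fun v => (pk, v))
      (K.bind fun pk => (retry (T' pk) n).map fun v => (pk, v)) (n * ε) := by
  induction n with
  | zero => simpa [retry] using StatClose.refl _
  | succ n ih =>
    -- first the later runs are replaced, then the first one
    have h1 : StatClose
        (K.bind fun pk => (T pk).bind fun o => ((if o = num 0 then retry (T pk) n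
          else PMF.pure o)).map fun v => (pk, v))
        (K.bind fun pk => (T pk).bind fun o => ((if o = num 0 then retry (T' pk) n
          else PMF.pure o)).map fun v => (pk, v)) (n * ε) := by
      have h2 := ih.bind_left fun x => (T x.1).map fun o => (x.1, if o = num 0 then x.2 else o)
      have h3 : ∀ S : κ → PMF Val, ((K.bind fun pk => (S pk).map fun v => (pk, v)).bind
          fun x => (T x.1).map fun o => (x.1, if o = num 0 then x.2 else o)) =
          K.bind fun pk => (T pk).bind fun o => ((if o = num 0 then S pk
            else PMF.pure o)).map fun v => (pk, v) := by
        intro S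
        rw [PMF.bind_bind]
        congr 1
        funext pk
        rw [PMF.bind_map]
        simp only [Function.comp_def, PMF.map]
        rw [PMF.bind_comm]
        congr 1
        funext o
        by_cases ho : o = num 0 <;> simp [ho]
      rwa [h3, h3] at h2
    have h4 : StatClose
        (K.bind fun pk => (T pk).bind fun o => ((if o = num 0 then retry (T' pk) n
          else PMF.pure o)).map fun v => (pk, v))
        (K.bind fun pk => (T' pk).bind fun o => ((if o = num 0 then retry (T' pk) n
          else PMF.pure o)).map fun v => (pk, v)) ε := by
      have h2 := h.bind_left fun x => (if x.2 = num 0 then retry (T' x.1) n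
        else PMF.pure x.2).map fun v => (x.1, v)
      simpa only [PMF.bind_bind, PMF.bind_map, Function.comp_def] using h2
    have h5 := (h1.trans h4).mono (δ := (n + 1 : ℕ) * ε) (by push_cast; linarith)
    simpa only [retry, PMF.map_bind] using h5

end

noncomputable section
open Val

/-! ### Lengths of the exchanged data -/

namespace Val

theorem size_ofFun_congr {k : ℕ} {f g : Fin k → Val} (h : ∀ i, (f i).size = (g i).size) :
    (ofFun f).size = (ofFun g).size := by
  unfold ofFun
  induction k with
  | zero => simp
  | succ k ih =>
    rw [List.ofFn_succ, List.ofFn_succ, List.foldr_cons, List.foldr_cons, size_pair, size_pair,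
      h 0, ih fun i => h i.succ]

theorem size_ofFun_le {k c : ℕ} (hk : 1 ≤ k) {f : Fin k → Val} (h : ∀ i, (f i).size ≤ c) :
    (ofFun f).size ≤ k * (3 * c) := by
  have h2 : 2 ≤ c := (two_le_size _).trans (h ⟨0, hk⟩)
  have key : ∀ (k : ℕ) (f : Fin k → Val), (∀ i, (f i).size ≤ c) →
      (ofFun f).size ≤ k * (c + 1) + 2 := by
    intro k
    induction k with
    | zero => intro f _; simp [ofFun, size_num]
    | succ k ih =>
      intro f h
      have h1 := ih (fun i => f i.succ) fun i => h i.succ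
      have h3 := h 0
      have h4 : (k + 1) * (c + 1) = k * (c + 1) + (c + 1) := by ring
      unfold ofFun at h1 ⊢
      rw [List.ofFn_succ, List.foldr_cons, size_pair]
      omega
  refine (key k f h).trans ?_
  nlinarith

theorem size_word {w x : ℕ} (hx : x < 2 ^ w) : (word w x).size = 2 * w + 4 := by
  rw [word, size_num]
  have h : (2 ^ w + x).size = w + 1 := by
    refine le_antisymm (Nat.size_le.2 ?_) (Nat.lt_size.2 (by omega))
    rw [pow_succ]; omega
  omega

end Val

theorem CommitmentScheme.size_coin (C : CommitmentScheme) {t : ℕ} (ρ : C.Coin t) :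
    (C.coin ρ).size = 2 * C.coinLen t + 4 := size_word ρ.2

namespace Params

variable {P : Params}

theorem size_eZq (z : P.Zq) : (eZq z).size = 2 * P.q.size + 4 :=
  size_word ((ZMod.val_lt z).trans (Nat.lt_size_self P.q))

theorem size_eTrit (z : Trit) : (eTrit z).size = 8 := by
  have h1 := dig_lt z
  exact size_word (w := 2) (x := dig z) (by omega)

theorem eOver_eq_ofFun (f : Trit → Val) : eOver f = ofFun fun i : Fin 3 => f (trit i) := by
  rw [eOver_eq_tab]
  exact tab_eq_ofFun fun _ => rfl

theorem size_eIdx_congr {f g : P.Idx → Val} (h : ∀ z, (f z).size = (g z).size) :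
    (eIdx f).size = (eIdx g).size := by
  have h1 : ∀ F G : Trit → Val, (∀ x, (F x).size = (G x).size) →
      (eOver F).size = (eOver G).size := fun F G hFG => by
    rw [eOver_eq_ofFun, eOver_eq_ofFun]
    exact size_ofFun_congr fun i => hFG (trit i)
  rw [eIdx, eIdx, size_pair, size_pair]
  refine congr_arg₂ _ (congr_arg₂ _ ?_ ?_) rfl
  · refine size_ofFun_congr fun i => size_ofFun_congr fun j => size_ofFun_congr fun r =>
      size_ofFun_congr fun s => size_ofFun_congr fun t => ?_
    exact h1 _ _ fun y => h1 _ _ fun x => h (.inl (i, (r, s), (j, t), (x, y)))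
  · refine size_ofFun_congr fun i => size_ofFun_congr fun r => size_ofFun_congr fun t => ?_
    exact h1 _ _ fun x => h (.inr (((i, r), t), x))

theorem size_eVec_congr (u v : P.Idx → P.Zq) : (eVec u).size = (eVec v).size :=
  size_eIdx_congr fun z => by rw [size_eZq, size_eZq]

theorem size_eRows_congr (u v : Fin P.ell × Fin P.n → P.Zq) : (eRows u).size = (eRows v).size :=
  size_ofFun_congr fun _ => size_ofFun_congr fun _ => by rw [size_eZq, size_eZq]

theorem size_eLabel_congr (η ξ : P.Label) : (eLabel η).size = (eLabel ξ).size := by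
  simp only [eLabel, size_pair]
  congr 2
  · exact size_ofFun_congr fun _ => size_ofFun_congr fun _ => size_ofFun_congr fun _ => by
      rw [size_eTrit, size_eTrit]
  · congr 2
    · exact size_ofFun_congr fun _ => size_ofFun_congr fun _ => by rw [size_eTrit, size_eTrit]
    · exact size_ofFun_congr fun _ => size_ofFun_congr fun _ => size_ofFun_congr fun _ => by
        rw [size_eTrit, size_eTrit]

theorem size_msg1_congr (η ξ : P.Label) (u v : Fin P.ell × Fin P.n → P.Zq) :
    (Stern.msg1 η u).size = (Stern.msg1 ξ v).size := by
  rw [Stern.msg1, Stern.msg1, size_pair, size_pair, size_eLabel_congr η ξ, size_eRows_congr u v]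

theorem one_le_n : 1 ≤ P.n := by have := P.two_le_n; omega

theorem one_le_ell : 1 ≤ P.ell := Nat.succ_pos _

theorem one_le_dB : 1 ≤ P.dB := Nat.succ_pos _

/-- The constant comes from seven nested lists: a list of `k ≥ 1` items of length at most `c` has
length at most `3 * k * c`. -/
theorem size_eIdx_le {f : P.Idx → Val} {c : ℕ} (h : ∀ z, (f z).size ≤ c) :
    (eIdx f).size ≤ 2188 * (P.L * c) := by
  have h1 := one_le_n (P := P)
  have h2 := one_le_ell (P := P)
  have h3 := one_le_dB (P := P)
  have hc : 2 ≤ c := (two_le_size _).trans (h (.inr (((0, 0), 0), br3 0)))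
  rw [eIdx, size_pair]
  simp only [eOver_eq_ofFun]
  have h4 := size_ofFun_le h2 fun i => size_ofFun_le h1 fun j => size_ofFun_le h1 fun r =>
    size_ofFun_le h2 fun s => size_ofFun_le h3 fun t => size_ofFun_le (k := 3) (by norm_num)
      fun y => size_ofFun_le (k := 3) (by norm_num) fun x =>
        h (.inl (i, (r, s), (j, t), (trit x, trit y)))
  have h5 := size_ofFun_le h2 fun i => size_ofFun_le h1 fun r => size_ofFun_le h3 fun t =>
    size_ofFun_le (k := 3) (by norm_num) fun x => h (.inr (((i, r), t), trit x))
  have h6 : 1 ≤ P.n * P.ell * P.dB * c :=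
    Nat.mul_pos (Nat.mul_pos (Nat.mul_pos h1 h2) h3) (by omega)
  have h7 : P.ell * (3 * (P.n * (3 * (P.n * (3 * (P.ell * (3 * (P.dB * (3 * (3 * (3 *
      (3 * (3 * c))))))))))))) = 2187 * (9 * P.n ^ 2 * P.ell ^ 2 * P.dB * c) := by ring
  have h8 : P.ell * (3 * (P.n * (3 * (P.dB * (3 * (3 * (3 * c))))))) =
      81 * (3 * P.n * P.ell * P.dB * c) := by ring
  have h9 : P.L * c = 9 * P.n ^ 2 * P.ell ^ 2 * P.dB * c + 3 * P.n * P.ell * P.dB * c := by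
    rw [L]; ring
  have h10 : 3 * P.n * P.ell * P.dB * c = 3 * (P.n * P.ell * P.dB * c) := by ring
  omega

theorem n_ell_dB_le_L : P.n * P.ell * P.dB ≤ P.L := by
  rw [L]
  nlinarith [Nat.zero_le (9 * P.n ^ 2 * P.ell ^ 2 * P.dB), Nat.zero_le (P.n * P.ell * P.dB)]

theorem one_le_L : 1 ≤ P.L :=
  (Nat.mul_pos (Nat.mul_pos one_le_n one_le_ell) one_le_dB : 0 < _).trans_le n_ell_dB_le_L

theorem n_mul_ell_le_L : P.ell * P.n ≤ P.L := by
  refine le_trans ?_ n_ell_dB_le_L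
  rw [mul_comm P.ell]
  exact Nat.le_mul_of_pos_right _ one_le_dB

theorem size_eVec_le (v : P.Idx → P.Zq) : (eVec v).size ≤ 2188 * (P.L * (6 * P.q.size)) := by
  have hq : 2 ≤ P.q.size := Nat.lt_size.2 (by have := P.three_le_q; omega)
  exact size_eIdx_le fun z => by rw [size_eZq]; omega

theorem size_eShort_le (v : P.Idx → ℤ) (hv : v ∈ P.VALID) :
    (eShort v).size ≤ 2188 * (P.L * 8) := by
  rw [VALID_eq_range] at hv
  obtain ⟨l, rfl⟩ := hv
  rw [← decL_eLabel l, decL]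
  refine size_eIdx_le fun z => ?_
  rcases z with ⟨i, k, m, s⟩ | ⟨y, s⟩
  · rw [ext_labOf_inl, size_num]
    have : (4 + multDig (labA (eLabel l) i k.1 k.2) (labG (eLabel l) m.1 m.2) (dig s.1)
        (dig s.2)).size ≤ 3 := by
      rw [Nat.size_le, multDig]
      have h1 := Nat.mod_lt (labA (eLabel l) i k.1 k.2 + 2 * dig s.1 + 1) (by norm_num : 3 > 0)
      have h2 := Nat.mod_lt (labG (eLabel l) m.1 m.2 + 2 * dig s.2 + 1) (by norm_num : 3 > 0)
      generalize (labA (eLabel l) i k.1 k.2 + 2 * dig s.1 + 1) % 3 = a at *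
      generalize (labG (eLabel l) m.1 m.2 + 2 * dig s.2 + 1) % 3 = b at *
      interval_cases a <;> interval_cases b <;> norm_num
    omega
  · rw [ext_labOf_inr, size_num]
    have : (4 + (labE (eLabel l) y.1.1 y.1.2 y.2 + 2 * dig s + 1) % 3).size ≤ 3 := by
      rw [Nat.size_le]
      omega
    omega

theorem size_eRows_le (u : Fin P.ell × Fin P.n → P.Zq) :
    (eRows u).size ≤ 9 * (P.L * (6 * P.q.size)) := by
  have hq : 2 ≤ P.q.size := Nat.lt_size.2 (by have := P.three_le_q; omega)
  have h := size_ofFun_le one_le_ell fun i => size_ofFun_le one_le_n fun r =>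
    (size_eZq (u (i, r))).le.trans (by omega : _ ≤ 6 * P.q.size)
  refine h.trans ?_
  calc P.ell * (3 * (P.n * (3 * (6 * P.q.size)))) = 9 * ((P.ell * P.n) * (6 * P.q.size)) := by ring
    _ ≤ _ := by gcongr; exact n_mul_ell_le_L

theorem size_eLabel_le (η : P.Label) : (eLabel η).size ≤ 1000 * P.L := by
  have h1 := one_le_n (P := P)
  have h2 := one_le_ell (P := P)
  have h3 := one_le_dB (P := P)
  rw [eLabel, size_pair, size_pair]
  have h4 := size_ofFun_le h2 fun i => size_ofFun_le h1 fun r => size_ofFun_le h2 fun s =>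
    (size_eTrit (η.1 i (r, s))).le
  have h5 := size_ofFun_le h1 fun j => size_ofFun_le h3 fun t => (size_eTrit (η.2.1 (j, t))).le
  have h6 := size_ofFun_le h2 fun i => size_ofFun_le h1 fun r => size_ofFun_le h3 fun t =>
    (size_eTrit (η.2.2 ((i, r), t))).le
  have h7 : P.ell * (3 * (P.n * (3 * (P.ell * (3 * 8))))) ≤
      24 * (9 * P.n ^ 2 * P.ell ^ 2 * P.dB) := by
    have : P.n * P.ell ^ 2 * 1 * 1 ≤ P.n * P.ell ^ 2 * P.n * P.dB := by gcongr
    nlinarith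
  have h8 : P.n * (3 * (P.dB * (3 * 8))) ≤ 72 * (P.n * P.ell * P.dB) := by
    have : P.n * 1 * P.dB ≤ P.n * P.ell * P.dB := by gcongr
    nlinarith
  have h9 : P.ell * (3 * (P.n * (3 * (P.dB * (3 * 8))))) = 216 * (P.n * P.ell * P.dB) := by ring
  have h10 : P.L = 9 * P.n ^ 2 * P.ell ^ 2 * P.dB + 3 * (P.n * P.ell * P.dB) := by rw [L]; ring
  have h11 := one_le_L (P := P)
  omega

theorem size_msg1_le (η : P.Label) (u : Fin P.ell × Fin P.n → P.Zq) :
    (Stern.msg1 η u).size ≤ 2188 * (P.L * (6 * P.q.size)) := by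
  have hq : 2 ≤ P.q.size := Nat.lt_size.2 (by have := P.three_le_q; omega)
  have h1 := size_eLabel_le η
  have h2 := size_eRows_le u
  have h3 := one_le_L (P := P)
  have h4 : P.L * 2 ≤ P.L * P.q.size := by gcongr
  rw [Stern.msg1, size_pair]
  have h5 : P.L * (6 * P.q.size) = 6 * (P.L * P.q.size) := by ring
  omega

end Params

/-! ### Growth of the parameters -/

/-- Sequences bounded by a polynomial. -/
def PolyN (f : ℕ → ℕ) : Prop := ∃ p : ℕ[X], ∀ t, f t ≤ p.eval t

namespace PolyN

theorem mono {f g : ℕ → ℕ} (hg : PolyN g) (h : ∀ t, f t ≤ g t) : PolyN f := by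
  obtain ⟨p, hp⟩ := hg
  exact ⟨p, fun t => (h t).trans (hp t)⟩

theorem add {f g : ℕ → ℕ} (hf : PolyN f) (hg : PolyN g) : PolyN fun t => f t + g t := by
  obtain ⟨p, hp⟩ := hf
  obtain ⟨r, hr⟩ := hg
  exact ⟨p + r, fun t => by rw [eval_add]; exact add_le_add (hp t) (hr t)⟩

theorem mul {f g : ℕ → ℕ} (hf : PolyN f) (hg : PolyN g) : PolyN fun t => f t * g t := by
  obtain ⟨p, hp⟩ := hf
  obtain ⟨r, hr⟩ := hg
  exact ⟨p * r, fun t => by rw [eval_mul]; exact Nat.mul_le_mul (hp t) (hr t)⟩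

theorem const (k : ℕ) : PolyN fun _ => k := ⟨Polynomial.C k, fun t => by simp⟩

theorem id : PolyN fun t => t := ⟨X, fun t => by simp⟩

theorem pow {f : ℕ → ℕ} (hf : PolyN f) (k : ℕ) : PolyN fun t => f t ^ k := by
  obtain ⟨p, hp⟩ := hf
  exact ⟨p ^ k, fun t => by rw [eval_pow]; exact Nat.pow_le_pow_left (hp t) k⟩

/-- A finite number of exceptions does not matter. -/
theorem of_eventually {f g : ℕ → ℕ} (hg : PolyN g) (h : ∀ᶠ t in atTop, f t ≤ g t) : PolyN f := by
  obtain ⟨N, hN⟩ := eventually_atTop.1 h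
  refine (hg.add (const (∑ i ∈ Finset.range N, f i))).mono fun t => ?_
  rcases le_or_gt N t with h1 | h1
  · exact (hN t h1).trans (Nat.le_add_right _ _)
  · exact (Finset.single_le_sum (f := f) (fun i _ => Nat.zero_le _)
      (Finset.mem_range.2 h1)).trans (Nat.le_add_left _ _)

theorem of_isBigO {f g : ℕ → ℕ} (hg : PolyN g)
    (h : (fun t => (f t : ℝ)) =O[atTop] fun t => (g t : ℝ)) : PolyN f := by
  obtain ⟨c, hc⟩ := h.bound
  refine of_eventually (hg.mul (const ⌈c⌉₊)) (hc.mono fun t ht => ?_)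
  simp only [Real.norm_natCast] at ht
  have h1 : (f t : ℝ) ≤ ((g t * ⌈c⌉₊ : ℕ) : ℝ) := by
    push_cast
    rw [mul_comm]
    exact ht.trans (mul_le_mul_of_nonneg_right (Nat.le_ceil c) (Nat.cast_nonneg _))
  exact_mod_cast h1

end PolyN

section Growth

variable {P : ℕ → Params}

theorem polyN_n (hn : (fun t => ((P t).n : ℝ)) =O[atTop] fun t : ℕ => (t : ℝ)) :
    PolyN fun t => (P t).n := PolyN.id.of_isBigO hn

theorem polyN_q (hn : (fun t => ((P t).n : ℝ)) =O[atTop] fun t : ℕ => (t : ℝ))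
    (hq : SoftO (fun t => ((P t).n : ℝ)) (fun t => ((P t).q : ℝ)) fun t => ((P t).n : ℝ) ^ 4) :
    PolyN fun t => (P t).q := by
  obtain ⟨k, hk⟩ := hq
  refine (((polyN_n hn).pow 4).mul ((polyN_n hn).pow k)).of_isBigO (hk.trans ?_)
  refine IsBigO.of_bound 1 (Eventually.of_forall fun t => ?_)
  have h1 : (1 : ℝ) ≤ (P t).n := by exact_mod_cast Params.one_le_n
  have h2 := Real.log_nonneg h1
  have h3 : Real.log (P t).n ≤ (P t).n := Real.log_le_self (by linarith)
  rw [one_mul]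
  push_cast
  rw [norm_mul, norm_mul, norm_pow, norm_pow, norm_pow, Real.norm_of_nonneg h2,
    Real.norm_of_nonneg (by linarith : (0 : ℝ) ≤ (P t).n)]
  gcongr

theorem natSize_le_self (n : ℕ) : n.size ≤ n := Nat.size_le.2 Nat.lt_two_pow_self

theorem Params.ell_le_size_q (P : Params) : P.ell ≤ P.q.size := by
  have h := size_eq_delta (b := P.half) (by have := P.three_le_q; show 1 ≤ (P.q - 1) / 2; omega)
  rw [Params.ell, ← h]
  exact Nat.size_le_size (by show (P.q - 1) / 2 ≤ _; omega)

theorem Params.dB_le_ell (P : Params) : P.dB ≤ P.ell := by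
  show delta P.B ≤ delta P.half
  exact Nat.succ_le_succ (Nat.log_mono_right P.B_le)

/-- `L = O(n² ℓ² δ_B)` with `δ_B ≤ ℓ = O(log q)`. -/
theorem Params.L_le (P : Params) : P.L ≤ 12 * P.n ^ 2 * P.q.size ^ 3 := by
  have h1 := P.ell_le_size_q
  have h2 := P.dB_le_ell.trans h1
  have h3 := Params.one_le_n (P := P)
  have h4 : 1 ≤ P.q.size := (Params.one_le_ell (P := P)).trans h1
  rw [Params.L]
  calc 9 * P.n ^ 2 * P.ell ^ 2 * P.dB + 3 * P.n * P.ell * P.dB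
      ≤ 9 * P.n ^ 2 * P.q.size ^ 2 * P.q.size + 3 * (P.n * P.n) * P.q.size * (P.q.size * P.q.size) := by
        have h5 : P.n * 1 ≤ P.n * P.n := by gcongr
        have h6 : P.dB * 1 ≤ P.q.size * P.q.size := by gcongr
        rw [mul_one] at h5 h6
        gcongr
    _ = _ := by ring

theorem polyN_L (hn : (fun t => ((P t).n : ℝ)) =O[atTop] fun t : ℕ => (t : ℝ))
    (hq : SoftO (fun t => ((P t).n : ℝ)) (fun t => ((P t).q : ℝ)) fun t => ((P t).n : ℝ) ^ 4) :
    PolyN fun t => (P t).L :=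
  ((PolyN.const 12).mul ((polyN_n hn).pow 2) |>.mul (((polyN_q hn hq).mono fun _ =>
    natSize_le_self _).pow 3)).mono fun t => (P t).L_le

theorem polyN_messages (hn : (fun t => ((P t).n : ℝ)) =O[atTop] fun t : ℕ => (t : ℝ))
    (hq : SoftO (fun t => ((P t).n : ℝ)) (fun t => ((P t).q : ℝ)) fun t => ((P t).n : ℝ) ^ 4) :
    PolyN fun t => 2188 * ((P t).L * (6 * (P t).q.size)) :=
  (PolyN.const _).mul ((polyN_L hn hq).mul ((PolyN.const _).mul ((polyN_q hn hq).mono fun _ =>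
    natSize_le_self _)))

end Growth

end

noncomputable section
open Val

/-! ### Hiding -/

/-- A commitment inside of a random experiment may be exchanged for a commitment to another message
of the same length, even if the rest of the outcome depends on the key, on that commitment and on
the randomness `b` from which the messages are computed. -/
theorem CommitmentScheme.statClose_of_hiding (C : CommitmentScheme) {t : ℕ} {ε : ℝ} {B β : Type}
    [Fintype B] [Nonempty B] {m₀ m₁ : B → Val}
    (h : ∀ b, StatClose (C.commitLaw t (m₀ b)) (C.commitLaw t (m₁ b)) ε)
    (G : Val → B → Val → β) :
    StatClose
      ((C.key t).bind fun pk => (PMF.uniformOfFintype (B × C.Coin t)).map fun b =>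
        G pk b.1 (C.com pk (m₀ b.1) (C.coin b.2)))
      ((C.key t).bind fun pk => (PMF.uniformOfFintype (B × C.Coin t)).map fun b =>
        G pk b.1 (C.com pk (m₁ b.1) (C.coin b.2))) ε := by
  have key : ∀ m : B → Val, ((C.key t).bind fun pk =>
      (PMF.uniformOfFintype (B × C.Coin t)).map fun b =>
        G pk b.1 (C.com pk (m b.1) (C.coin b.2))) =
      (PMF.uniformOfFintype B).bind fun b => (C.commitLaw t (m b)).map fun x => G x.1 b x.2 := by
    intro m
    simp only [CommitmentScheme.commitLaw, PMF.map_bind, PMF.map_comp]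
    rw [PMF.bind_comm]
    congr 1
    funext pk
    rw [PMF.uniformOfFintype_prod, PMF.map_bind]
    simp only [PMF.map_comp]
    rfl
  rw [key, key]
  exact StatClose.bind_right _ fun b => (h b).map _

namespace Stern

open Params

/-! ### The simulator -/

section Simulator

variable {C : CommitmentScheme} {t : ℕ} {P : Params}

/-- The commitment message of the simulator that expects the challenge `g`: the two commitments
that `g` opens are prepared so that they pass verification, the third one is arbitrary. -/
def simCmt (pk : Val) (c : P.Stmt) (s : Coins C t P) (g : Challenge) : Val :=
  let (η, r, ρ₁, ρ₂, ρ₃) := s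
  ![cmt (C.com pk (msg1 η (P.M.mulVec r)) (C.coin ρ₁)) (C.com pk (msg r) (C.coin ρ₂))
      (C.com pk (msg (red (ext η) + r)) (C.coin ρ₃)),
    cmt (C.com pk (msg1 η (P.M.mulVec r - target c)) (C.coin ρ₁)) (C.com pk (msg r) (C.coin ρ₂))
      (C.com pk (msg (Gam η r)) (C.coin ρ₃)),
    cmt (C.com pk (msg1 η (P.M.mulVec r)) (C.coin ρ₁)) (C.com pk (msg (Gam η r)) (C.coin ρ₂))
      (C.com pk (msg r) (C.coin ρ₃))] g

/-- The response that goes with `simCmt`. -/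
def simRsp (s : Coins C t P) (g : Challenge) : Val :=
  let (η, r, ρ₁, ρ₂, ρ₃) := s
  ![rspA C t (ext η) r ρ₂ ρ₃, rspB C t η r ρ₁ ρ₃, rspB C t η r ρ₁ ρ₂] g

/-- The transcript, if the challenge is `g` (or if there is none and `g = 0`). -/
def hitOr (g : Challenge) (o : Option Challenge) (m rsp : Val) : Val :=
  if o.getD 0 = g then .pair m (.pair (eReply o) (o.elim (num 0) fun _ => rsp)) else num 0

/-- One run of the simulator. -/
def trial (pk : Val) (c : P.Stmt) (V : Val → Option Challenge) : PMF Val :=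
  (PMF.uniformOfFintype (Fin 3)).bind fun g => (PMF.uniformOfFintype (Coins C t P)).map fun s =>
    hitOr g (V (simCmt pk c s g)) (simCmt pk c s g) (simRsp s g)

/-- The change of variables under which the simulator for the challenge `g` and the honest prover
with secret `ext l` differ in the unopened commitment only. -/
def reparam (l : P.Label) (g : Challenge) (x : P.Label × (P.Idx → P.Zq)) :
    P.Label × (P.Idx → P.Zq) :=
  ![(addLab l x.1, Gam x.1 x.2), (x.1, red (ext l) + x.2), x] g

theorem reparam_bijective (l : P.Label) (g : Challenge) : Function.Bijective (reparam l g) := by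
  refine Finite.injective_iff_bijective.1 ?_
  rintro ⟨η, r⟩ ⟨η', r'⟩ h
  fin_cases g
  · have h1 : addLab l η = addLab l η' := congr_arg Prod.fst h
    have h2 : Gam η r = Gam η' r' := congr_arg Prod.snd h
    have h3 : η = η' := by exact (addLabEquiv l).injective h1
    subst h3
    rw [Gam_injective η h2]
  · have h1 : η = η' := congr_arg Prod.fst h
    have h2 : red (ext l) + r = red (ext l) + r' := congr_arg Prod.snd h
    rw [h1, add_left_cancel h2]
  · exact h


/-- The comparison of simulator and prover, for any commitment scheme that hides the messages of
the protocol up to `ε`: after the change of variables `reparam`, one commitment is to be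
exchanged. -/
theorem statClose_hitOr {c : P.Stmt} {w : P.Witness} (hw : Rel c w) {ε : ℝ}
    (hε : ∀ m₀ m₁ : Val, m₀.size = m₁.size → m₀.size ≤ 2188 * (P.L * (6 * P.q.size)) →
      StatClose (C.commitLaw t m₀) (C.commitLaw t m₁) ε)
    (V : Val → Val → Option Challenge) (g : Challenge) :
    StatClose
      ((C.key t).bind fun pk => (PMF.uniformOfFintype (Coins C t P)).map fun s =>
        (pk, hitOr g (V pk (simCmt pk c s g)) (simCmt pk c s g) (simRsp s g)))
      ((C.key t).bind fun pk => (PMF.uniformOfFintype (Coins C t P)).map fun s =>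
        (pk, hitOr g (V pk (proverCmt pk (secret w) s)) (proverCmt pk (secret w) s)
          (proverRsp (secret w) s g))) ε := by
  have swap : ∀ (e : ((P.Label × (P.Idx → P.Zq)) × C.Coin t × C.Coin t) × C.Coin t ≃ Coins C t P)
      (m₀ m₁ : (P.Label × (P.Idx → P.Zq)) × C.Coin t × C.Coin t → Val)
      (G : Val → (P.Label × (P.Idx → P.Zq)) × C.Coin t × C.Coin t → Val → Val × Val)
      (S T : Val → Coins C t P → Val × Val),
      (∀ b, (m₀ b).size = (m₁ b).size ∧ (m₀ b).size ≤ 2188 * (P.L * (6 * P.q.size))) →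
      (∀ pk b ρ, G pk b (C.com pk (m₀ b) (C.coin ρ)) =
        S pk (e ((reparam (digits w) g b.1, b.2), ρ))) →
      (∀ pk b ρ, G pk b (C.com pk (m₁ b) (C.coin ρ)) = T pk (e (b, ρ))) →
      StatClose
        ((C.key t).bind fun pk => (PMF.uniformOfFintype (Coins C t P)).map (S pk))
        ((C.key t).bind fun pk => (PMF.uniformOfFintype (Coins C t P)).map (T pk)) ε := by
    intro e m₀ m₁ G S T hm hS hT
    have h := C.statClose_of_hiding (fun b => hε _ _ (hm b).1 (hm b).2) G
    have h1 : ∀ pk, ((PMF.uniformOfFintype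
        (((P.Label × (P.Idx → P.Zq)) × C.Coin t × C.Coin t) × C.Coin t)).map fun b =>
          G pk b.1 (C.com pk (m₀ b.1) (C.coin b.2))) =
        (PMF.uniformOfFintype (Coins C t P)).map (S pk) := fun pk =>
      PMF.map_uniformOfFintype_of_equiv ((((Equiv.ofBijective _
        (reparam_bijective (digits w) g)).prodCongr (.refl _)).prodCongr (.refl _)).trans e)
        fun b => hS pk b.1 b.2
    have h2 : ∀ pk, ((PMF.uniformOfFintype
        (((P.Label × (P.Idx → P.Zq)) × C.Coin t × C.Coin t) × C.Coin t)).map fun b =>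
          G pk b.1 (C.com pk (m₁ b.1) (C.coin b.2))) =
        (PMF.uniformOfFintype (Coins C t P)).map (T pk) := fun pk =>
      PMF.map_uniformOfFintype_of_equiv e fun b => hT pk b.1 b.2
    simpa only [h1, h2] using h
  have hM : P.M.mulVec (red (secret w)) = target c := (eq_iff_M_mulVec_secret c hw.1 hw.2.1).1 hw.2.2
  let out (pk : Val) (cm rsp : Val) : Val × Val := (pk, hitOr g (V pk cm) cm rsp)
  fin_cases g
  · refine swap
      ⟨fun x => (x.1.1.1, x.1.1.2, x.2, x.1.2.1, x.1.2.2),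
        fun s => (((s.1, s.2.1), s.2.2.2.1, s.2.2.2.2), s.2.2.1), fun _ => rfl, fun _ => rfl⟩
      (fun b => msg1 (addLab (digits w) b.1.1) (P.M.mulVec (Gam b.1.1 b.1.2)))
      (fun b => msg1 b.1.1 (P.M.mulVec b.1.2))
      (fun pk b C₁ => out pk (cmt C₁ (C.com pk (msg (Gam b.1.1 b.1.2)) (C.coin b.2.1))
        (C.com pk (msg (Gam b.1.1 (red (secret w) + b.1.2))) (C.coin b.2.2)))
        (rspA C t (Gam b.1.1 (secret w)) (Gam b.1.1 b.1.2) b.2.1 b.2.2)) _ _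
      (fun b => ⟨size_msg1_congr _ _ _ _, size_msg1_le _ _⟩) ?_ (fun _ _ _ => rfl)
    rintro pk ⟨⟨η, r⟩, ρ₂, ρ₃⟩ ρ
    simp only [secret_eq_ext, Gam_add, Gam_red, Gam_ext]
    rfl
  · refine swap
      ⟨fun x => (x.1.1.1, x.1.1.2, x.1.2.1, x.2, x.1.2.2),
        fun s => (((s.1, s.2.1), s.2.2.1, s.2.2.2.2), s.2.2.2.1), fun _ => rfl, fun _ => rfl⟩
      (fun b => msg (red (secret w) + b.1.2)) (fun b => msg (Gam b.1.1 b.1.2))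
      (fun pk b C₂ => out pk (cmt (C.com pk (msg1 b.1.1 (P.M.mulVec b.1.2)) (C.coin b.2.1)) C₂
        (C.com pk (msg (Gam b.1.1 (red (secret w) + b.1.2))) (C.coin b.2.2)))
        (rspB C t b.1.1 (red (secret w) + b.1.2) b.2.1 b.2.2)) _ _
      (fun b => ⟨size_eVec_congr _ _, size_eVec_le _⟩) ?_ (fun _ _ _ => rfl)
    rintro pk ⟨⟨η, r⟩, ρ₁, ρ₃⟩ ρ
    have h : P.M.mulVec r = P.M.mulVec (red (secret w) + r) - target c := by
      rw [Matrix.mulVec_add, hM, add_sub_cancel_left]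
    simp only [h]
    rfl
  · refine swap
      ⟨fun x => (x.1.1.1, x.1.1.2, x.1.2.1, x.1.2.2, x.2),
        fun s => (((s.1, s.2.1), s.2.2.1, s.2.2.2.1), s.2.2.2.2), fun _ => rfl, fun _ => rfl⟩
      (fun b => msg b.1.2) (fun b => msg (Gam b.1.1 (red (secret w) + b.1.2)))
      (fun pk b C₃ => out pk (cmt (C.com pk (msg1 b.1.1 (P.M.mulVec b.1.2)) (C.coin b.2.1))
        (C.com pk (msg (Gam b.1.1 b.1.2)) (C.coin b.2.2)) C₃)
        (rspB C t b.1.1 b.1.2 b.2.1 b.2.2)) _ _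
      (fun b => ⟨size_eVec_congr _ _, size_eVec_le _⟩) ?_ (fun _ _ _ => rfl)
    rintro pk ⟨⟨η, r⟩, ρ₁, ρ₂⟩ ρ
    rfl

/-- The transcript of the honest prover with a verifier that sends the challenge `V m`. -/
def honestView (pk : Val) (w : P.Witness) (V : Val → Option Challenge) : PMF Val :=
  (PMF.uniformOfFintype (Coins C t P)).map fun s =>
    .pair (proverCmt pk (secret w) s) (.pair (eReply (V (proverCmt pk (secret w) s)))
      ((V (proverCmt pk (secret w) s)).elim (num 0) (proverRsp (secret w) s)))

/-- The challenge in a transcript; a missing challenge counts as the first one. -/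
def challengeOf (v : Val) : Challenge := Fin.ofNat 3 (v.snd.fst.toNat - 1)

theorem challengeOf_eReply (m r : Val) (o : Option Challenge) :
    challengeOf (.pair m (.pair (eReply o) r)) = o.getD 0 := by
  cases o with
  | none => rfl
  | some ch => fin_cases ch <;> rfl

open Classical in
theorem statClose_trial {c : P.Stmt} {w : P.Witness} (hw : Rel c w) {ε : ℝ}
    (hε : ∀ m₀ m₁ : Val, m₀.size = m₁.size → m₀.size ≤ 2188 * (P.L * (6 * P.q.size)) →
      StatClose (C.commitLaw t m₀) (C.commitLaw t m₁) ε)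
    (V : Val → Val → Option Challenge) :
    StatClose
      ((C.key t).bind fun pk => (trial (C := C) (t := t) pk c (V pk)).map fun v => (pk, v))
      ((C.key t).bind fun pk => ((honestView (C := C) (t := t) pk w (V pk)).bind fun v =>
        (PMF.uniformOfFintype (Fin 3)).map fun g : Fin 3 =>
          if g = challengeOf v then v else num 0).map fun v => (pk, v)) ε := by
  have h := StatClose.bind_right (PMF.uniformOfFintype (Fin 3)) fun g =>
    statClose_hitOr (C := C) (t := t) hw hε V g
  rw [PMF.bind_comm, PMF.bind_comm (PMF.uniformOfFintype (Fin 3))] at h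
  convert h using 3 with pk pk
  · rw [trial, PMF.map_bind]
    simp only [PMF.map_comp]
    rfl
  · rw [honestView]
    simp only [PMF.map, PMF.bind_bind, PMF.pure_bind, Function.comp_def]
    rw [PMF.bind_comm]
    congr 1
    funext g
    congr 1
    funext s
    rw [challengeOf_eReply, hitOr]
    rcases V pk (proverCmt pk (secret w) s) with _ | ch
    · simp only [eq_comm]
      rfl
    · by_cases hg : ch = g
      · subst hg
        simp
      · simp [hg, Ne.symm hg]

theorem statClose_retry_trial {c : P.Stmt} {w : P.Witness} (hw : Rel c w) {ε : ℝ}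
    (hε : ∀ m₀ m₁ : Val, m₀.size = m₁.size → m₀.size ≤ 2188 * (P.L * (6 * P.q.size)) →
      StatClose (C.commitLaw t m₀) (C.commitLaw t m₁) ε)
    (V : Val → Val → Option Challenge) (n : ℕ) :
    StatClose (realView C t w V)
      ((C.key t).bind fun pk => (retry (trial (C := C) (t := t) pk c (V pk)) n).map
        fun v => (pk, v)) (n * ε + (2 / 3) ^ n) := by
  classical
  refine ((statClose_key_retry (statClose_trial hw hε V) n).trans ?_).symm
  have h : realView C t w V = (C.key t).bind fun pk =>
      (honestView (C := C) (t := t) pk w (V pk)).map fun v => (pk, v) := by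
    rw [realView]
    congr 1
    funext pk
    rw [honestView, PMF.map_comp]
    rfl
  rw [h]
  refine StatClose.bind_right _ fun pk => (statClose_retry (k := challengeOf) ?_ n).map _
  intro v hv
  rw [honestView, PMF.support_map] at hv
  obtain ⟨s, -, rfl⟩ := hv
  exact fun h => Val.noConfusion h

end Simulator

end Stern
end

noncomputable section
open Val

namespace Stern

open Params

/-! ### The simulator as a program -/

section SimulatorProgram

/-- `simCmt` on encodings. -/
def simCmtV (C : CommitmentScheme) (x R : Val) (g : ℕ) : Val :=
  if g = 0 then
    cmt (C.com (inK x) (.pair R.fst (mulMV x R.snd.fst)) R.snd.snd.fst)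
      (C.com (inK x) R.snd.fst R.snd.snd.snd.fst)
      (C.com (inK x) (addV x (redExtV x R.fst) R.snd.fst) R.snd.snd.snd.snd)
  else if g = 1 then
    cmt (C.com (inK x) (.pair R.fst (subR x (mulMV x R.snd.fst) (inC x))) R.snd.snd.fst)
      (C.com (inK x) R.snd.fst R.snd.snd.snd.fst)
      (C.com (inK x) (gamV x R.fst R.snd.fst) R.snd.snd.snd.snd)
  else
    cmt (C.com (inK x) (.pair R.fst (mulMV x R.snd.fst)) R.snd.snd.fst)
      (C.com (inK x) (gamV x R.fst R.snd.fst) R.snd.snd.snd.fst)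
      (C.com (inK x) R.snd.fst R.snd.snd.snd.snd)

/-- `simRsp` on encodings. -/
def simRspV (x R : Val) (g : ℕ) : Val :=
  if g = 0 then .pair (extV x R.fst) (.pair R.snd.fst
    (.pair R.snd.snd.snd.fst R.snd.snd.snd.snd))
  else if g = 1 then .pair R.fst (.pair R.snd.fst (.pair R.snd.snd.fst R.snd.snd.snd.snd))
  else .pair R.fst (.pair R.snd.fst (.pair R.snd.snd.fst R.snd.snd.snd.fst))

/-- `hitOr` on encodings; here `r` is the reply of the verifier. -/
def hitOrV (g : ℕ) (r m rsp : Val) : Val :=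
  if r.toNat - 1 = g then .pair m (.pair r (if r.toNat = 0 then num 0 else rsp)) else num 0

@[fun_prop]
theorem pF_simCmtV (C : CommitmentScheme) {x R : Val → Val} {g : Val → ℕ} (hx : PF x) (hR : PF R)
    (hg : PF g) : PF fun z => simCmtV C (x z) (R z) (g z) := by
  unfold simCmtV cmt; fun_prop

@[fun_prop]
theorem pF_simRspV {x R : Val → Val} {g : Val → ℕ} (hx : PF x) (hR : PF R)
    (hg : PF g) : PF fun z => simRspV (x z) (R z) (g z) := by
  unfold simRspV; fun_prop

@[fun_prop]
theorem pF_hitOrV {g : Val → ℕ} {r m rsp : Val → Val} (hg : PF g) (hr : PF r) (hm : PF m)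
    (hrsp : PF rsp) : PF fun z => hitOrV (g z) (r z) (m z) (rsp z) := by
  unfold hitOrV; fun_prop

/-- `trial` on encodings, with oracle access to the verifier. -/
def trialV (C : CommitmentScheme) (O : Val → Val) (x : Val) : PMF Val :=
  (randBelow 3).bind fun g => (randCoins x).map fun R =>
    hitOrV g.toNat (O (simCmtV C x R g.toNat)) (simCmtV C x R g.toNat) (simRspV x R g.toNat)

theorem feas_trialV (C : CommitmentScheme) : Feas (trialV C) := by
  have h1 : Feas fun _ x => (randBelow 3).bind fun g => (randCoins x).map fun R => .pair g R :=
    Feas.bind (f := fun _ _ => randBelow 3) (g := fun _ z => (randCoins z.fst).map fun R =>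
      .pair z.snd R) (Feas.randBelow (PF.const 3))
      ((Feas.comp feas_randCoins PF.id'.fst).map (g := fun y => .pair y.fst.snd y.snd)
        (by fun_prop))
  have h2 : Feas fun O z => (PMF.pure (O (simCmtV C z.fst z.snd.snd z.snd.fst.toNat))).map
      fun r => hitOrV z.snd.fst.toNat r (simCmtV C z.fst z.snd.snd z.snd.fst.toNat)
        (simRspV z.fst z.snd.snd z.snd.fst.toNat) :=
    (Feas.comp Feas.oracle (g := fun z => simCmtV C z.fst z.snd.snd z.snd.fst.toNat)
      (by fun_prop)).map (g := fun y => hitOrV y.fst.snd.fst.toNat y.snd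
        (simCmtV C y.fst.fst y.fst.snd.snd y.fst.snd.fst.toNat)
        (simRspV y.fst.fst y.fst.snd.snd y.fst.snd.fst.toNat)) (by fun_prop)
  have h3 := h1.bind h2
  simp only [PMF.pure_map, PMF.bind_bind, PMF.bind_map, fst_pair, snd_pair,
    Function.comp_def] at h3
  exact h3

variable {C : CommitmentScheme} {t : ℕ} {P : Params}

theorem simCmtV_eq (pk : Val) (c : P.Stmt) (s : Coins C t P) (g : Challenge) :
    simCmtV C (input C t pk c) (eCoins s) g = simCmt pk c s g := by
  have hx := reads_input C t pk c
  obtain ⟨η, r, ρ₁, ρ₂, ρ₃⟩ := s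
  have hC : inC (input C t pk c) = eRows (target c) := by
    simp only [inC, input, snd_pair, eStmt_eq]
  simp only [simCmtV, eCoins, fst_pair, snd_pair, mulMV_eq hx, gamV_eq hx, addV_eq hx,
    redExtV_eq hx, subR_eq hx, hC, decL_eLabel, decV_eVec, decR_eRows]
  fin_cases g <;> rfl

theorem simRspV_eq (pk : Val) (c : P.Stmt) (s : Coins C t P) (g : Challenge) :
    simRspV (input C t pk c) (eCoins s) g = simRsp s g := by
  have hx := reads_input C t pk c
  obtain ⟨η, r, ρ₁, ρ₂, ρ₃⟩ := s
  simp only [simRspV, eCoins, fst_pair, snd_pair, extV_eq hx, decL_eLabel]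
  fin_cases g <;> rfl

theorem hitOrV_eq (g : Challenge) (o : Option Challenge) (m rsp : Val) :
    hitOrV g (eReply o) m rsp = hitOr g o m rsp := by
  rw [hitOrV, hitOr]
  cases o with
  | none => fin_cases g <;> rfl
  | some ch => fin_cases ch <;> fin_cases g <;> rfl

theorem trialV_eq (pk : Val) (c : P.Stmt) (V : Val → Option Challenge) :
    trialV C (fun m => eReply (V m)) (input C t pk c) = trial (C := C) (t := t) pk c V := by
  rw [trialV, trial, randBelow_eq, PMF.bind_map, randCoins_eq]
  simp only [PMF.map_comp, Function.comp_def, toNat_num, simCmtV_eq, simRspV_eq, hitOrV_eq]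

open Classical in
/-- One pass of the loop: the state consists of the input and the outcome of the last run. -/
def retryStep (C : CommitmentScheme) (O : Val → Val) (s : Val) : PMF Val :=
  if s.snd = num 0 then (trialV C O s.fst).map (Val.pair s.fst) else PMF.pure s

theorem feas_retryStep (C : CommitmentScheme) : Feas (retryStep C) := by
  have h : PF fun s : Val => s.snd = num 0 := by fun_prop
  have h' := Feas.cond h ((Feas.comp (feas_trialV C) PF.id'.fst).map
    (g := fun y => .pair y.fst.fst y.snd) (by fun_prop)) (PF.id' : PF fun x : Val => x)
  convert h' using 3 with O s
  rw [PMF.pure_bind, retryStep]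
  by_cases hs : s.snd = num 0
  · rw [if_pos hs, if_neg]
    · rfl
    · simp [Coded.toVal, hs, isZero]
  · rw [if_neg hs, if_pos]
    · rfl
    · simp [Coded.toVal, hs, isZero]

open Classical in
theorem iterK_retryStep (C : CommitmentScheme) (O : Val → Val) (x : Val) (n : ℕ) (o : Val) :
    iterK (retryStep C O) n (.pair x o) =
      (if o = num 0 then retry (trialV C O x) n else PMF.pure o).map (Val.pair x) := by
  induction n generalizing o with
  | zero =>
    by_cases ho : o = num 0
    · rw [if_pos ho, ho]; simp [iterK, retry, PMF.pure_map]
    · rw [if_neg ho]; simp [iterK, PMF.pure_map]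
  | succ n ih =>
    rw [iterK_succ', retryStep]
    by_cases ho : o = num 0
    · rw [snd_pair, fst_pair, if_pos ho, if_pos ho, PMF.bind_map]
      simp only [Function.comp_def, ih, retry, PMF.map_bind]
    · rw [snd_pair, if_neg ho, if_neg ho, PMF.pure_bind, ih, if_neg ho]

theorem mem_support_retry {T : PMF Val} {n : ℕ} {v : Val} (h : v ∈ (retry T n).support) :
    v = num 0 ∨ v ∈ T.support := by
  induction n with
  | zero =>
    rw [retry, PMF.support_pure, Set.mem_singleton_iff] at h
    exact .inl h
  | succ n ih =>
    rw [retry, PMF.mem_support_bind_iff] at h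
    obtain ⟨o, ho, h⟩ := h
    split_ifs at h with h0
    · exact ih h
    · rw [PMF.support_pure, Set.mem_singleton_iff] at h
      exact .inr (h ▸ ho)

theorem feas_simulator (C : CommitmentScheme) : Feas fun O x => retry (trialV C O x) (inT x) := by
  have h : Feas fun O x => iterK (retryStep C O) (inT x) (.pair x (num 0)) := by
    refine Feas.loop (feas_retryStep C) polyBdd_inT (y := fun x => .pair x (num 0))
      (?_ : PF fun x => Val.pair (num (inT x)) (.pair x (num 0))) ?_
    · fun_prop
    · obtain ⟨p, hp⟩ := (feas_trialV C).size_le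
      refine ⟨X + p + 3, fun O hO x i _ v hv => ?_⟩
      rw [iterK_retryStep, if_pos rfl, PMF.support_map] at hv
      obtain ⟨o, ho, rfl⟩ := hv
      rw [size_pair]
      simp only [eval_add, eval_X, eval_ofNat]
      rcases mem_support_retry ho with rfl | ho
      · rw [size_num, Nat.size_zero]
        omega
      · have := hp O hO x o ho
        omega
  have h' := h.map (g := fun y => y.snd.snd) (by fun_prop)
  convert h' using 3 with O x
  rw [iterK_retryStep, if_pos rfl, PMF.map_comp]
  simp only [Function.comp_def, snd_pair]
  exact (PMF.map_id _).symm

end SimulatorProgram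

theorem smallOracle_eReply (V : Val → Option Challenge) : SmallOracle fun m => eReply (V m) := by
  intro m
  show (eReply (V m)).size ≤ 8
  rcases V m with _ | ch
  · decide
  · fin_cases ch <;> decide

theorem negligible_simulation {ε : ℕ → ℝ} (h : Negligible ε) :
    Negligible fun t => t * ε t + (2 / 3 : ℝ) ^ t := by
  refine (SuperpolynomialDecay.param_mul h).add fun k => ?_
  exact tendsto_pow_const_mul_const_pow_of_lt_one k (by norm_num) (by norm_num)

theorem statisticalZK {C : CommitmentScheme} {P : ℕ → Params} (hide : C.StatisticallyHiding)
    (hP : PolyN fun t => 2188 * ((P t).L * (6 * (P t).q.size))) : StatisticalZK C P := by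
  obtain ⟨S, p, hS⟩ := feas_simulator C
  obtain ⟨b, hb⟩ := hP
  obtain ⟨ε, hε, h⟩ := hide b
  refine ⟨S, ⟨p, fun V x => (hS _ (smallOracle_eReply V) x).2⟩, _, negligible_simulation hε,
    fun t c w hw V => ?_⟩
  have h1 := statClose_retry_trial (C := C) (t := t) hw
    (fun m₀ m₁ h₁ h₂ => h t m₀ m₁ h₁ (h₂.trans (hb t))) V t
  convert h1 using 1
  rw [simView]
  congr 1
  funext pk
  rw [(hS _ (smallOracle_eReply (V pk)) _).1]
  beta_reduce
  rw [trialV_eq]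
  congr 2
  exact unLen_unary t

end Stern
end

noncomputable section
open Val

namespace Stern

open Params

/-! ### The extractor -/

/-- The witness computed from the responses `r₁, r₂` to the first two challenges: undo the
permutation with the label in `r₂`, then recompose. -/
def extractV (x r₁ r₂ : Val) : Val := recomposeV x (subLV x (readLV x r₁.fst) r₂.fst)

/-- The two openings of the first commitment in the responses to the last two challenges. -/
def collision₁ (x r₂ r₃ : Val) : Val :=
  .pair (.pair (.pair r₂.fst (subR x (mulMV x r₂.snd.fst) (inC x))) r₂.snd.snd.fst)
    (.pair (.pair r₃.fst (mulMV x r₃.snd.fst)) r₃.snd.snd.fst)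

/-- The two openings of the second commitment in the responses to the first and last challenge. -/
def collision₂ (x r₁ r₃ : Val) : Val :=
  .pair (.pair r₁.snd.fst r₁.snd.snd.fst) (.pair (gamV x r₃.fst r₃.snd.fst) r₃.snd.snd.snd)

/-- The two openings of the third commitment in the responses to the first two challenges. -/
def collision₃ (x r₁ r₂ : Val) : Val :=
  .pair (.pair (addV x (redExtV x (readLV x r₁.fst)) r₁.snd.fst) r₁.snd.snd.snd)
    (.pair (gamV x r₂.fst r₂.snd.fst) r₂.snd.snd.snd)

@[fun_prop]
theorem pF_extractV {x r₁ r₂ : Val → Val} (hx : PF x) (h₁ : PF r₁) (h₂ : PF r₂) :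
    PF fun z => extractV (x z) (r₁ z) (r₂ z) := by
  unfold extractV; fun_prop

@[fun_prop]
theorem pF_collision₁ {x r₂ r₃ : Val → Val} (hx : PF x) (h₂ : PF r₂) (h₃ : PF r₃) :
    PF fun z => collision₁ (x z) (r₂ z) (r₃ z) := by
  unfold collision₁; fun_prop

@[fun_prop]
theorem pF_collision₂ {x r₁ r₃ : Val → Val} (hx : PF x) (h₁ : PF r₁) (h₃ : PF r₃) :
    PF fun z => collision₂ (x z) (r₁ z) (r₃ z) := by
  unfold collision₂; fun_prop

@[fun_prop]
theorem pF_collision₃ {x r₁ r₂ : Val → Val} (hx : PF x) (h₁ : PF r₁) (h₂ : PF r₂) :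
    PF fun z => collision₃ (x z) (r₁ z) (r₂ z) := by
  unfold collision₃; fun_prop

section Extraction

variable {C : CommitmentScheme} {t : ℕ} {P : Params}

theorem eLabel_injective : Function.Injective (eLabel (P := P)) :=
  Function.LeftInverse.injective decL_eLabel

theorem eVec_injective : Function.Injective (eVec (P := P)) :=
  Function.LeftInverse.injective decV_eVec

theorem eRows_injective : Function.Injective (eRows (P := P)) :=
  Function.LeftInverse.injective decR_eRows

/-- If the openings of all three commitments are consistent, then the unpermuted vector of the first
response solves the linear equation. -/
theorem mulVec_subLab {c : P.Stmt} {l η : P.Label} {tr w₂ w₃ : P.Idx → P.Zq}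
    (h₁ : P.M.mulVec w₂ - target c = P.M.mulVec w₃) (h₂ : tr = Gam η w₃)
    (h₃ : red (ext l) + tr = Gam η w₂) :
    P.M.mulVec (red (ext (subLab l η))) = target c := by
  have h : red (ext (subLab l η)) + w₃ = w₂ := by
    refine Gam_injective η ?_
    rw [Gam_add, Gam_red, Gam_ext, addLab_subLab, ← h₂, h₃]
  rw [← h, Matrix.mulVec_add] at h₁
  rw [← sub_eq_zero, ← sub_eq_zero.2 h₁]
  abel

/-- Three accepting transcripts with one commitment message yield a witness or a collision. -/
theorem extracted_or_collision {pk : Val} {c : P.Stmt} {m r₁ r₂ r₃ : Val}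
    (h₁ : Accept C t pk c m 0 r₁) (h₂ : Accept C t pk c m 1 r₂) (h₃ : Accept C t pk c m 2 r₃) :
    Extracted C t c r₁ r₂ (extractV (input C t pk c) r₁ r₂) ∨
      C.Collision t pk (collision₁ (input C t pk c) r₂ r₃) ∨
      C.Collision t pk (collision₂ (input C t pk c) r₁ r₃) ∨
      C.Collision t pk (collision₃ (input C t pk c) r₁ r₂) := by
  have hx := reads_input C t pk c
  have hC : inC (input C t pk c) = eRows (target c) := by
    simp only [inC, input, snd_pair, eStmt_eq]
  obtain ⟨C₁, C₂, C₃, rfl, tw, tr, ρ₂, ρ₃, rfl, htw, h12, h13⟩ := h₁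
  obtain ⟨D₁, D₂, D₃, hD, η, w₂, ρ₁, ρ₃', rfl, h21, h23⟩ := h₂
  obtain ⟨E₁, E₂, E₃, hE, ξ, w₃, ρ₁', ρ₂', rfl, h31, h32⟩ := h₃
  simp only [cmt, pair.injEq] at hD hE
  obtain ⟨rfl, rfl, rfl⟩ := hD
  obtain ⟨rfl, rfl, rfl⟩ := hE
  rw [VALID_eq_range] at htw
  obtain ⟨l, rfl⟩ := htw
  simp only [collision₁, collision₂, collision₃, extractV, rspA, rspB, fst_pair, snd_pair,
    mulMV_eq hx, subR_eq hx, gamV_eq hx, addV_eq hx, redExtV_eq hx, readLV_eq hx, subLV_eq hx,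
    recomposeV_eq hx, readL_eShort_ext, hC, decL_eLabel, decV_eVec, decR_eRows]
  by_cases e₁ : msg1 η (P.M.mulVec w₂ - target c) = msg1 ξ (P.M.mulVec w₃)
  swap
  · exact .inr (.inl ⟨_, _, ρ₁, ρ₁', rfl, e₁, h21.symm.trans h31⟩)
  by_cases e₂ : msg tr = msg (Gam ξ w₃)
  swap
  · exact .inr (.inr (.inl ⟨_, _, ρ₂, ρ₂', rfl, e₂, h12.symm.trans h32⟩))
  by_cases e₃ : msg (red (ext l) + tr) = msg (Gam η w₂)
  swap
  · exact .inr (.inr (.inr ⟨_, _, ρ₃, ρ₃', rfl, e₃, h13.symm.trans h23⟩))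
  left
  rw [msg1, msg1, pair.injEq] at e₁
  obtain rfl := eLabel_injective e₁.1
  have hM := mulVec_subLab (eRows_injective e₁.2) (eVec_injective e₂) (eVec_injective e₃)
  refine ⟨(subLab l η).1, (subLab l η).2.1, (subLab l η).2.2, recompose (subLab l η), tr, w₂, η,
    ρ₁, ρ₂, ρ₃, ρ₃', rfl, rel_recompose hM, hM, fun i => tau_ofTau _, tau_ofTau _, ?_, ?_, rfl⟩
  · funext x
    exact congrFun (tau_ofTau _) x.2
  · show _ = rspA C t (Gam η (ext (subLab l η))) tr ρ₂ ρ₃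
    rw [Gam_ext, addLab_subLab]
    rfl

end Extraction

/-! ### Reduction to the binding property -/

/-- The part of the public input that a collision finder gets as auxiliary string. -/
def advice (C : CommitmentScheme) (t : ℕ) {P : Params} (c : P.Stmt) : Val :=
  .pair (.unary P.n) (.pair (.num P.q) (.pair (.num P.B) (.pair (.unary (C.coinLen t)) (eStmt c))))

/-- The public input, reassembled from the input of a collision finder. -/
def inputOf (v : Val) : Val :=
  .pair v.fst (.pair v.snd.snd.fst.fst (.pair v.snd.snd.fst.snd.fst
    (.pair v.snd.snd.fst.snd.snd.fst (.pair v.snd.snd.fst.snd.snd.snd.fst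
      (.pair v.snd.fst v.snd.snd.fst.snd.snd.snd.snd)))))

theorem polyLength_advice {C : CommitmentScheme} {P : ℕ → Params} (hn : PolyN fun t => (P t).n)
    (hq : PolyN fun t => (P t).q) (hL : PolyN fun t => (P t).L) (hC : PolyN C.coinLen)
    (c : (t : ℕ) → (P t).Stmt) {z : ℕ → Val} (hz : PolyLength z) :
    PolyLength fun t => .pair (advice C t (c t)) (z t) := by
  have h1 : ∀ k, (unary k).size = 2 * k + 4 := fun k => by
    rw [unary, size_num, Nat.size_pow]; ring
  have h : PolyN fun t => (2 * (P t).n + 4 + (2 * (P t).q + 2) + (2 * (P t).q + 2) +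
      (2 * C.coinLen t + 4) + 9 * ((P t).L * (6 * (P t).q)) + 5) + (z t).size := by
    have hz : PolyN fun t => (z t).size := hz
    exact ((((((((PolyN.const 2).mul hn).add (.const 4)).add
      (((PolyN.const 2).mul hq).add (.const 2))).add
      (((PolyN.const 2).mul hq).add (.const 2))).add
      (((PolyN.const 2).mul hC).add (.const 4))).add
      ((PolyN.const 9).mul (hL.mul ((PolyN.const 6).mul hq)))).add (.const 5)).add hz
  refine h.mono fun t => ?_
  have h2 := natSize_le_self (P t).q
  have h3 : (P t).B.size ≤ (P t).q := (natSize_le_self _).trans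
    ((P t).B_le.trans ((Nat.div_le_self _ _).trans (Nat.sub_le _ _)))
  have h4 : (eStmt (c t)).size ≤ 9 * ((P t).L * (6 * (P t).q)) := by
    rw [eStmt_eq]
    exact (size_eRows_le _).trans (by gcongr)
  simp only [advice, size_pair, h1, size_num]
  omega

section Reduction

variable {C : CommitmentScheme} {P : ℕ → Params}

/-- A polynomial-time function `F` of the public input and of the output of a polynomial-time
algorithm is a collision with negligible probability only. -/
theorem negligible_collision (bind : C.ComputationallyBinding) {A : Prog} (hA : A.PolyTime)
    {c : (t : ℕ) → (P t).Stmt} {z : ℕ → Val}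
    (hz : PolyLength fun t => .pair (advice C t (c t)) (z t)) {F : Val → Val → Val}
    (hF : PF fun z => F (inputOf z.fst) z.snd) :
    Negligible fun t => prob ((C.key t).bind fun pk =>
      (A.out (.pair (input C t pk (c t)) (z t))).map fun y => (pk, y))
      {x | C.Collision t x.1 (F (input C t x.1 (c t)) x.2)} := by
  have h : Feas fun _ v => A.out (.pair (inputOf v) v.snd.snd.snd) :=
    (Feas.out hA).comp (g := fun v => .pair (inputOf v) v.snd.snd.snd) (by unfold inputOf; fun_prop)
  obtain ⟨D, hD, hout⟩ := (h.map hF).exists_prog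
  convert bind D hD _ hz using 2 with t
  have h1 : ∀ pk, inputOf (.pair (.unary t) (.pair pk (.pair (advice C t (c t)) (z t)))) =
      input C t pk (c t) := fun _ => rfl
  simp only [hout, fst_pair, snd_pair, h1]
  have h2 : ((C.key t).bind fun pk => ((A.out (.pair (input C t pk (c t)) (z t))).map fun v =>
      F (input C t pk (c t)) v).map fun v => (pk, v)) =
      ((C.key t).bind fun pk => (A.out (.pair (input C t pk (c t)) (z t))).map
        fun y => (pk, y)).map fun x => (x.1, F (input C t x.1 (c t)) x.2) := by
    simp only [PMF.map_bind, PMF.map_comp]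
    rfl
  rw [h2, prob_map]
  rfl

/-- The commitment message and the three responses in the output of an algorithm. -/
def transcripts (y : Val) : Val × Val × Val × Val :=
  (y.fst, y.snd.fst, y.snd.snd.fst, y.snd.snd.snd)

theorem negligible_extraction_failure (bind : C.ComputationallyBinding) {A : Prog}
    (hA : A.PolyTime) {c : (t : ℕ) → (P t).Stmt} {z : ℕ → Val}
    (hz : PolyLength fun t => .pair (advice C t (c t)) (z t)) :
    Negligible fun t => prob ((C.key t).bind fun pk =>
      (A.out (.pair (input C t pk (c t)) (z t))).map fun y => (pk, y))
      {x | (Accept C t x.1 (c t) (transcripts x.2).1 0 (transcripts x.2).2.1 ∧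
        Accept C t x.1 (c t) (transcripts x.2).1 1 (transcripts x.2).2.2.1 ∧
        Accept C t x.1 (c t) (transcripts x.2).1 2 (transcripts x.2).2.2.2) ∧
        ¬ Extracted C t (c t) (transcripts x.2).2.1 (transcripts x.2).2.2.1
          (extractV (input C t x.1 (c t)) (transcripts x.2).2.1 (transcripts x.2).2.2.1)} := by
  have h1 := negligible_collision bind hA hz
    (F := fun x y => collision₁ x y.snd.snd.fst y.snd.snd.snd) (by unfold inputOf; fun_prop)
  have h2 := negligible_collision bind hA hz
    (F := fun x y => collision₂ x y.snd.fst y.snd.snd.snd) (by unfold inputOf; fun_prop)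
  have h3 := negligible_collision bind hA hz
    (F := fun x y => collision₃ x y.snd.fst y.snd.snd.fst) (by unfold inputOf; fun_prop)
  refine SuperpolynomialDecay.trans_abs_le (h1.add (h2.add h3)) fun t => ?_
  simp only [Pi.add_apply]
  rw [abs_of_nonneg (prob_nonneg _ _)]
  refine le_trans ?_ (le_abs_self _)
  refine le_trans (prob_mono _ ?_) ((prob_union_le _ _ _).trans
    (add_le_add le_rfl (prob_union_le _ _ _)))
  rintro ⟨pk, y⟩ ⟨⟨ha, hb, hc⟩, he⟩
  exact (extracted_or_collision ha hb hc).resolve_left he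

end Reduction

end Stern
end

noncomputable section
open Val

/-! ### Soundness -/

section

variable {α β : Type}

theorem prob_empty (μ : PMF α) : prob μ ∅ = 0 := by simp [prob]

open Classical in
/-- If the probability of an event is `p` after a first outcome in `A` and `0` otherwise, then the
total probability is the product. -/
theorem prob_bind_eq_mul (μ : PMF α) {f : α → PMF β} {s : Set β} {A : Set α} {p : ℝ}
    (h : ∀ a, prob (f a) s = if a ∈ A then p else 0) : prob (μ.bind f) s = prob μ A * p := by
  rw [prob_bind, prob_eq_tsum, ← tsum_mul_right]
  refine tsum_congr fun a => ?_
  rw [h a]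
  split_ifs <;> ring

/-- Three independent events occur at the same time. -/
theorem prob_three (μ₁ μ₂ μ₃ : PMF α) (A₁ A₂ A₃ : Set α) :
    prob (μ₁.bind fun a => μ₂.bind fun b => μ₃.map fun c => (a, b, c))
      {x | x.1 ∈ A₁ ∧ x.2.1 ∈ A₂ ∧ x.2.2 ∈ A₃} = prob μ₁ A₁ * (prob μ₂ A₂ * prob μ₃ A₃) := by
  classical
  refine prob_bind_eq_mul μ₁ fun a => ?_
  by_cases ha : a ∈ A₁
  · rw [if_pos ha]
    refine prob_bind_eq_mul μ₂ fun b => ?_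
    rw [prob_map]
    by_cases hb : b ∈ A₂
    · rw [if_pos hb]
      congr 1
      ext c
      simp [ha, hb]
    · rw [if_neg hb]
      convert prob_empty μ₃ using 2
      ext c
      simp [hb]
  · rw [if_neg ha]
    have : ∀ μ : PMF (α × α × α), (∀ x ∈ μ.support, x.1 = a) →
        prob μ {x | x.1 ∈ A₁ ∧ x.2.1 ∈ A₂ ∧ x.2.2 ∈ A₃} = 0 := by
      intro μ hμ
      rw [prob, (PMF.toOuterMeasure_apply_eq_zero_iff _ _).2, ENNReal.toReal_zero]
      rw [Set.disjoint_left]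
      intro x hx h
      exact ha (hμ x hx ▸ h.1)
    refine this _ fun x hx => ?_
    simp only [PMF.mem_support_bind_iff, PMF.support_map, Set.mem_image] at hx
    obtain ⟨b, -, c, -, rfl⟩ := hx
    rfl

end

namespace Stern

open Params

section Soundness

variable {C : CommitmentScheme} {t : ℕ} {P : Params}

/-- Both programs of a prover, with three runs of the second one from the same state. -/
def rewound (P₁ P₂ : Prog) (x : Val) : PMF Val :=
  (P₁.out x).bind fun y => rpair (PMF.pure y.fst) (rpair (P₂.out (.pair y.snd (eChallenge 0)))
    (rpair (P₂.out (.pair y.snd (eChallenge 1))) (P₂.out (.pair y.snd (eChallenge 2)))))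

theorem feas_rewound {P₁ P₂ : Prog} (h₁ : P₁.PolyTime) (h₂ : P₂.PolyTime) :
    Feas fun _ x => rewound P₁ P₂ x := by
  have h : ∀ ch, Feas fun _ y => P₂.out (.pair y.snd (eChallenge ch)) := fun ch =>
    (Feas.out h₂).comp (g := fun y => .pair y.snd (eChallenge ch)) (by fun_prop)
  exact Feas.bind_comp (Feas.out h₁) (.rpair (PF.id'.fst : PF fun y : Val => y.fst)
    (.rpair (h 0) (.rpair (h 1) (h 2))))

theorem map_transcripts_rewound (P₁ P₂ : Prog) (x : Val) :
    (rewound P₁ P₂ x).map transcripts = runRewound P₁ P₂ x := by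
  simp only [rewound, runRewound, rpair, PMF.map, PMF.pure_bind, PMF.bind_bind, Function.comp_def,
    transcripts, fst_pair, snd_pair]

/-- At most two of the three challenges are answered, unless all of them are. -/
theorem prob_accept_le (pk : Val) (c : P.Stmt) (P₁ P₂ : Prog) (x : Val) :
    prob ((PMF.uniformOfFintype Challenge).bind fun ch =>
        (runProver P₁ P₂ x ch).map fun y => (ch, y))
      {y | Accept C t pk c y.2.1 y.1 y.2.2} ≤
    2 / 3 + 1 / 3 * prob (runRewound P₁ P₂ x)
      {y | Accept C t pk c y.1 0 y.2.1 ∧ Accept C t pk c y.1 1 y.2.2.1 ∧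
        Accept C t pk c y.1 2 y.2.2.2} := by
  let a (y : Val) (ch : Challenge) : ℝ :=
    prob (P₂.out (.pair y.snd (eChallenge ch))) {r | Accept C t pk c y.fst ch r}
  have h0 : ∀ y ch, 0 ≤ a y ch := fun y ch => prob_nonneg _ _
  have h1 : ∀ y ch, a y ch ≤ 1 := fun y ch => prob_le_one _ _
  have hl : ((PMF.uniformOfFintype Challenge).bind fun ch =>
        (runProver P₁ P₂ x ch).map fun y => (ch, y)) =
      (P₁.out x).bind fun y => (PMF.uniformOfFintype Challenge).bind fun ch =>
        (P₂.out (.pair y.snd (eChallenge ch))).map fun r => (ch, y.fst, r) := by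
    simp only [runProver, PMF.map_bind, PMF.map_comp]
    rw [PMF.bind_comm]
    rfl
  have hr : prob (runRewound P₁ P₂ x)
      {y | Accept C t pk c y.1 0 y.2.1 ∧ Accept C t pk c y.1 1 y.2.2.1 ∧
        Accept C t pk c y.1 2 y.2.2.2} =
      ∑' y, (P₁.out x y).toReal * (a y 0 * (a y 1 * a y 2)) := by
    rw [runRewound, prob_bind]
    refine tsum_congr fun y => ?_
    congr 1
    rw [← prob_three]
    have : ((P₂.out (.pair y.snd (eChallenge 0))).bind fun r₁ =>
        (P₂.out (.pair y.snd (eChallenge 1))).bind fun r₂ =>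
          (P₂.out (.pair y.snd (eChallenge 2))).map fun r₃ => (y.fst, r₁, r₂, r₃)) =
        ((P₂.out (.pair y.snd (eChallenge 0))).bind fun r₁ =>
          (P₂.out (.pair y.snd (eChallenge 1))).bind fun r₂ =>
            (P₂.out (.pair y.snd (eChallenge 2))).map fun r₃ => (r₁, r₂, r₃)).map
          (Prod.mk y.fst) := by
      simp only [PMF.map_bind, PMF.map_comp]
      rfl
    rw [this, prob_map]
    rfl
  have hp0 : ∀ y, 0 ≤ a y 0 * (a y 1 * a y 2) := fun y =>
    mul_nonneg (h0 y 0) (mul_nonneg (h0 y 1) (h0 y 2))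
  have hp1 : ∀ y, a y 0 * (a y 1 * a y 2) ≤ 1 := fun y =>
    mul_le_one₀ (h1 y 0) (mul_nonneg (h0 y 1) (h0 y 2))
      (mul_le_one₀ (h1 y 1) (h0 y 2) (h1 y 2))
  rw [hl, hr]
  refine (prob_bind_congr_le (P₁.out x) (g := fun y => 2 / 3 + 1 / 3 * (a y 0 * (a y 1 * a y 2)))
    (fun y => ?_) (fun y => ?_) fun y => ?_).trans (le_of_eq ?_)
  · linarith [hp0 y]
  · linarith [hp1 y]
  · rw [prob_uniform_bind, Fin.sum_univ_three, Fintype.card_fin]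
    simp only [prob_map]
    show (a y 0 + a y 1 + a y 2) / ((3 : ℕ) : ℝ) ≤ _
    have e1 := mul_nonneg (sub_nonneg.2 (h1 y 1)) (sub_nonneg.2 (h1 y 2))
    have e2 := mul_nonneg (sub_nonneg.2 (h1 y 0))
      (sub_nonneg.2 (mul_le_one₀ (h1 y 1) (h0 y 2) (h1 y 2)))
    -- for `0 ≤ x, y, z ≤ 1` one has `x + y + z ≤ 2 + x * y * z`
    push_cast
    nlinarith
  · have hs := (P₁.out x).sum_toReal
    have hs' := (P₁.out x).summable_mul hp0 hp1
    have e : ∀ y, (P₁.out x y).toReal * (2 / 3 + 1 / 3 * (a y 0 * (a y 1 * a y 2))) =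
        (P₁.out x y).toReal * (2 / 3) +
          1 / 3 * ((P₁.out x y).toReal * (a y 0 * (a y 1 * a y 2))) := fun y => by ring
    simp only [e]
    rw [(hs.mul_right _).summable.tsum_add (hs'.mul_left _), tsum_mul_left,
      (hs.mul_right _).tsum_eq, one_mul]

/-- Averaging over the key. -/
theorem prob_key_accept_le (K : PMF Val) (c : P.Stmt) (P₁ P₂ : Prog) (x : Val → Val) :
    prob (K.bind fun pk => (PMF.uniformOfFintype Challenge).bind fun ch =>
        (runProver P₁ P₂ (x pk) ch).map fun y => (pk, ch, y))
      {y | Accept C t y.1 c y.2.2.1 y.2.1 y.2.2.2} ≤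
    2 / 3 + 1 / 3 * prob (K.bind fun pk => (rewound P₁ P₂ (x pk)).map fun y => (pk, y))
      {y | Accept C t y.1 c (transcripts y.2).1 0 (transcripts y.2).2.1 ∧
        Accept C t y.1 c (transcripts y.2).1 1 (transcripts y.2).2.2.1 ∧
        Accept C t y.1 c (transcripts y.2).1 2 (transcripts y.2).2.2.2} := by
  let p (pk : Val) : ℝ := prob (runRewound P₁ P₂ (x pk))
      {y | Accept C t pk c y.1 0 y.2.1 ∧ Accept C t pk c y.1 1 y.2.2.1 ∧
        Accept C t pk c y.1 2 y.2.2.2}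
  have h0 : ∀ pk, 0 ≤ p pk := fun pk => prob_nonneg _ _
  have h1 : ∀ pk, p pk ≤ 1 := fun pk => prob_le_one _ _
  have hr : prob (K.bind fun pk => (rewound P₁ P₂ (x pk)).map fun y => (pk, y))
      {y | Accept C t y.1 c (transcripts y.2).1 0 (transcripts y.2).2.1 ∧
        Accept C t y.1 c (transcripts y.2).1 1 (transcripts y.2).2.2.1 ∧
        Accept C t y.1 c (transcripts y.2).1 2 (transcripts y.2).2.2.2} =
      ∑' pk, (K pk).toReal * p pk := by
    rw [prob_bind]
    refine tsum_congr fun pk => ?_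
    rw [prob_map]
    show _ = _ * prob (runRewound P₁ P₂ (x pk)) _
    rw [← map_transcripts_rewound, prob_map]
    rfl
  rw [hr]
  refine (prob_bind_congr_le K (g := fun pk => 2 / 3 + 1 / 3 * p pk)
    (fun pk => ?_) (fun pk => ?_) fun pk => ?_).trans (le_of_eq ?_)
  · linarith [h0 pk]
  · linarith [h1 pk]
  · refine le_trans (le_of_eq ?_) (prob_accept_le (C := C) (t := t) pk c P₁ P₂ (x pk))
    have : ((PMF.uniformOfFintype Challenge).bind fun ch =>
          (runProver P₁ P₂ (x pk) ch).map fun y => (pk, ch, y)) =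
        ((PMF.uniformOfFintype Challenge).bind fun ch =>
          (runProver P₁ P₂ (x pk) ch).map fun y => (ch, y)).map (Prod.mk pk) := by
      simp only [PMF.map_bind, PMF.map_comp]
      rfl
    rw [this, prob_map]
    rfl
  · have hs := K.sum_toReal
    have hs' := K.summable_mul h0 h1
    have e : ∀ pk, (K pk).toReal * (2 / 3 + 1 / 3 * p pk) =
        (K pk).toReal * (2 / 3) + 1 / 3 * ((K pk).toReal * p pk) := fun pk => by ring
    simp only [e]
    rw [(hs.mul_right _).summable.tsum_add (hs'.mul_left _), tsum_mul_left,
      (hs.mul_right _).tsum_eq, one_mul]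

end Soundness

theorem argumentOfKnowledge {C : CommitmentScheme} (bind : C.ComputationallyBinding)
    {P : ℕ → Params} (hP : ∀ (c : (t : ℕ) → (P t).Stmt) (z : ℕ → Val), PolyLength z →
      PolyLength fun t => .pair (advice C t (c t)) (z t)) : ArgumentOfKnowledge C P := by
  have hE : PF fun v => extractV v.fst v.snd.snd.fst v.snd.snd.snd.fst := by fun_prop
  obtain ⟨E, hE, hout⟩ := Feas.exists_prog hE
  have hrun : ∀ (t : ℕ) (pk : Val) (c : (P t).Stmt) (y : Val × Val × Val × Val),
      runExtractor C t E pk c y = PMF.pure (y, extractV (input C t pk c) y.2.1 y.2.2.1) := by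
    intro t pk c y
    rw [runExtractor, hout, toVal_val, PMF.pure_map]
    rfl
  refine ⟨E, hE, fun c z hz => ⟨fun A hA => ?_, fun P₁ P₂ h₁ h₂ => ?_⟩⟩
  · convert negligible_extraction_failure bind hA (hP c z hz) using 2 with t
    simp only [hrun, PMF.pure_map]
    have h : ((C.key t).bind fun pk => (A.out (.pair (input C t pk (c t)) (z t))).bind fun y =>
        PMF.pure (pk, ((y.fst, y.snd.fst, y.snd.snd.fst, y.snd.snd.snd),
          extractV (input C t pk (c t)) y.snd.fst y.snd.snd.fst))) =
        ((C.key t).bind fun pk => (A.out (.pair (input C t pk (c t)) (z t))).map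
          fun y => (pk, y)).map fun x => (x.1, transcripts x.2,
            extractV (input C t x.1 (c t)) (transcripts x.2).2.1 (transcripts x.2).2.2.1) := by
      simp only [PMF.map_bind, PMF.map_comp]
      rfl
    rw [h, prob_map]
    congr 1
    ext x
    simp only [Set.mem_preimage, Set.mem_ofPred_eq, and_assoc]
  · obtain ⟨A, hA, hAout⟩ := (feas_rewound h₁ h₂).exists_prog
    have hfail := negligible_extraction_failure bind hA (hP c z hz)
    refine ⟨_, SuperpolynomialDecay.const_mul hfail (1 / 3), fun t => ?_⟩
    refine (prob_key_accept_le (C := C) (t := t) (C.key t) (c t) P₁ P₂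
      fun pk => .pair (input C t pk (c t)) (z t)).trans ?_
    simp only [hAout]
    rw [add_assoc, ← mul_add]
    gcongr
    have h : ((C.key t).bind fun pk =>
        (runRewound P₁ P₂ (.pair (input C t pk (c t)) (z t))).bind fun y =>
          runExtractor C t E pk (c t) y) =
        ((C.key t).bind fun pk => (rewound P₁ P₂ (.pair (input C t pk (c t)) (z t))).map
          fun y => (pk, y)).map fun x => (transcripts x.2,
            extractV (input C t x.1 (c t)) (transcripts x.2).2.1 (transcripts x.2).2.2.1) := by
      simp only [← map_transcripts_rewound, hrun, PMF.bind_map, PMF.map_bind, PMF.map_comp]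
      rfl
    rw [h, prob_map]
    refine (prob_mono _ ?_).trans (prob_union_le _ _ _)
    intro x hx
    by_cases he : Extracted C t (c t) (transcripts x.2).2.1 (transcripts x.2).2.2.1
        (extractV (input C t x.1 (c t)) (transcripts x.2).2.1 (transcripts x.2).2.2.1)
    · exact .inl he
    · exact .inr ⟨hx, he⟩

end Stern
end

noncomputable section
open Val

namespace Stern

open Params

theorem perfectlyComplete (C : CommitmentScheme) (P : ℕ → Params) : PerfectlyComplete C P := by
  intro t c w hw
  rw [prob, (PMF.toOuterMeasure_apply_eq_one_iff _ _).2, ENNReal.toReal_one]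
  intro x hx
  simp only [honest, PMF.mem_support_bind_iff, PMF.support_map, Set.mem_image] at hx
  obtain ⟨pk, -, ch, -, -, ⟨s, -, rfl⟩, rfl⟩ := hx
  exact accept_honest hw pk s ch

end Stern

/-! ### Communication cost -/

namespace Params

variable {P : Params}

theorem one_le_log_q : 1 ≤ Real.log P.q := by
  have h : (3 : ℝ) ≤ P.q := by exact_mod_cast P.three_le_q
  rw [Real.le_log_iff_exp_le (by linarith)]
  linarith [Real.exp_one_lt_d9]

theorem size_q_le : (P.q.size : ℝ) ≤ 3 * Real.log P.q := by
  have h1 := one_le_log_q (P := P)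
  have h2 : 1 ≤ P.q.size := one_le_ell.trans P.ell_le_size_q
  have h3 : ((2 : ℝ) ^ (P.q.size - 1)) ≤ P.q := by
    exact_mod_cast Nat.lt_size.1 (by omega : P.q.size - 1 < P.q.size)
  have h4 := Real.log_le_log (by positivity) h3
  rw [Real.log_pow, Nat.cast_sub h2, Nat.cast_one] at h4
  have h5 := Real.log_two_gt_d9
  nlinarith [(by exact_mod_cast h2 : (1 : ℝ) ≤ P.q.size)]

theorem one_le_L_mul_log : 1 ≤ (P.L : ℝ) * Real.log P.q := by
  have h1 := one_le_log_q (P := P)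
  have h2 : (1 : ℝ) ≤ P.L := by exact_mod_cast one_le_L
  nlinarith

theorem L_le_L_mul_log : (P.L : ℝ) ≤ P.L * Real.log P.q :=
  le_mul_of_one_le_right (Nat.cast_nonneg _) one_le_log_q

/-- The length of the longest message, in terms of `L · log q`. -/
theorem message_le : ((2188 * (P.L * (6 * P.q.size)) : ℕ) : ℝ) ≤
    39384 * (P.L * Real.log P.q) := by
  have h1 := size_q_le (P := P)
  have h2 : (0 : ℝ) ≤ P.L := Nat.cast_nonneg _
  push_cast
  nlinarith [mul_le_mul_of_nonneg_left h1 h2]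

theorem L_mul_log_le : (P.L : ℝ) * Real.log P.q ≤ 324 * ((P.n : ℝ) ^ 2 * Real.log P.q ^ 4) := by
  have h1 : (P.L : ℝ) ≤ 12 * (P.n : ℝ) ^ 2 * (P.q.size : ℝ) ^ 3 := by exact_mod_cast P.L_le
  have h2 := one_le_log_q (P := P)
  calc (P.L : ℝ) * Real.log P.q
      ≤ (12 * (P.n : ℝ) ^ 2 * (3 * Real.log P.q) ^ 3) * Real.log P.q := by
        gcongr
        exact h1.trans (by gcongr; exact size_q_le)
    _ = _ := by ring

end Params

namespace Stern

open Params

section Communication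

variable {C : CommitmentScheme} {t : ℕ} {P : Params}

theorem size_proverRsp_le (w : P.Witness) (s : Coins C t P) (ch : Challenge) :
    (proverRsp (secret w) s ch).size ≤
      17504 * P.L + 2188 * (P.L * (6 * P.q.size)) + 4 * C.coinLen t + 11 := by
  obtain ⟨η, r, ρ₁, ρ₂, ρ₃⟩ := s
  have h1 := size_eShort_le _ ((mem_VALID_iff_Gam η _).1 (secret_mem_VALID w))
  have h2 := size_eLabel_le η
  have h3 : ∀ ρ : C.Coin t, (C.coin ρ).size = 2 * C.coinLen t + 4 := C.size_coin
  have hA : (rspA C t (Gam η (secret w)) (Gam η r) ρ₂ ρ₃).size ≤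
      17504 * P.L + 2188 * (P.L * (6 * P.q.size)) + 4 * C.coinLen t + 11 := by
    have h4 := size_eVec_le (Gam η r)
    simp only [rspA, size_pair, h3]
    omega
  have hB : ∀ v ρ ρ', (rspB C t η v ρ ρ').size ≤
      17504 * P.L + 2188 * (P.L * (6 * P.q.size)) + 4 * C.coinLen t + 11 := by
    intro v ρ ρ'
    have h4 := size_eVec_le v
    simp only [rspB, size_pair, h3]
    omega
  fin_cases ch
  · exact hA
  · exact hB _ _ _
  · exact hB _ _ _

theorem size_eChallenge_le (ch : Challenge) : (eChallenge ch).size ≤ 6 := by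
  fin_cases ch <;> decide

/-- The number of bits exchanged, given that commitments and coins are not much longer than `m` and
`L · log q`. -/
theorem size_transcript_le {K : ℝ} (hK : 0 ≤ K)
    (hcoin : (C.coinLen t : ℝ) ≤ K * (P.L * Real.log P.q)) {pk : Val}
    (hcom : ∀ (m : Val) (ρ : C.Coin t),
      ((C.com pk m (C.coin ρ)).size : ℝ) ≤ K * (m.size + P.L * Real.log P.q))
    (w : P.Witness) (s : Coins C t P) (ch : Challenge) :
    (((proverCmt pk (secret w) s).size + (eChallenge ch).size +
      (proverRsp (secret w) s ch).size : ℕ) : ℝ) ≤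
      (118159 * K + 56907) * (P.L * Real.log P.q) := by
  have hX := one_le_L_mul_log (P := P)
  have hL := L_le_L_mul_log (P := P)
  have hM := message_le (P := P)
  have h1 : ∀ (m : Val) (ρ : C.Coin t), m.size ≤ 2188 * (P.L * (6 * P.q.size)) →
      ((C.com pk m (C.coin ρ)).size : ℝ) ≤ K * (39385 * (P.L * Real.log P.q)) := by
    intro m ρ hm
    refine (hcom m ρ).trans (mul_le_mul_of_nonneg_left ?_ hK)
    have : (m.size : ℝ) ≤ _ := (Nat.cast_le.2 hm).trans hM
    linarith
  have h2 : ((eChallenge ch).size : ℝ) ≤ 6 := by exact_mod_cast size_eChallenge_le ch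
  have h3 : ((proverRsp (secret w) s ch).size : ℝ) ≤
      17504 * P.L + ((2188 * (P.L * (6 * P.q.size)) : ℕ) : ℝ) + 4 * C.coinLen t + 11 := by
    exact_mod_cast size_proverRsp_le w s ch
  obtain ⟨η, r, ρ₁, ρ₂, ρ₃⟩ := s
  have h4 := h1 (msg1 η (P.M.mulVec r)) ρ₁ (size_msg1_le _ _)
  have h5 := h1 (msg (Gam η r)) ρ₂ (size_eVec_le _)
  have h6 := h1 (msg (Gam η (red (secret w) + r))) ρ₃ (size_eVec_le _)
  have h7 : ((proverCmt pk (secret w) (η, r, ρ₁, ρ₂, ρ₃)).size : ℝ) ≤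
      3 * (K * (39385 * (P.L * Real.log P.q))) + 2 := by
    rw [proverCmt]
    simp only [cmt, size_pair]
    push_cast
    linarith
  push_cast at h3 hM ⊢
  linarith

end Communication

section Asymptotic

variable {P : ℕ → Params}

theorem two_le_n_real (t : ℕ) : (2 : ℝ) ≤ (P t).n := by exact_mod_cast (P t).two_le_n

theorem log_q_isBigO
    (hq : SoftO (fun t => ((P t).n : ℝ)) (fun t => ((P t).q : ℝ)) fun t => ((P t).n : ℝ) ^ 4) :
    (fun t => Real.log (P t).q) =O[atTop] fun t => Real.log (P t).n := by
  obtain ⟨k, hk⟩ := hq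
  obtain ⟨c, hc1, hc⟩ := hk.exists_pos
  refine IsBigO.of_bound (Real.log (max c 1) / Real.log 2 + (4 + k)) (hc.bound.mono fun t ht => ?_)
  have h1 := two_le_n_real (P := P) t
  have h2 : 0 < Real.log 2 := Real.log_pos (by norm_num)
  have h3 : Real.log 2 ≤ Real.log (P t).n := Real.log_le_log (by norm_num) h1
  have h4 : Real.log (P t).n ≤ (P t).n := Real.log_le_self (by linarith)
  have h5 := one_le_log_q (P := P t)
  have h6 : 0 ≤ Real.log (max c 1) := Real.log_nonneg (le_max_right _ _)
  have h7 : ((P t).q : ℝ) ≤ max c 1 * ((P t).n : ℝ) ^ (4 + k) := by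
    rw [norm_mul, norm_pow, norm_pow, Real.norm_natCast, Real.norm_natCast,
      Real.norm_of_nonneg (h2.le.trans h3)] at ht
    refine ht.trans ?_
    rw [pow_add]
    gcongr
    exact le_max_left _ _
  have h8 := Real.log_le_log (Nat.cast_pos.2 (NeZero.pos (P t).q)) h7
  rw [Real.log_mul (by positivity) (by positivity), Real.log_pow] at h8
  rw [Real.norm_of_nonneg (by linarith), Real.norm_of_nonneg (h2.le.trans h3)]
  have h9 : Real.log (max c 1) ≤ Real.log (max c 1) / Real.log 2 * Real.log (P t).n := by
    rw [div_mul_eq_mul_div, le_div_iff₀ h2]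
    gcongr
  push_cast at h8
  linarith

theorem log_n_isBigO (hn : (fun t => ((P t).n : ℝ)) =O[atTop] fun t : ℕ => (t : ℝ)) :
    (fun t => Real.log (P t).n) =O[atTop] fun t : ℕ => Real.log t := by
  obtain ⟨c, hc1, hc⟩ := hn.exists_pos
  refine IsBigO.of_bound (Real.log (max c 1) + 1)
    ((hc.bound.and (eventually_ge_atTop 3)).mono fun t ht => ?_)
  have h1 := two_le_n_real (P := P) t
  have h2 : (3 : ℝ) ≤ t := by exact_mod_cast ht.2
  have h3 : 1 ≤ Real.log t := by
    rw [Real.le_log_iff_exp_le (by linarith)]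
    linarith [Real.exp_one_lt_d9]
  have h4 : ((P t).n : ℝ) ≤ max c 1 * t := by
    have h := ht.1
    rw [Real.norm_natCast, Real.norm_natCast] at h
    exact h.trans (by gcongr; exact le_max_left _ _)
  have h5 := Real.log_le_log (by linarith) h4
  rw [Real.log_mul (by positivity) (by positivity)] at h5
  have h6 : 0 ≤ Real.log (max c 1) := Real.log_nonneg (le_max_right _ _)
  rw [Real.norm_of_nonneg (Real.log_nonneg (by linarith)), Real.norm_of_nonneg (by linarith)]
  nlinarith

theorem polyN_coinLen {C : CommitmentScheme} {K : ℝ} (hL : PolyN fun t => (P t).L)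
    (hq : PolyN fun t => (P t).q)
    (h : ∀ᶠ t in atTop, (C.coinLen t : ℝ) ≤ K * ((P t).L * Real.log (P t).q)) :
    PolyN C.coinLen := by
  refine (hL.mul hq).of_isBigO (IsBigO.of_bound |K| (h.mono fun t ht => ?_))
  have h1 := one_le_L_mul_log (P := P t)
  rw [Real.norm_natCast, Real.norm_natCast]
  push_cast
  refine ht.trans ?_
  calc K * ((P t).L * Real.log (P t).q) ≤ |K| * ((P t).L * Real.log (P t).q) := by
        gcongr; exact le_abs_self K
    _ ≤ _ := by gcongr; exact Real.log_le_self (Nat.cast_nonneg _)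

theorem exists_communicationBound {C : CommitmentScheme}
    (hn : (fun t => ((P t).n : ℝ)) =O[atTop] fun t : ℕ => (t : ℝ))
    (hq : SoftO (fun t => ((P t).n : ℝ)) (fun t => ((P t).q : ℝ)) fun t => ((P t).n : ℝ) ^ 4)
    (hlen : ∃ K : ℝ, ∀ᶠ t in atTop,
      (C.coinLen t : ℝ) ≤ K * ((P t).L * Real.log (P t).q) ∧
      ∀ pk ∈ (C.key t).support, ∀ (m : Val) (ρ : C.Coin t),
        ((C.com pk m (C.coin ρ)).size : ℝ) ≤ K * (m.size + (P t).L * Real.log (P t).q)) :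
    ∃ T : ℕ → ℝ, CommunicationBound C P T ∧
      T =O[atTop] (fun t => ((P t).L : ℝ) * Real.log (P t).q) ∧
      T =O[atTop] (fun t => ((P t).n : ℝ) ^ 2 * Real.log (P t).n ^ 4) ∧
      SoftO (fun t => (t : ℝ)) T fun t => (t : ℝ) ^ 2 := by
  obtain ⟨K, hK⟩ := hlen
  have h1 : (fun t => (118159 * |K| + 56907) * ((P t).L * Real.log (P t).q)) =O[atTop]
      fun t => ((P t).L : ℝ) * Real.log (P t).q := (isBigO_refl _ _).const_mul_left _
  have h2 : (fun t => ((P t).L : ℝ) * Real.log (P t).q) =O[atTop]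
      fun t => ((P t).n : ℝ) ^ 2 * Real.log (P t).n ^ 4 := by
    refine IsBigO.trans (IsBigO.of_bound 324 (Eventually.of_forall fun t => ?_))
      ((isBigO_refl (fun t => ((P t).n : ℝ) ^ 2) _).mul ((log_q_isBigO hq).pow 4))
    have h3 := one_le_L_mul_log (P := P t)
    rw [Real.norm_of_nonneg (by linarith), Real.norm_of_nonneg (by positivity)]
    exact L_mul_log_le
  refine ⟨_, ?_, h1, h1.trans h2, 4, (h1.trans h2).trans ((hn.pow 2).mul ((log_n_isBigO hn).pow 4))⟩
  refine hK.mono fun t ht c w _ pk hpk s ch => ?_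
  have hX := one_le_L_mul_log (P := P t)
  refine size_transcript_le (abs_nonneg K) (ht.1.trans ?_) (fun m ρ => (ht.2 pk hpk m ρ).trans ?_)
    w s ch
  · gcongr; exact le_abs_self K
  · gcongr; exact le_abs_self K

end Asymptotic

end Stern

end

theorem mainTheorem3 (P : ℕ → Params)
    (hn : (fun t => ((P t).n : ℝ)) =O[atTop] fun t : ℕ => (t : ℝ))
    (hq : SoftO (fun t => ((P t).n : ℝ)) (fun t => ((P t).q : ℝ)) fun t => ((P t).n : ℝ) ^ 4)
    (hB : SoftO (fun t => ((P t).n : ℝ)) (fun t => ((P t).B : ℝ)) fun t => Real.sqrt (P t).n)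
    (C : CommitmentScheme) (hide : C.StatisticallyHiding) (bind : C.ComputationallyBinding)
    (hlen : ∃ K : ℝ, ∀ᶠ t in atTop,
      (C.coinLen t : ℝ) ≤ K * ((P t).L * Real.log (P t).q) ∧
      ∀ pk ∈ (C.key t).support, ∀ (m : Val) (ρ : C.Coin t),
        ((C.com pk m (C.coin ρ)).size : ℝ) ≤ K * (m.size + (P t).L * Real.log (P t).q)) :
    -- the permutations of the extended products
    (∀ (a b g e : Trit) (v : Trit × Trit → ℤ),
      v = mult3 a g ↔ permPhi b e v = mult3 (br3 ((a : ℤ) + b)) (br3 ((g : ℤ) + e))) ∧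
    (∀ (ι κ : Type) (a b : ι → Trit) (g e : κ → Trit) (v : ι → κ → Trit × Trit → ℤ),
      v = multV a g ↔ permPhiV b e v = multV (addT a b) (addT g e)) ∧
    -- the conditions on `VALID`, the label set and the permutations
    (∀ t, (∀ (η : (P t).Label) (v : (P t).Idx → ℤ),
        v ∈ (P t).VALID ↔ Params.Gam η v ∈ (P t).VALID) ∧
      ∀ w ∈ (P t).VALID, ∀ v ∈ (P t).VALID,
        (PMF.uniformOfFintype (P t).Label).map (fun η => Params.Gam η w) v =
          ((P t).VALID.ncard : ENNReal)⁻¹) ∧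
    -- the relation as a linear equation with solution in `VALID`
    (∀ t, ∀ (c : (P t).Stmt) (w : (P t).Witness), Params.secret w ∈ (P t).VALID ∧
      ((P t).Bounded w.g → (∀ i, (P t).Bounded (w.e i)) →
        ((c = fun i => w.a i * w.g + w.e i) ↔
          (P t).M.mulVec (Params.red (Params.secret w)) = Params.target c))) ∧
    -- the protocol is a statistical zero-knowledge argument of knowledge
    Stern.Efficient C P ∧
    Stern.PerfectlyComplete C P ∧
    Stern.StatisticalZK C P ∧
    Stern.ArgumentOfKnowledge C P ∧
    -- communication cost
    (∃ T : ℕ → ℝ, Stern.CommunicationBound C P T ∧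
      T =O[atTop] (fun t => ((P t).L : ℝ) * Real.log (P t).q) ∧
      T =O[atTop] (fun t => ((P t).n : ℝ) ^ 2 * Real.log (P t).n ^ 4) ∧
      SoftO (fun t => (t : ℝ)) T fun t => (t : ℝ) ^ 2) := by
  have hN := polyN_n hn
  have hQ := polyN_q hn hq
  have hL := polyN_L hn hq
  have hcoin : PolyN C.coinLen := by
    obtain ⟨K, hK⟩ := hlen
    exact Stern.polyN_coinLen hL hQ (hK.mono fun t ht => ht.1)
  exact ⟨fun a b g e v => eq_mult3_iff a b g e v, fun ι κ a b g e v => eq_multV_iff a b g e v,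
    fun t => ⟨fun η v => Params.mem_VALID_iff_Gam η v, fun w hw v hv =>
      Params.map_Gam_uniform_apply hw hv⟩,
    fun t c w => ⟨Params.secret_mem_VALID w, Params.eq_iff_M_mulVec_secret c⟩,
    Stern.efficient C P, Stern.perfectlyComplete C P,
    Stern.statisticalZK hide (polyN_messages hn hq),
    Stern.argumentOfKnowledge bind fun c z hz => Stern.polyLength_advice hN hQ hL hcoin c hz,
    Stern.exists_communicationBound hn hq hlen⟩
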